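/- All functions are real- or complex-valued, Lebesgue measurable on $(0,\infty)$, and identified when equal almost everywhere; $L^1$ and $L^\infty$ are the Lebesgue spaces on $(0,\infty)$. The level function $f^o$ of $f$ is the derivative (defined almost everywhere) of the least concave majorant of $x\mapsto\int_0^x|f|$ if that majorant is finite; otherwise $f^o=\lim_{k\to\infty}\min(|f|,k)^o$, an increasing limit. Let $(L^\infty)^o$ be the Banach space of all $f$ with $f^o\in L^\infty$, normed by $\|f\|_{(L^\infty)^o}=\|f^o\|_{L^\infty}$. For compatible couples of Banach spaces $(X_0,X_1)$ and $(Y_0,Y_1)$, write $T:(X_0,X_1)\to(Y_0,Y_1)$ if $T:X_0+X_1\to Y_0+Y_1$ is linear and restricts to a bounded map $X_j\to Y_j$ for $j=0,1$; the norm of $T$ is the larger of the norms of these two restrictions. Let $K(t,x;X_0,X_1)=\inf\{\|x_0\|_{X_0}+t\|x_1\|_{X_1}:x_0\in X_0,\ x_1\in X_1,\ x_0+x_1=x\}$. The couples $(X_0,X_1)$ and $(Y_0,Y_1)$ form a $c$-uniform relative Calderón–Mityagin pair $[(X_0,X_1),(Y_0,Y_1)]$ if, whenever $x\in X_0+X_1$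 and $y\in Y_0+Y_1$ satisfy $K(t,y;Y_0,Y_1)\le K(t,x;X_0,X_1)$ for all $t>0$, there is a $T:(X_0,X_1)\to(Y_0,Y_1)$ of norm at most $c$ with $Tx=y$. The pair is exact if this holds with $c=1$, and $(X_0,X_1)$ is an exact Calderón–Mityagin couple if $[(X_0,X_1),(X_0,X_1)]$ is an exact pair. Call $n\ge 0$ admissible if for each $f\in L^1+(L^\infty)^o$ there is a linear operator $N:(L^1,(L^\infty)^o)\to(L^1,L^\infty)$ of norm at most $n$ with $Nf=f^o$. **Theorem.** The constant $n=2$ is admissible. If $n$ is any admissible constant, then: (a) $(L^1,(L^\infty)^o)$ is an exact Calderón–Mityagin couple; (b) $[(L^1,L^\infty),(L^1,(L^\infty)^o)]$ is an exact relative Calderón–Mityagin pair; (c) $[(L^1,(L^\infty)^o),(L^1,L^\infty)]$ is an $n$-uniform relative Calderón–Mityagin pair; (d) $[(L^1,(L^\infty)^o),(L^1,L^\infty)]$ is not an exact relative Calderón–Mityagin pair. -/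

import Mathlib

open MeasureTheory Set Filter Topology
open scoped ENNReal NNReal

namespace CalderonMityagin

/-- Lebesgue measure on the half line `(0, ∞)`. -/
noncomputable abbrev halfLine : Measure ℝ := volume.restrict (Ioi 0)

/-- `x ↦ ∫₀ˣ u`, with values in `[0, ∞]`. -/
noncomputable def primitive (u : ℝ → ℝ≥0∞) (x : ℝ) : ℝ≥0∞ := ∫⁻ y in Ioo 0 x, u y

/-- `φ` is a (finite) concave majorant of the non-negative function `F` on `(0, ∞)`. -/
def IsConcaveMajorant (F : ℝ → ℝ≥0∞) (φ : ℝ → ℝ) : Prop :=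
  ConcaveOn ℝ (Ioi 0) φ ∧ ∀ y, 0 < y → 0 ≤ φ y ∧ F y ≤ ENNReal.ofReal (φ y)

/-- The least concave majorant of `F` on `(0, ∞)`: the pointwise infimum of all finite concave
majorants, which is `∞` if there are none. -/
noncomputable def leastConcaveMajorant (F : ℝ → ℝ≥0∞) (x : ℝ) : ℝ≥0∞ :=
  ⨅ (φ : ℝ → ℝ) (_ : IsConcaveMajorant F φ), ENNReal.ofReal (φ x)

/-- The derivative of the least concave majorant of `x ↦ ∫₀ˣ u`; the level function of `u` when
this majorant is finite. (A finite concave function is differentiable almost everywhere.) -/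
noncomputable def levelDeriv (u : ℝ → ℝ≥0∞) (x : ℝ) : ℝ≥0∞ :=
  ENNReal.ofReal (deriv (fun y => (leastConcaveMajorant (primitive u) y).toReal) x)

open Classical in
/-- The level function `uᵒ` of a non-negative function `u` on `(0, ∞)`: the derivative of the
least concave majorant of `x ↦ ∫₀ˣ u` if the latter is finite, and otherwise the limit of the
increasing sequence of the level functions of the truncations `min (u, n)`. -/
noncomputable def levelFunction (u : ℝ → ℝ≥0∞) (x : ℝ) : ℝ≥0∞ :=
  if ∀ y, 0 < y → leastConcaveMajorant (primitive u) y ≠ ∞ then levelDeriv u x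
  else ⨆ n : ℕ, levelDeriv (fun y => min (u y) n) x

section LevelFacts

variable {F : ℝ → ℝ≥0∞} {u : ℝ → ℝ≥0∞}

theorem leastConcaveMajorant_le {φ : ℝ → ℝ} (h : IsConcaveMajorant F φ) (x : ℝ) :
    leastConcaveMajorant F x ≤ ENNReal.ofReal (φ x) := iInf₂_le φ h

theorem le_leastConcaveMajorant {x : ℝ} (hx : 0 < x) : F x ≤ leastConcaveMajorant F x :=
  le_iInf₂ fun _ h => (h.2 x hx).2

theorem toReal_lcm_le {φ : ℝ → ℝ} (h : IsConcaveMajorant F φ) {x : ℝ} (hx : 0 < x) :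
    (leastConcaveMajorant F x).toReal ≤ φ x :=
  ENNReal.toReal_le_of_le_ofReal (h.2 x hx).1 (leastConcaveMajorant_le h x)

theorem le_toReal_lcm {x c : ℝ} (hfin : leastConcaveMajorant F x ≠ ∞)
    (h : ∀ φ, IsConcaveMajorant F φ → c ≤ φ x) :
    c ≤ (leastConcaveMajorant F x).toReal := by
  refine (ENNReal.ofReal_le_iff_le_toReal hfin).1 (le_iInf₂ fun φ hφ => ?_)
  exact ENNReal.ofReal_le_ofReal (h φ hφ)

theorem concaveOn_lcm (hfin : ∀ y, 0 < y → leastConcaveMajorant F y ≠ ∞) :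
    ConcaveOn ℝ (Ioi 0) fun y => (leastConcaveMajorant F y).toReal := by
  refine ⟨convex_Ioi 0, fun x hx y hy a b ha hb hab => ?_⟩
  have hz : 0 < a • x + b • y := (convex_Ioi (0 : ℝ)) hx hy ha hb hab
  refine le_toReal_lcm (hfin _ hz) fun φ hφ => ?_
  refine le_trans ?_ (hφ.1.2 hx hy ha hb hab)
  have h1 := toReal_lcm_le hφ hx
  have h2 := toReal_lcm_le hφ hy
  simp only [smul_eq_mul]
  gcongr

theorem monotoneOn_of_concaveOn {g : ℝ → ℝ} (hg : ConcaveOn ℝ (Ioi 0) g)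
    (h0 : ∀ y, 0 ≤ g y) : MonotoneOn g (Ioi 0) := by
  intro x hx y hy hxy
  by_contra! hlt
  have hxy' : x < y := lt_of_le_of_ne hxy (by rintro rfl; exact lt_irrefl _ hlt)
  set s := (g y - g x) / (y - x) with hs
  have hs0 : s < 0 := div_neg_of_neg_of_pos (by linarith) (by linarith)
  set z := y + (g y + 1) / (-s) with hz
  have hp : 0 < (g y + 1) / (-s) := div_pos (by linarith [h0 y]) (by linarith)
  have hyz : y < z := by linarith
  have h := hg.slope_anti_adjacent hx (show z ∈ Ioi (0 : ℝ) from lt_trans hy hyz) hxy' hyz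
  rw [← hs, div_le_iff₀ (by linarith)] at h
  have : s * (z - y) = -(g y + 1) := by
    have hs1 : s ≠ 0 := hs0.ne
    rw [hz]; field_simp; ring
  linarith [h0 z]

theorem isConcaveMajorant_affine {a b : ℝ} (ha : 0 ≤ a) (hb : 0 ≤ b)
    (h : ∀ y, 0 < y → F y ≤ ENNReal.ofReal (a + b * y)) :
    IsConcaveMajorant F fun y => a + b * y := by
  refine ⟨?_, fun y hy => ⟨by positivity, h y hy⟩⟩
  refine ⟨convex_Ioi 0, fun x _ y _ s t _ _ hst => le_of_eq ?_⟩
  simp only [smul_eq_mul]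
  linear_combination (a : ℝ) * hst

theorem lcm_ne_top_of_linear {M : ℝ≥0} (h : ∀ x, 0 < x → F x ≤ M * ENNReal.ofReal x) :
    IsConcaveMajorant F fun y => 0 + (M : ℝ) * y := by
  refine isConcaveMajorant_affine le_rfl M.2 fun y hy => (h y hy).trans (le_of_eq ?_)
  rw [zero_add, ENNReal.ofReal_mul M.coe_nonneg, ENNReal.ofReal_coe_nnreal]

theorem levelDeriv_le {M : ℝ≥0} (h : ∀ x, 0 < x → primitive u x ≤ M * ENNReal.ofReal x)
    {x : ℝ} (hx : 0 < x) : levelDeriv u x ≤ M := by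
  have hmaj := lcm_ne_top_of_linear h
  have hfin : ∀ y, 0 < y → leastConcaveMajorant (primitive u) y ≠ ∞ := fun y _ =>
    ne_top_of_le_ne_top ENNReal.ofReal_ne_top (leastConcaveMajorant_le hmaj y)
  have hc := concaveOn_lcm hfin
  rw [levelDeriv, ENNReal.ofReal_le_iff_le_toReal ENNReal.coe_ne_top, ENNReal.coe_toReal]
  set g := fun y => (leastConcaveMajorant (primitive u) y).toReal with hg
  by_cases hd : DifferentiableAt ℝ g x
  swap
  · rw [deriv_zero_of_not_differentiableAt hd]; exact M.2
  have key : ∀ y, 0 < y → y < x → deriv g x * (x - y) ≤ M * x := by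
    intro y hy hyx
    have h1 := hc.deriv_le_slope hy hx hyx hd
    rw [slope_def_field, le_div_iff₀ (by linarith)] at h1
    have h2 : g x ≤ 0 + M * x := toReal_lcm_le hmaj hx
    have h3 : 0 ≤ g y := ENNReal.toReal_nonneg
    linarith
  have hlim : Tendsto (fun y => deriv g x * (x - y)) (𝓝[>] 0) (𝓝 (deriv g x * (x - 0))) :=
    (Continuous.tendsto (by fun_prop) 0).mono_left nhdsWithin_le_nhds
  have := le_of_tendsto hlim (by
    filter_upwards [Ioo_mem_nhdsGT hx] with y hy using key y hy.1 hy.2)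
  rw [sub_zero] at this
  exact le_of_mul_le_mul_right this hx

theorem primitive_mono {x y : ℝ} (h : x ≤ y) : primitive u x ≤ primitive u y :=
  lintegral_mono_set (Ioo_subset_Ioo_right h)

theorem exists_primitive_le {x : ℝ} (hx : 0 < x) (h : primitive u x ≠ ∞) {ε : ℝ} (hε : 0 < ε) :
    ∃ δ, 0 < δ ∧ primitive u δ ≤ ENNReal.ofReal ε := by
  obtain ⟨η, hη, H⟩ := exists_pos_setLIntegral_lt_of_measure_lt (μ := volume.restrict (Ioo 0 x))
    (f := u) h (ENNReal.ofReal_pos.2 hε).ne'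
  obtain ⟨r, hr0, hr⟩ : ∃ r : ℝ, 0 < r ∧ ENNReal.ofReal r < η := by
    obtain ⟨q, hq0, hq⟩ := ENNReal.lt_iff_exists_nnreal_btwn.1 hη
    exact ⟨q, by exact_mod_cast hq0, by simpa using hq⟩
  refine ⟨min r x, lt_min hr0 hx, ?_⟩
  have h2 := H (Ioo 0 (min r x)) (by
    refine lt_of_le_of_lt (Measure.restrict_apply_le _ _) (lt_of_le_of_lt ?_ hr)
    rw [Real.volume_Ioo]
    exact ENNReal.ofReal_le_ofReal (by simp))
  rw [Measure.restrict_restrict measurableSet_Ioo,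
    inter_eq_left.2 (Ioo_subset_Ioo_right (min_le_right _ _))] at h2
  exact h2.le

theorem primitive_le_of_levelDeriv_le {M : ℝ≥0}
    (hfin : ∀ y, 0 < y → leastConcaveMajorant (primitive u) y ≠ ∞)
    (h : ∀ᵐ x ∂halfLine, levelDeriv u x ≤ M) {x : ℝ} (hx : 0 < x) :
    primitive u x ≤ M * ENNReal.ofReal x := by
  have hc := concaveOn_lcm hfin
  have hle : ∀ y, 0 < y → primitive u y ≤ ENNReal.ofReal
      (leastConcaveMajorant (primitive u) y).toReal := fun y hy => by
    rw [ENNReal.ofReal_toReal (hfin y hy)]; exact le_leastConcaveMajorant hy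
  have hle' : ∀ φ, IsConcaveMajorant (primitive u) φ → ∀ y, 0 < y →
      (leastConcaveMajorant (primitive u) y).toReal ≤ φ y := fun φ hφ y hy => toReal_lcm_le hφ hy
  unfold levelDeriv at h
  set g := fun y => (leastConcaveMajorant (primitive u) y).toReal with hg
  have hg0 : ∀ y, 0 ≤ g y := fun y => ENNReal.toReal_nonneg
  have hmono := monotoneOn_of_concaveOn hc hg0
  have step : ∀ y z, 0 < y → y < z → g z ≤ g y + M * (z - y) := by
    intro y z hy hyz
    have hdiff : ∀ᵐ w ∂halfLine, DifferentiableWithinAt ℝ g (Ioi 0) w :=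
      (ae_restrict_iff' measurableSet_Ioi).2 hmono.ae_differentiableWithinAt_of_mem
    have hboth := h.and hdiff
    obtain ⟨w, hw, hw1, hw2⟩ : ∃ w ∈ Ioo 0 y, ENNReal.ofReal (deriv g w) ≤ M ∧
        DifferentiableWithinAt ℝ g (Ioi 0) w := by
      by_contra! hcon
      have hnull : halfLine (Ioo 0 y) = 0 := by
        refine measure_mono_null (fun w hw => ?_) (ae_iff.1 hboth)
        exact fun hh => hcon w hw hh.1 hh.2
      rw [Measure.restrict_apply measurableSet_Ioo, inter_eq_left.2 Ioo_subset_Ioi_self,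
        Real.volume_Ioo] at hnull
      simp only [sub_zero, ENNReal.ofReal_eq_zero] at hnull
      linarith
    have hd : DifferentiableAt ℝ g w := hw2.differentiableAt (Ioi_mem_nhds hw.1)
    rw [ENNReal.ofReal_le_iff_le_toReal ENNReal.coe_ne_top, ENNReal.coe_toReal] at hw1
    have h1 := hc.slope_le_deriv hw.1 hy hw.2 hd
    rw [slope_def_field] at h1
    have h2 := hc.slope_anti_adjacent hw.1 (lt_trans hy hyz : (0:ℝ) < z) hw.2 hyz
    have h3 := h2.trans (h1.trans hw1)
    rw [div_le_iff₀ (by linarith)] at h3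
    linarith
  have main : ∀ ε : ℝ, 0 < ε → g x ≤ ε + M * x := by
    intro ε hε
    obtain ⟨δ, hδ, hδε⟩ := exists_primitive_le hx
      (ne_top_of_le_ne_top ENNReal.ofReal_ne_top (hle x hx)) hε
    set C : ℝ := g δ / δ + M with hC
    have hC0 : 0 ≤ C := add_nonneg (div_nonneg (hg0 _) hδ.le) M.2
    have hmaj : IsConcaveMajorant (primitive u) fun y => ε + C * y := by
      refine isConcaveMajorant_affine hε.le hC0 fun y hy => ?_
      rcases le_total y δ with hyδ | hyδ
      · exact (primitive_mono hyδ).trans (hδε.trans (ENNReal.ofReal_le_ofReal (by nlinarith)))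
      · refine (hle y hy).trans (ENNReal.ofReal_le_ofReal ?_)
        have h1 : g y ≤ g δ + M * (y - δ) := by
          rcases eq_or_lt_of_le hyδ with rfl | hlt
          · simp
          · exact step δ y hδ hlt
        have h2 : g δ ≤ g δ / δ * y := by
          calc g δ = g δ / δ * δ := by field_simp
            _ ≤ g δ / δ * y := mul_le_mul_of_nonneg_left hyδ (div_nonneg (hg0 _) hδ.le)
        have h3 : (M : ℝ) * (y - δ) ≤ M * y := by
          nlinarith [M.coe_nonneg]
        show g y ≤ ε + C * y
        rw [hC]; nlinarith
    have hb := hle' _ hmaj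
    have hlim : Tendsto (fun y => ε + C * y + M * (x - y)) (𝓝[>] 0)
        (𝓝 (ε + C * 0 + M * (x - 0))) :=
      (Continuous.tendsto (by fun_prop) 0).mono_left nhdsWithin_le_nhds
    have := ge_of_tendsto hlim (b := g x) (by
      filter_upwards [Ioo_mem_nhdsGT hx] with y hy
      have h1 : g y ≤ ε + C * y := hb y hy.1
      linarith [step y x hy.1 hy.2])
    simpa using this
  have hfinal : g x ≤ M * x := le_of_forall_pos_le_add fun ε hε => by linarith [main ε hε]
  refine (hle x hx).trans ((ENNReal.ofReal_le_ofReal hfinal).trans (le_of_eq ?_))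
  rw [ENNReal.ofReal_mul M.coe_nonneg, ENNReal.ofReal_coe_nnreal]

/-- The essential supremum of the level function is `sup_{x > 0} (1/x) ∫₀ˣ u`. -/
theorem essSup_levelFunction_le_iff (hu : AEMeasurable u halfLine) (M : ℝ≥0∞) :
    essSup (levelFunction u) halfLine ≤ M ↔
      ∀ x, 0 < x → primitive u x ≤ M * ENNReal.ofReal x := by
  induction M with
  | top =>
    refine iff_of_true le_top fun x hx => ?_
    rw [ENNReal.top_mul (ENNReal.ofReal_pos.2 hx).ne']
    exact le_top
  | coe M =>
    constructor
    · intro h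
      have hae : ∀ᵐ x ∂halfLine, levelFunction u x ≤ M := by
        filter_upwards [ENNReal.ae_le_essSup (μ := halfLine) (levelFunction u)] with x hx
        exact hx.trans h
      by_cases hfin : ∀ y, 0 < y → leastConcaveMajorant (primitive u) y ≠ ∞
      · simp only [levelFunction, if_pos hfin] at hae
        exact fun x hx => primitive_le_of_levelDeriv_le hfin hae hx
      · simp only [levelFunction, if_neg hfin, iSup_le_iff] at hae
        have htr : ∀ (n : ℕ) (x : ℝ), 0 < x →
            primitive (fun y => min (u y) n) x ≤ M * ENNReal.ofReal x := by
          intro n x hx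
          have hlin : ∀ z, 0 < z → primitive (fun y => min (u y) n) z ≤
              ((n : ℝ≥0) : ℝ≥0∞) * ENNReal.ofReal z := by
            intro z hz
            calc primitive (fun y => min (u y) n) z
                ≤ ∫⁻ _ in Ioo 0 z, (n : ℝ≥0∞) := lintegral_mono fun y => min_le_right _ _
              _ = _ := by simp
          refine primitive_le_of_levelDeriv_le (fun y _ => ?_) ?_ hx
          · exact ne_top_of_le_ne_top ENNReal.ofReal_ne_top
              (leastConcaveMajorant_le (lcm_ne_top_of_linear hlin) y)
          · filter_upwards [hae] with y hy using hy n
        intro x hx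
        have hmc : primitive u x = ⨆ n : ℕ, primitive (fun y => min (u y) n) x := by
          unfold primitive
          rw [← lintegral_iSup']
          · refine lintegral_congr fun y => ?_
            refine le_antisymm ?_ (iSup_le fun n => min_le_left _ _)
            refine le_of_forall_lt fun c hc => ?_
            obtain ⟨n, hn⟩ := ENNReal.exists_nat_gt (ne_top_of_lt hc)
            exact lt_of_lt_of_le (lt_min hc hn) (le_iSup (fun n : ℕ => min (u y) n) n)
          · intro n
            exact ((hu.mono_measure (Measure.restrict_mono Ioo_subset_Ioi_self le_rfl)).min
              aemeasurable_const)
          · refine Eventually.of_forall fun y m n hmn => ?_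
            exact min_le_min_left _ (by exact_mod_cast hmn)
        rw [hmc]
        exact iSup_le fun n => htr n x hx
    · intro h
      have hfin : ∀ y, 0 < y → leastConcaveMajorant (primitive u) y ≠ ∞ := fun y _ =>
        ne_top_of_le_ne_top ENNReal.ofReal_ne_top
          (leastConcaveMajorant_le (lcm_ne_top_of_linear h) y)
      refine essSup_le_of_ae_le _ ?_
      filter_upwards [ae_restrict_mem measurableSet_Ioi] with x hx
      simp only [levelFunction, if_pos hfin]
      exact levelDeriv_le h hx

end LevelFacts

/-! ### Banach spaces and couples inside a common vector space -/

section Couples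

variable (𝕜 : Type*) [RCLike 𝕜]

/-- A Banach space that is a linear subspace of a vector space `V`, given by its norm, extended by `∞` to the vectors outside the space. -/
structure BanachSubspace (V : Type*) [AddCommGroup V] [Module 𝕜 V] where
  /-- The norm; the space consists of the vectors of finite norm. -/
  nrm : V → ℝ≥0∞
  eq_zero : ∀ v, nrm v = 0 → v = 0
  smul_eq : ∀ (c : 𝕜) (v : V), nrm (c • v) = ‖c‖ₑ * nrm v
  add_le : ∀ v w, nrm (v + w) ≤ nrm v + nrm w
  complete : ∀ s : ℕ → V, (∀ k, nrm (s k) < ∞) →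
    (∀ ε : ℝ≥0∞, 0 < ε → ∃ N, ∀ m, N ≤ m → ∀ n, N ≤ n → nrm (s m - s n) < ε) →
    ∃ v, nrm v < ∞ ∧ Tendsto (fun n => nrm (s n - v)) atTop (𝓝 0)

variable {𝕜} {V W : Type*} [AddCommGroup V] [Module 𝕜 V] [AddCommGroup W] [Module 𝕜 W]

/-- The underlying vector space of a Banach subspace. -/
def BanachSubspace.space (X : BanachSubspace 𝕜 V) : Submodule 𝕜 V where
  carrier := {v | X.nrm v < ∞}
  zero_mem' := by
    have h := X.smul_eq 0 0
    rw [enorm_zero, zero_mul, smul_zero] at h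
    simp [h]
  add_mem' {v w} hv hw := lt_of_le_of_lt (X.add_le v w) (ENNReal.add_lt_top.2 ⟨hv, hw⟩)
  smul_mem' c v hv := by
    show X.nrm (c • v) < ∞
    rw [X.smul_eq]
    exact ENNReal.mul_lt_top enorm_lt_top hv

variable (𝕜 V) in
/-- A compatible couple `(X₀, X₁)` of Banach spaces. The condition `separated` says that
`inf {‖x₀‖ + ‖x₁‖ : x₀ + x₁ = x}` is a norm on `X₀ + X₁`; it holds if and only if `X₀` and `X₁`
embed continuously, with the given identifications, in some Hausdorff topological vector space. -/
structure CompatibleCouple where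
  X₀ : BanachSubspace 𝕜 V
  X₁ : BanachSubspace 𝕜 V
  separated : ∀ v, (∀ ε : ℝ≥0∞, 0 < ε → ∃ a b, a + b = v ∧ X₀.nrm a + X₁.nrm b < ε) → v = 0

namespace CompatibleCouple

/-- The space `X₀ + X₁`. -/
def sum (X : CompatibleCouple 𝕜 V) : Submodule 𝕜 V := X.X₀.space ⊔ X.X₁.space

/-- The `K`-functional `K(t, x; X₀, X₁)`. (Decompositions with `x₀ ∉ X₀` or `x₁ ∉ X₁` contribute
the value `∞` when `t > 0`.) -/
noncomputable def K (X : CompatibleCouple 𝕜 V) (t : ℝ≥0) (x : V) : ℝ≥0∞ :=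
  ⨅ (x₀ : V) (x₁ : V) (_ : x₀ + x₁ = x), X.X₀.nrm x₀ + t * X.X₁.nrm x₁

/-- The linear operator `T : X₀ + X₁ → Y₀ + Y₁` maps `X_j` boundedly into `Y_j` for `j = 0, 1`,
and its norm as an operator `(X₀, X₁) → (Y₀, Y₁)` is at most `c`. -/
def NormAtMost {X : CompatibleCouple 𝕜 V} {Y : CompatibleCouple 𝕜 W} (T : X.sum →ₗ[𝕜] Y.sum)
    (c : ℝ≥0) : Prop :=
  (∀ x : X.sum, (x : V) ∈ X.X₀.space → Y.X₀.nrm (T x) ≤ c * X.X₀.nrm x) ∧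
  (∀ x : X.sum, (x : V) ∈ X.X₁.space → Y.X₁.nrm (T x) ≤ c * X.X₁.nrm x)

/-- `[(X₀, X₁), (Y₀, Y₁)]` is a `c`-uniform relative Calderón–Mityagin pair. -/
def IsRelativeCMPair (c : ℝ≥0) (X : CompatibleCouple 𝕜 V) (Y : CompatibleCouple 𝕜 W) : Prop :=
  ∀ (x : X.sum) (y : Y.sum), (∀ t : ℝ≥0, 0 < t → Y.K t y ≤ X.K t x) →
    ∃ T : X.sum →ₗ[𝕜] Y.sum, NormAtMost T c ∧ T x = y

/-- Exact relative Calderón–Mityagin pairs. -/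
def IsExactRelativeCMPair (X : CompatibleCouple 𝕜 V) (Y : CompatibleCouple 𝕜 W) : Prop :=
  IsRelativeCMPair 1 X Y

/-- Exact Calderón–Mityagin couples. -/
def IsExactCMCouple (X : CompatibleCouple 𝕜 V) : Prop :=
  IsExactRelativeCMPair X X

end CompatibleCouple

end Couples

/-! ### The spaces `L¹`, `L^∞` and `(L^∞)ᵒ` on the half line -/

section Spaces

variable (𝕜 : Type*) [RCLike 𝕜]

/-- Measurable functions on `(0, ∞)`, up to equality almost everywhere. -/
abbrev L0 : Type _ := ℝ →ₘ[halfLine] 𝕜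

/-- The Lebesgue space `Lᵖ` on `(0, ∞)`. -/
noncomputable def lebesgue (p : ℝ≥0∞) (hp : 1 ≤ p) : BanachSubspace 𝕜 (L0 𝕜) where
  nrm f := eLpNorm f p halfLine
  eq_zero f h := by
    rw [eLpNorm_eq_zero_iff f.aestronglyMeasurable (by positivity)] at h
    exact AEEqFun.ext (h.trans AEEqFun.coeFn_zero.symm)
  smul_eq c f := by
    rw [eLpNorm_congr_ae (AEEqFun.coeFn_smul c f), eLpNorm_const_smul]
  add_le f g := by
    rw [eLpNorm_congr_ae (AEEqFun.coeFn_add f g)]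
    exact eLpNorm_add_le f.aestronglyMeasurable g.aestronglyMeasurable hp
  complete s hs hc := by
    have : Fact (1 ≤ p) := ⟨hp⟩
    let σ : ℕ → Lp 𝕜 p halfLine := fun k => ⟨s k, Lp.mem_Lp_iff_eLpNorm_lt_top.2 (hs k)⟩
    have hσ : ∀ (m : ℕ) (g : Lp 𝕜 p halfLine),
        edist (σ m) g = eLpNorm (s m - (g : L0 𝕜) : L0 𝕜) p halfLine := fun m g => by
      rw [Lp.edist_def]
      exact (eLpNorm_congr_ae (AEEqFun.coeFn_sub _ _)).symm
    have hcs : CauchySeq σ := by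
      refine EMetric.cauchySeq_iff.2 fun ε hε => ?_
      obtain ⟨N, hN⟩ := hc ε hε
      exact ⟨N, fun m hm n hn => by rw [hσ]; exact hN m hm n hn⟩
    obtain ⟨g, hg⟩ := cauchySeq_tendsto_of_complete hcs
    refine ⟨g, Lp.mem_Lp_iff_eLpNorm_lt_top.1 g.2, ?_⟩
    simpa only [hσ] using tendsto_iff_edist_tendsto_0.1 hg

variable {𝕜}

/-- The norm of `f` in `(L^∞)ᵒ`, that is, the `L^∞` norm of the level function of `f`. -/
noncomputable def levelNorm (f : L0 𝕜) : ℝ≥0∞ :=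
  essSup (levelFunction fun x => ‖f x‖ₑ) halfLine

theorem levelNorm_le_iff (f : L0 𝕜) (M : ℝ≥0∞) : levelNorm f ≤ M ↔
    ∀ x, 0 < x → ∫⁻ y in Ioo 0 x, ‖f y‖ₑ ≤ M * ENNReal.ofReal x :=
  essSup_levelFunction_le_iff f.aestronglyMeasurable.enorm M

theorem lintegral_le_levelNorm (f : L0 𝕜) {x : ℝ} (hx : 0 < x) :
    ∫⁻ y in Ioo 0 x, ‖f y‖ₑ ≤ levelNorm f * ENNReal.ofReal x :=
  (levelNorm_le_iff f _).1 le_rfl x hx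

theorem ae_Ioo {P : ℝ → Prop} (h : ∀ᵐ x ∂halfLine, P x) (x : ℝ) :
    ∀ᵐ y ∂volume.restrict (Ioo 0 x), P y :=
  ae_mono (Measure.restrict_mono Ioo_subset_Ioi_self le_rfl) h

theorem ae_halfLine {P : ℝ → Prop} (h : ∀ n : ℕ, ∀ᵐ y ∂volume.restrict (Ioo (0 : ℝ) (n + 1)), P y) :
    ∀ᵐ x ∂halfLine, P x := by
  have hU : Ioi (0 : ℝ) = ⋃ n : ℕ, Ioo (0 : ℝ) (n + 1) := by
    ext x
    simp only [mem_Ioi, mem_iUnion, mem_Ioo]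
    refine ⟨fun hx => ?_, fun ⟨n, hn⟩ => hn.1⟩
    obtain ⟨n, hn⟩ := exists_nat_gt x
    exact ⟨n, hx, by linarith⟩
  rw [halfLine, hU, ae_restrict_iUnion_iff]
  exact h

theorem levelNorm_eq_zero (f : L0 𝕜) (h : levelNorm f = 0) : f = 0 := by
  refine AEEqFun.ext (EventuallyEq.trans ?_ AEEqFun.coeFn_zero.symm)
  refine ae_halfLine fun n => ?_
  have h1 := lintegral_le_levelNorm f (x := n + 1) (by positivity)
  rw [h, zero_mul, nonpos_iff_eq_zero, lintegral_eq_zero_iff'] at h1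
  · filter_upwards [h1] with y hy
    simpa using hy
  · exact (f.aestronglyMeasurable.mono_measure
      (Measure.restrict_mono Ioo_subset_Ioi_self le_rfl)).enorm

theorem levelNorm_smul_le (c : 𝕜) (f : L0 𝕜) : levelNorm (c • f) ≤ ‖c‖ₑ * levelNorm f := by
  refine (levelNorm_le_iff _ _).2 fun x hx => ?_
  have h : ∫⁻ y in Ioo 0 x, ‖(c • f : L0 𝕜) y‖ₑ = ‖c‖ₑ * ∫⁻ y in Ioo 0 x, ‖f y‖ₑ := by
    rw [← lintegral_const_mul' _ _ enorm_ne_top]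
    refine lintegral_congr_ae ?_
    filter_upwards [ae_Ioo (AEEqFun.coeFn_smul c f) x] with y hy
    rw [hy, Pi.smul_apply, enorm_smul]
  rw [h, mul_assoc]
  gcongr
  exact lintegral_le_levelNorm f hx

theorem levelNorm_add_le (f g : L0 𝕜) : levelNorm (f + g) ≤ levelNorm f + levelNorm g := by
  refine (levelNorm_le_iff _ _).2 fun x hx => ?_
  calc ∫⁻ y in Ioo 0 x, ‖(f + g : L0 𝕜) y‖ₑ
      ≤ ∫⁻ y in Ioo 0 x, (‖f y‖ₑ + ‖g y‖ₑ) := by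
        refine lintegral_mono_ae ?_
        filter_upwards [ae_Ioo (AEEqFun.coeFn_add f g) x] with y hy
        rw [hy]
        exact enorm_add_le _ _
    _ = (∫⁻ y in Ioo 0 x, ‖f y‖ₑ) + ∫⁻ y in Ioo 0 x, ‖g y‖ₑ :=
        lintegral_add_left' (f.aestronglyMeasurable.mono_measure
          (Measure.restrict_mono Ioo_subset_Ioi_self le_rfl)).enorm _
    _ ≤ (levelNorm f + levelNorm g) * ENNReal.ofReal x := by
        rw [add_mul]
        exact add_le_add (lintegral_le_levelNorm f hx) (lintegral_le_levelNorm g hx)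

theorem levelNorm_complete (s : ℕ → L0 𝕜) (hs : ∀ k, levelNorm (s k) < ∞)
    (hc : ∀ ε : ℝ≥0∞, 0 < ε → ∃ N, ∀ m, N ≤ m → ∀ n, N ≤ n → levelNorm (s m - s n) < ε) :
    ∃ v, levelNorm v < ∞ ∧ Tendsto (fun n => levelNorm (s n - v)) atTop (𝓝 0) := by
  have hmeas : ∀ (f : L0 𝕜) (x : ℝ), AEStronglyMeasurable f (volume.restrict (Ioo 0 x)) :=
    fun f x => f.aestronglyMeasurable.mono_measure
      (Measure.restrict_mono Ioo_subset_Ioi_self le_rfl)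
  choose N hN using fun k : ℕ => hc ((2 : ℝ≥0∞)⁻¹ ^ k)
    (ENNReal.pow_pos (ENNReal.inv_pos.2 (by simp)) k)
  -- a rapidly Cauchy subsequence
  let κ : ℕ → ℕ := fun k => k + ∑ i ∈ Finset.range (k + 1), N i
  have hκ : ∀ i k, i ≤ k → N i ≤ κ k := fun i k hik => by
    have h := Finset.single_le_sum (f := N) (fun _ _ => Nat.zero_le _)
      (Finset.mem_range.2 (Nat.lt_succ_of_le hik))
    exact h.trans (Nat.le_add_left _ _)
  have hκk : ∀ k, k ≤ κ k := fun k => Nat.le_add_right _ _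
  have hlim : ∀ᵐ x ∂halfLine, ∃ l : 𝕜, Tendsto (fun k => s (κ k) x) atTop (𝓝 l) := by
    refine ae_halfLine fun n => ?_
    have hpos : ENNReal.ofReal ((n : ℝ) + 1) ≠ 0 := (ENNReal.ofReal_pos.2 (by positivity)).ne'
    refine Lp.ae_tendsto_of_cauchy_eLpNorm (p := 1) (fun k => hmeas _ _) le_rfl
      (B := fun k => (2 : ℝ≥0∞)⁻¹ ^ k * ENNReal.ofReal ((n : ℝ) + 1)) ?_ fun k i j hi hj => ?_
    · rw [ENNReal.tsum_mul_right, ENNReal.tsum_geometric]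
      exact ENNReal.mul_ne_top (by simp) ENNReal.ofReal_ne_top
    · rw [eLpNorm_one_eq_lintegral_enorm]
      calc ∫⁻ y in Ioo (0 : ℝ) (n + 1), ‖(⇑(s (κ i)) - ⇑(s (κ j))) y‖ₑ
          = ∫⁻ y in Ioo (0 : ℝ) (n + 1), ‖(s (κ i) - s (κ j) : L0 𝕜) y‖ₑ := by
            refine lintegral_congr_ae ?_
            filter_upwards [ae_Ioo (AEEqFun.coeFn_sub (s (κ i)) (s (κ j))) (n + 1)] with y hy
            rw [hy]
        _ ≤ levelNorm (s (κ i) - s (κ j)) * ENNReal.ofReal ((n : ℝ) + 1) :=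
            lintegral_le_levelNorm _ (by positivity)
        _ < (2 : ℝ≥0∞)⁻¹ ^ k * ENNReal.ofReal ((n : ℝ) + 1) :=
            ENNReal.mul_lt_mul_left hpos ENNReal.ofReal_ne_top (hN k _ (hκ k i hi) _ (hκ k j hj))
  obtain ⟨v, hvm, hv⟩ := exists_stronglyMeasurable_limit_of_tendsto_ae
    (fun k => (s (κ k)).aestronglyMeasurable) hlim
  let w : L0 𝕜 := AEEqFun.mk v hvm.aestronglyMeasurable
  have hw : ∀ᵐ x ∂halfLine, Tendsto (fun k => s (κ k) x) atTop (𝓝 (w x)) := by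
    filter_upwards [hv, AEEqFun.coeFn_mk v hvm.aestronglyMeasurable] with x h1 h2
    rw [h2]; exact h1
  have hbd : ∀ (ε : ℝ≥0∞) (m : ℕ), (∃ K, ∀ n, K ≤ n → levelNorm (s m - s n) ≤ ε) →
      levelNorm (s m - w) ≤ ε := by
    rintro ε m ⟨K, hK⟩
    refine (levelNorm_le_iff _ _).2 fun x hx => ?_
    calc ∫⁻ y in Ioo 0 x, ‖(s m - w : L0 𝕜) y‖ₑ
        = ∫⁻ y in Ioo 0 x, liminf (fun k => ‖(s m - s (κ k) : L0 𝕜) y‖ₑ) atTop := by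
          refine lintegral_congr_ae ?_
          have hall := ae_all_iff.2 fun k => AEEqFun.coeFn_sub (s m) (s (κ k))
          filter_upwards [ae_Ioo hw x, ae_Ioo (AEEqFun.coeFn_sub (s m) w) x, ae_Ioo hall x]
            with y h1 h2 h3
          rw [h2]
          simp only [h3, Pi.sub_apply]
          exact ((tendsto_const_nhds.sub h1).enorm.liminf_eq).symm
      _ ≤ liminf (fun k => ∫⁻ y in Ioo 0 x, ‖(s m - s (κ k) : L0 𝕜) y‖ₑ) atTop :=
          lintegral_liminf_le' fun k => (hmeas _ _).enorm
      _ ≤ ε * ENNReal.ofReal x := by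
          refine liminf_le_of_frequently_le' (Eventually.frequently ?_)
          filter_upwards [eventually_ge_atTop K] with k hk
          refine (lintegral_le_levelNorm _ hx).trans ?_
          gcongr
          exact hK _ (hk.trans (hκk k))
  have htend : Tendsto (fun n => levelNorm (s n - w)) atTop (𝓝 0) := by
    refine ENNReal.tendsto_nhds_zero.2 fun ε hε => ?_
    obtain ⟨M, hM⟩ := hc ε hε
    filter_upwards [eventually_ge_atTop M] with m hm
    exact hbd ε m ⟨M, fun n hn => (hM m hm n hn).le⟩
  refine ⟨w, ?_, htend⟩
  obtain ⟨m, hm⟩ := ((ENNReal.tendsto_nhds_zero.1 htend) 1 one_pos).exists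
  have h1 : w = s m + (-1 : 𝕜) • (s m - w) := by
    have h2 : (-1 : 𝕜) • (s m - w) = -(s m - w) := neg_one_smul 𝕜 (s m - w)
    rw [h2, neg_sub, add_sub_cancel]
  rw [h1]
  refine lt_of_le_of_lt (levelNorm_add_le _ _) (ENNReal.add_lt_top.2 ⟨hs m, ?_⟩)
  refine lt_of_le_of_lt (levelNorm_smul_le _ _) (ENNReal.mul_lt_top enorm_lt_top ?_)
  exact lt_of_le_of_lt hm ENNReal.one_lt_top

variable (𝕜)

/-- The space `(L^∞)ᵒ` of the functions whose level function belongs to `L^∞`. -/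
noncomputable def levelLinfty : BanachSubspace 𝕜 (L0 𝕜) where
  nrm := levelNorm
  eq_zero := levelNorm_eq_zero
  smul_eq c f := by
    refine le_antisymm (levelNorm_smul_le c f) ?_
    rcases eq_or_ne c 0 with rfl | hc
    · simp
    have h := levelNorm_smul_le c⁻¹ (c • f)
    rw [smul_smul, inv_mul_cancel₀ hc, one_smul] at h
    calc ‖c‖ₑ * levelNorm f ≤ ‖c‖ₑ * (‖c⁻¹‖ₑ * levelNorm (c • f)) := by gcongr
      _ = levelNorm (c • f) := by
        rw [← mul_assoc, ← enorm_mul, mul_inv_cancel₀ hc, enorm_one, one_mul]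
  add_le := levelNorm_add_le
  complete := levelNorm_complete

variable {𝕜}

theorem levelNorm_le_eLpNorm (f : L0 𝕜) : levelNorm f ≤ eLpNorm f ∞ halfLine := by
  refine (levelNorm_le_iff _ _).2 fun x hx => ?_
  calc ∫⁻ y in Ioo 0 x, ‖f y‖ₑ ≤ ∫⁻ _ in Ioo 0 x, eLpNorm f ∞ halfLine := by
        refine lintegral_mono_ae ?_
        rw [eLpNorm_exponent_top]
        exact ae_Ioo (enorm_ae_le_eLpNormEssSup f halfLine) x
    _ = _ := by simp

theorem separated_level (v : L0 𝕜)
    (h : ∀ ε : ℝ≥0∞, 0 < ε → ∃ a b : L0 𝕜, a + b = v ∧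
      eLpNorm a 1 halfLine + levelNorm b < ε) : v = 0 := by
  refine levelNorm_eq_zero v (nonpos_iff_eq_zero.1 ((levelNorm_le_iff _ _).2 fun x hx => ?_))
  rw [zero_mul]
  refine le_of_forall_gt fun δ hδ => ?_
  have hC : (1 + ENNReal.ofReal x) ≠ ∞ := by simp
  have hC0 : (1 + ENNReal.ofReal x) ≠ 0 := by simp
  obtain ⟨a, b, rfl, hab⟩ := h (δ / (1 + ENNReal.ofReal x)) (ENNReal.div_pos hδ.ne' hC)
  calc ∫⁻ y in Ioo 0 x, ‖(a + b : L0 𝕜) y‖ₑ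
      ≤ ∫⁻ y in Ioo 0 x, (‖a y‖ₑ + ‖b y‖ₑ) := by
        refine lintegral_mono_ae ?_
        filter_upwards [ae_Ioo (AEEqFun.coeFn_add a b) x] with y hy
        rw [hy]
        exact enorm_add_le _ _
    _ = (∫⁻ y in Ioo 0 x, ‖a y‖ₑ) + ∫⁻ y in Ioo 0 x, ‖b y‖ₑ :=
        lintegral_add_left' (a.aestronglyMeasurable.mono_measure
          (Measure.restrict_mono Ioo_subset_Ioi_self le_rfl)).enorm _
    _ ≤ eLpNorm a 1 halfLine + levelNorm b * ENNReal.ofReal x := by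
        refine add_le_add ?_ (lintegral_le_levelNorm b hx)
        rw [eLpNorm_one_eq_lintegral_enorm]
        exact lintegral_mono_set Ioo_subset_Ioi_self
    _ ≤ (eLpNorm a 1 halfLine + levelNorm b) * (1 + ENNReal.ofReal x) := by
        rw [add_mul, mul_add, mul_add, mul_one, mul_one]
        exact add_le_add le_self_add le_add_self
    _ < δ := (ENNReal.lt_div_iff_mul_lt (Or.inl hC0) (Or.inl hC)).1 hab

variable (𝕜)

/-- The couple `(L¹, L^∞)` on the half line. -/
noncomputable def coupleL1Linfty : CompatibleCouple 𝕜 (L0 𝕜) where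
  X₀ := lebesgue 𝕜 1 le_rfl
  X₁ := lebesgue 𝕜 ∞ le_top
  separated v h := separated_level v fun ε hε => by
    obtain ⟨a, b, hab, hlt⟩ := h ε hε
    exact ⟨a, b, hab, lt_of_le_of_lt (add_le_add le_rfl (levelNorm_le_eLpNorm b)) hlt⟩

/-- The couple `(L¹, (L^∞)ᵒ)` on the half line. -/
noncomputable def coupleL1LevelLinfty : CompatibleCouple 𝕜 (L0 𝕜) where
  X₀ := lebesgue 𝕜 1 le_rfl
  X₁ := levelLinfty 𝕜
  separated := separated_level

/-- The constant `n` is such that for each `f ∈ L¹ + (L^∞)ᵒ` there is a linear operator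
`N : (L¹, (L^∞)ᵒ) → (L¹, L^∞)` of norm at most `n` with `N f = fᵒ`. -/
def IsLevelConstant (n : ℝ≥0) : Prop :=
  ∀ f : (coupleL1LevelLinfty 𝕜).sum,
    ∃ N : (coupleL1LevelLinfty 𝕜).sum →ₗ[𝕜] (coupleL1Linfty 𝕜).sum,
      CompatibleCouple.NormAtMost N n ∧
      ∀ᵐ x ∂halfLine, (N f : L0 𝕜) x =
        (((levelFunction fun y => ‖(f : L0 𝕜) y‖ₑ) x).toReal : 𝕜)

end Spaces

end CalderonMityagin

open CalderonMityagin

/-!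
The couple `(L¹, (L^∞)ᵒ)` has the K-functional `∫₀ᵗ fᵒ`, and `(L¹, L^∞)` has `∫₀ᵗ f*`, with `f*` the
decreasing rearrangement. If the primitive of `|y|` is below that of `|f|`, then `y` arises from `f`
by moving mass to the right, which is an operator of norm one on `(L¹, (L^∞)ᵒ)`. In particular, `fᵒ`
can be taken to `f`; conversely `f` is taken to `fᵒ` by averaging over the intervals on which the
primitive of `|f|` is strictly below its least concave majorant. On `(L¹, L^∞)`, disintegration
along the level sets takes `f` to `f*` and back. So one may start from a decreasing function, for
which an inequality between K-functionals is an inequality between primitives. Finally,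
`h ↦ (p(x) / ∫_{x/2}^x p) ∫_{x/2}^x h`, with the decreasing function `p = fᵒ`, takes `p` to itself
and has norm at most two from `(L¹, (L^∞)ᵒ)` to `(L¹, L^∞)`.

Norm one cannot be had for the decreasing function `χ[0,1) + χ[0,2)`. Suppose that an operator of
norm one takes it to itself, and let `u`, `v`, `w` be the images of `χ[0,1)`, `χ[1,2)`, `χ[0,2)`.
Since `χ[0,1)` has norm `1` in `L¹`, and `χ[1,2)`, `χ[0,2)` have norms `1/2`, `1` in `(L^∞)ᵒ`, we
have `‖u‖₁ ≤ 1`, `|v| ≤ 1/2` and `|w| ≤ 1`. But `u + w = 2` on `[0,1)` forces `|u| ≥ 1` there, and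
`2u + v = 1` on `[1,2)` forces `|u| ≥ 1/4` there, so `‖u‖₁ ≥ 5/4`.
-/

namespace CalderonMityagin

/-! ### Images under operators between couples -/

namespace CompatibleCouple

section Images

variable {𝕜 : Type*} [RCLike 𝕜] {U V W : Type*} [AddCommGroup U] [Module 𝕜 U]
  [AddCommGroup V] [Module 𝕜 V] [AddCommGroup W] [Module 𝕜 W]
  {X : CompatibleCouple 𝕜 V} {Y : CompatibleCouple 𝕜 W}

/-- `y` is the image of `x` under some operator `X → Y` of norm at most `c`. Images compose, so an
operator taking `x` to `y` can be found by passing through intermediate vectors. -/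
def IsImage (c : ℝ≥0) (X : CompatibleCouple 𝕜 V) (Y : CompatibleCouple 𝕜 W) (x : V) (y : W) :
    Prop :=
  ∃ (hx : x ∈ X.sum) (T : X.sum →ₗ[𝕜] Y.sum), NormAtMost T c ∧ (T ⟨x, hx⟩ : W) = y

theorem isRelativeCMPair_of_isImage {c : ℝ≥0}
    (h : ∀ x ∈ X.sum, ∀ y ∈ Y.sum, (∀ t : ℝ≥0, 0 < t → Y.K t y ≤ X.K t x) →
      IsImage c X Y x y) : IsRelativeCMPair c X Y := fun x y hxy =>
  let ⟨_, T, hT, hTx⟩ := h x x.2 y y.2 hxy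
  ⟨T, hT, Subtype.ext hTx⟩

theorem mem_sum_left {v : V} (h : X.X₀.nrm v < ∞) : v ∈ X.sum :=
  Submodule.mem_sup_left h

theorem mem_sum_right {v : V} (h : X.X₁.nrm v < ∞) : v ∈ X.sum :=
  Submodule.mem_sup_right h

theorem mem_sum_iff {v : V} :
    v ∈ X.sum ↔ ∃ a b, X.X₀.nrm a < ∞ ∧ X.X₁.nrm b < ∞ ∧ a + b = v := by
  rw [sum, Submodule.mem_sup]
  exact ⟨fun ⟨a, ha, b, hb, h⟩ => ⟨a, b, ha, hb, h⟩, fun ⟨a, b, ha, hb, h⟩ => ⟨a, ha, b, hb, h⟩⟩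

theorem K_le_add (X : CompatibleCouple 𝕜 V) (t : ℝ≥0) (a b : V) :
    X.K t (a + b) ≤ X.X₀.nrm a + t * X.X₁.nrm b :=
  (iInf₂_le a b).trans (iInf_le _ rfl)

theorem NormAtMost.comp {c d : ℝ≥0} {Z : CompatibleCouple 𝕜 U} {S : Y.sum →ₗ[𝕜] Z.sum}
    {T : X.sum →ₗ[𝕜] Y.sum} (hS : NormAtMost S d) (hT : NormAtMost T c) :
    NormAtMost (S ∘ₗ T) (d * c) := by
  have bound {p q r : ℝ≥0∞} (hp : p < ∞) (hq : q ≤ c * p) (hr : q < ∞ → r ≤ d * q) :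
      r ≤ (d * c : ℝ≥0) * p := by
    rw [ENNReal.coe_mul, mul_assoc]
    exact (hr (hq.trans_lt (ENNReal.mul_lt_top ENNReal.coe_lt_top hp))).trans (by gcongr)
  exact ⟨fun v hv => bound hv (hT.1 v hv) (hS.1 (T v)),
    fun v hv => bound hv (hT.2 v hv) (hS.2 (T v))⟩

theorem IsImage.mem_right {c : ℝ≥0} {x : V} {y : W} (h : IsImage c X Y x y) : y ∈ Y.sum :=
  let ⟨_, _, _, hy⟩ := h
  hy ▸ Subtype.coe_prop _

theorem IsImage.trans {c d : ℝ≥0} {Z : CompatibleCouple 𝕜 U} {x : V} {y : W} {z : U}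
    (h₁ : IsImage c X Y x y) (h₂ : IsImage d Y Z y z) : IsImage (d * c) X Z x z := by
  obtain ⟨hx, T, hT, rfl⟩ := h₁
  obtain ⟨_, S, hS, rfl⟩ := h₂
  exact ⟨hx, S ∘ₗ T, hS.comp hT, rfl⟩

theorem IsImage.trans_one {c : ℝ≥0} {Z : CompatibleCouple 𝕜 U} {x : V} {y : W} {z : U}
    (h₁ : IsImage c X Y x y) (h₂ : IsImage 1 Y Z y z) : IsImage c X Z x z :=
  one_mul c ▸ h₁.trans h₂

theorem IsImage.one_trans {c : ℝ≥0} {Z : CompatibleCouple 𝕜 U} {x : V} {y : W} {z : U}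
    (h₁ : IsImage 1 X Y x y) (h₂ : IsImage c Y Z y z) : IsImage c X Z x z :=
  mul_one c ▸ h₁.trans h₂

theorem IsImage.of_map {c : ℝ≥0}
    (T : V → W) (hadd : ∀ v ∈ X.sum, ∀ w ∈ X.sum, T (v + w) = T v + T w)
    (hsmul : ∀ (r : 𝕜), ∀ v ∈ X.sum, T (r • v) = r • T v)
    (h₀ : ∀ v, X.X₀.nrm v < ∞ → Y.X₀.nrm (T v) ≤ c * X.X₀.nrm v)
    (h₁ : ∀ v, X.X₁.nrm v < ∞ → Y.X₁.nrm (T v) ≤ c * X.X₁.nrm v)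
    {x : V} (hx : x ∈ X.sum) : IsImage c X Y x (T x) := by
  have hmem : ∀ v ∈ X.sum, T v ∈ Y.sum := by
    intro v hv
    obtain ⟨a, b, ha, hb, rfl⟩ := mem_sum_iff.1 hv
    rw [hadd a (mem_sum_left ha) b (mem_sum_right hb)]
    refine add_mem (mem_sum_left ?_) (mem_sum_right ?_)
    · exact (h₀ a ha).trans_lt (ENNReal.mul_lt_top ENNReal.coe_lt_top ha)
    · exact (h₁ b hb).trans_lt (ENNReal.mul_lt_top ENNReal.coe_lt_top hb)
  exact ⟨hx,
    { toFun := fun v => ⟨T v, hmem v v.2⟩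
      map_add' := fun v w => Subtype.ext (hadd v v.2 w w.2)
      map_smul' := fun r v => Subtype.ext (hsmul r v v.2) },
    ⟨fun v => h₀ v, fun v => h₁ v⟩, rfl⟩

theorem IsImage.K_le {x : V} {y : W} (h : IsImage 1 X Y x y) {t : ℝ≥0} (ht : 0 < t) :
    Y.K t y ≤ X.K t x := by
  obtain ⟨hx, T, hT, rfl⟩ := h
  refine le_iInf₂ fun a b => le_iInf fun hab => ?_
  subst hab
  rcases eq_or_ne (X.X₀.nrm a) ∞ with ha | ha
  · simp [ha]
  rcases eq_or_ne (X.X₁.nrm b) ∞ with hb | hb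
  · simp [hb, ENNReal.mul_top, ht.ne']
  have ha' : a ∈ X.sum := mem_sum_left (lt_top_iff_ne_top.2 ha)
  have hb' : b ∈ X.sum := mem_sum_right (lt_top_iff_ne_top.2 hb)
  have hTab : (T ⟨a + b, hx⟩ : W) = T ⟨a, ha'⟩ + T ⟨b, hb'⟩ := by
    rw [← Submodule.coe_add, ← map_add]
    rfl
  have hTa := hT.1 ⟨a, ha'⟩ (lt_top_iff_ne_top.2 ha)
  have hTb := hT.2 ⟨b, hb'⟩ (lt_top_iff_ne_top.2 hb)
  simp only [ENNReal.coe_one, one_mul] at hTa hTb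
  rw [hTab]
  exact (K_le_add Y t _ _).trans (by gcongr)

end Images

end CompatibleCouple

/-! ### Functions on the half line -/

section FunctionSpaces

open CompatibleCouple

variable {𝕜 : Type*} [RCLike 𝕜]

theorem isImage_of_fun {c : ℝ≥0} {X Y : CompatibleCouple 𝕜 (L0 𝕜)} (T : L0 𝕜 → ℝ → 𝕜)
    (hm : ∀ h ∈ X.sum, AEStronglyMeasurable (T h) halfLine)
    (hadd : ∀ h ∈ X.sum, ∀ k ∈ X.sum, ∀ᵐ x ∂halfLine, T (h + k) x = T h x + T k x)
    (hsmul : ∀ (r : 𝕜), ∀ h ∈ X.sum, ∀ᵐ x ∂halfLine, T (r • h) x = r * T h x)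
    (h₀ : ∀ h k : L0 𝕜, X.X₀.nrm h < ∞ → k =ᵐ[halfLine] T h → Y.X₀.nrm k ≤ c * X.X₀.nrm h)
    (h₁ : ∀ h k : L0 𝕜, X.X₁.nrm h < ∞ → k =ᵐ[halfLine] T h → Y.X₁.nrm k ≤ c * X.X₁.nrm h)
    {x y : L0 𝕜} (hx : x ∈ X.sum) (hxy : y =ᵐ[halfLine] T x) : IsImage c X Y x y := by
  classical
  let S : L0 𝕜 → L0 𝕜 := fun h => if hh : h ∈ X.sum then AEEqFun.mk (T h) (hm h hh) else 0
  have hS : ∀ h ∈ X.sum, S h =ᵐ[halfLine] T h := fun h hh => by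
    simp only [S, dif_pos hh]
    exact AEEqFun.coeFn_mk _ _
  have hSx : S x = y := AEEqFun.ext ((hS x hx).trans hxy.symm)
  rw [← hSx]
  refine IsImage.of_map S (fun h hh k hk => AEEqFun.ext ?_) (fun r h hh => AEEqFun.ext ?_)
    (fun h hh => h₀ h _ hh (hS h (mem_sum_left hh)))
    (fun h hh => h₁ h _ hh (hS h (mem_sum_right hh))) hx
  · filter_upwards [hS _ (add_mem hh hk), hS h hh, hS k hk, AEEqFun.coeFn_add (S h) (S k),
      hadd h hh k hk] with x h1 h2 h3 h4 h5
    rw [h1, h4, Pi.add_apply, h2, h3, h5]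
  · filter_upwards [hS _ (X.sum.smul_mem r hh), hS h hh, AEEqFun.coeFn_smul r (S h),
      hsmul r h hh] with x h1 h2 h3 h4
    rw [h1, h3, Pi.smul_apply, h2, h4, smul_eq_mul]

theorem nrm_L1 (h : L0 𝕜) : (lebesgue 𝕜 1 le_rfl).nrm h = ∫⁻ x in Ioi 0, ‖h x‖ₑ :=
  eLpNorm_one_eq_lintegral_enorm

theorem nrm_Linfty_le_iff (h : L0 𝕜) (M : ℝ≥0∞) :
    (lebesgue 𝕜 ∞ le_top).nrm h ≤ M ↔ ∀ᵐ x ∂halfLine, ‖h x‖ₑ ≤ M := by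
  change eLpNorm h ∞ halfLine ≤ M ↔ _
  rw [eLpNorm_exponent_top]
  refine ⟨fun H => ?_, fun H => essSup_le_of_ae_le _ H⟩
  filter_upwards [enorm_ae_le_eLpNormEssSup h halfLine] with x hx using hx.trans H

theorem setLIntegral_Ioo_le (u : ℝ → ℝ≥0∞) (t : ℝ) :
    ∫⁻ x in Ioo 0 t, u x ≤ ∫⁻ x in Ioi 0, u x := lintegral_mono_set Ioo_subset_Ioi_self

theorem aestronglyMeasurable_Ioo (h : L0 𝕜) (t : ℝ) :
    AEStronglyMeasurable h (volume.restrict (Ioo 0 t)) :=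
  h.aestronglyMeasurable.mono_measure (Measure.restrict_mono Ioo_subset_Ioi_self le_rfl)

theorem lintegral_add_le_add (a b : L0 𝕜) (t : ℝ) :
    ∫⁻ x in Ioo 0 t, ‖(a + b : L0 𝕜) x‖ₑ ≤
      (∫⁻ x in Ioo 0 t, ‖a x‖ₑ) + ∫⁻ x in Ioo 0 t, ‖b x‖ₑ := by
  rw [← lintegral_add_left' (aestronglyMeasurable_Ioo a t).enorm]
  refine lintegral_mono_ae ?_
  filter_upwards [ae_Ioo (AEEqFun.coeFn_add a b) t] with y hy
  rw [hy]
  exact enorm_add_le _ _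

/-- The elements of `L⁰` that are integrable near `0`, so that `x ↦ ∫₀ˣ |h|` is finite. They
include `L¹ + (L^∞)ᵒ`. -/
def HasFinitePrimitive (h : L0 𝕜) : Prop := ∀ t, IntegrableOn h (Ioo 0 t)

theorem hasFinitePrimitive_iff {h : L0 𝕜} :
    HasFinitePrimitive h ↔ ∀ t, 0 < t → ∫⁻ x in Ioo 0 t, ‖h x‖ₑ < ∞ := by
  refine ⟨fun hh t _ => (hh t).2, fun hh t => ⟨aestronglyMeasurable_Ioo h t, ?_⟩⟩
  rcases le_or_gt t 0 with ht | ht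
  · simp [Ioo_eq_empty (not_lt.2 ht)]
  · exact hh t ht

theorem exists_affine_bound {h : L0 𝕜} (hh : h ∈ (coupleL1LevelLinfty 𝕜).sum) :
    ∃ A B : ℝ≥0, ∀ t, 0 < t →
      ∫⁻ x in Ioo 0 t, ‖h x‖ₑ ≤ A + B * ENNReal.ofReal t := by
  obtain ⟨a, b, ha, hb, rfl⟩ := mem_sum_iff.1 hh
  refine ⟨(∫⁻ x in Ioi 0, ‖a x‖ₑ).toNNReal, (levelNorm b).toNNReal, fun t ht => ?_⟩
  have ha' : ∫⁻ x in Ioi 0, ‖a x‖ₑ ≠ ∞ := by rw [← nrm_L1]; exact ha.ne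
  rw [ENNReal.coe_toNNReal ha', ENNReal.coe_toNNReal (show levelNorm b ≠ ∞ from hb.ne)]
  exact (lintegral_add_le_add a b t).trans
    (add_le_add (setLIntegral_Ioo_le _ _) (lintegral_le_levelNorm b ht))

theorem hasFinitePrimitive_of_mem_sum {h : L0 𝕜} (hh : h ∈ (coupleL1LevelLinfty 𝕜).sum) :
    HasFinitePrimitive h := by
  obtain ⟨A, B, hAB⟩ := exists_affine_bound hh
  exact hasFinitePrimitive_iff.2 fun t ht =>
    (hAB t ht).trans_lt (ENNReal.add_lt_top.2 ⟨by simp, ENNReal.mul_lt_top (by simp) (by simp)⟩)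

theorem sum_le_sum_level : (coupleL1Linfty 𝕜).sum ≤ (coupleL1LevelLinfty 𝕜).sum := by
  intro v hv
  obtain ⟨a, b, ha, hb, rfl⟩ := mem_sum_iff.1 hv
  exact add_mem (mem_sum_left ha) (mem_sum_right ((levelNorm_le_eLpNorm b).trans_lt hb))

theorem isImage_inclusion {x : L0 𝕜} (hx : x ∈ (coupleL1Linfty 𝕜).sum) :
    IsImage 1 (coupleL1Linfty 𝕜) (coupleL1LevelLinfty 𝕜) x x :=
  IsImage.of_map id (fun _ _ _ _ => rfl) (fun _ _ _ => rfl) (fun v _ => by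
    rw [ENNReal.coe_one, one_mul]; exact le_rfl) (fun v _ => by
    rw [ENNReal.coe_one, one_mul]; exact levelNorm_le_eLpNorm v) hx

/-- Both spaces of the couple are normed lattices of functions: their norms are monotone in the
modulus of the function. -/
def IsSolid (X : CompatibleCouple 𝕜 (L0 𝕜)) : Prop :=
  ∀ h k : L0 𝕜, (∀ᵐ x ∂halfLine, ‖k x‖ₑ ≤ ‖h x‖ₑ) →
    X.X₀.nrm k ≤ X.X₀.nrm h ∧ X.X₁.nrm k ≤ X.X₁.nrm h

theorem nrm_L1_mono {h k : L0 𝕜} (hk : ∀ᵐ x ∂halfLine, ‖k x‖ₑ ≤ ‖h x‖ₑ) :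
    (lebesgue 𝕜 1 le_rfl).nrm k ≤ (lebesgue 𝕜 1 le_rfl).nrm h := by
  rw [nrm_L1, nrm_L1]
  exact lintegral_mono_ae hk

theorem isSolid_coupleL1Linfty : IsSolid (coupleL1Linfty 𝕜) := fun h k hk =>
  ⟨nrm_L1_mono hk, (nrm_Linfty_le_iff k _).2 (by
    filter_upwards [hk, (nrm_Linfty_le_iff h _).1 le_rfl] with x h1 h2 using h1.trans h2)⟩

theorem isSolid_coupleL1LevelLinfty : IsSolid (coupleL1LevelLinfty 𝕜) := fun h k hk =>
  ⟨nrm_L1_mono hk, (levelNorm_le_iff k _).2 fun t ht =>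
    (lintegral_mono_ae (ae_Ioo hk t)).trans (lintegral_le_levelNorm h ht)⟩

theorem isImage_of_enorm_le {X : CompatibleCouple 𝕜 (L0 𝕜)} (hX : IsSolid X) {f k : L0 𝕜}
    (hf : f ∈ X.sum) (hk : ∀ᵐ x ∂halfLine, ‖k x‖ₑ ≤ ‖f x‖ₑ) : IsImage 1 X X f k := by
  let T : L0 𝕜 → ℝ → 𝕜 := fun h x => k x / f x * h x
  have hbd : ∀ h v : L0 𝕜, v =ᵐ[halfLine] T h → ∀ᵐ x ∂halfLine, ‖v x‖ₑ ≤ ‖h x‖ₑ := by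
    intro h v hv
    filter_upwards [hv, hk] with x h1 h2
    rw [h1, ← ofReal_norm, ← ofReal_norm, norm_mul, norm_div]
    refine ENNReal.ofReal_le_ofReal (mul_le_of_le_one_left (norm_nonneg _) ?_)
    rw [← ofReal_norm, ← ofReal_norm, ENNReal.ofReal_le_ofReal_iff (norm_nonneg _)] at h2
    exact div_le_one_of_le₀ h2 (norm_nonneg _)
  refine isImage_of_fun T (fun h _ => ?_) (fun h _ v _ => ?_) (fun r h _ => ?_)
    (fun h v _ hv => ?_) (fun h v _ hv => ?_) hf ?_
  · exact ((k.stronglyMeasurable.measurable.div f.stronglyMeasurable.measurable).mul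
      h.stronglyMeasurable.measurable).aestronglyMeasurable
  · filter_upwards [AEEqFun.coeFn_add h v] with x hx
    simp only [T, hx, Pi.add_apply, mul_add]
  · filter_upwards [AEEqFun.coeFn_smul r h] with x hx
    simp only [T, hx, Pi.smul_apply, smul_eq_mul]
    ring
  · rw [ENNReal.coe_one, one_mul]
    exact (hX h v (hbd h v hv)).1
  · rw [ENNReal.coe_one, one_mul]
    exact (hX h v (hbd h v hv)).2
  · filter_upwards [hk] with x hx
    rcases eq_or_ne (f x) 0 with h0 | h0
    · rw [h0, enorm_zero, nonpos_iff_eq_zero, enorm_eq_zero] at hx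
      simp [T, hx]
    · simp only [T]
      rw [div_mul_cancel₀ _ h0]

theorem lintegral_le_K (y : L0 𝕜) {t : ℝ≥0} (ht : 0 < t) :
    ∫⁻ x in Ioo 0 (t : ℝ), ‖y x‖ₑ ≤ (coupleL1LevelLinfty 𝕜).K t y := by
  refine le_iInf₂ fun a b => le_iInf fun hab => ?_
  subst hab
  refine (lintegral_add_le_add a b t).trans (add_le_add ?_ ?_)
  · exact (setLIntegral_Ioo_le _ _).trans (nrm_L1 a).ge
  · refine (lintegral_le_levelNorm b (by exact_mod_cast ht)).trans ?_
    rw [mul_comm, ENNReal.ofReal_coe_nnreal]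
    exact le_rfl

theorem K_level_le_K (t : ℝ≥0) (x : L0 𝕜) :
    (coupleL1LevelLinfty 𝕜).K t x ≤ (coupleL1Linfty 𝕜).K t x := by
  refine le_iInf₂ fun a b => le_iInf fun hab => ?_
  subst hab
  refine (K_le_add _ t a b).trans ?_
  exact add_le_add le_rfl (mul_le_mul le_rfl (levelNorm_le_eLpNorm b) zero_le zero_le)

theorem enorm_ofReal_of_nonneg {r : ℝ} (hr : 0 ≤ r) : ‖(r : 𝕜)‖ₑ = ENNReal.ofReal r := by
  rw [← ofReal_norm, RCLike.norm_ofReal, abs_of_nonneg hr]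

/-- The elements of `L⁰` that have a decreasing non-negative representative. -/
def IsDecreasing (w : L0 𝕜) : Prop :=
  ∃ p : ℝ → ℝ, Measurable p ∧ AntitoneOn p (Ioi 0) ∧ (∀ x, 0 ≤ p x) ∧
    ∀ᵐ x ∂halfLine, w x = (p x : 𝕜)

theorem K_le_of_truncation {w : L0 𝕜} {p : ℝ → ℝ} (hpm : Measurable p) (hp0 : ∀ x, 0 ≤ p x)
    (hwp : ∀ᵐ x ∂halfLine, w x = (p x : 𝕜)) (t : ℝ≥0) {s : ℝ} (hs : 0 ≤ s) :
    (coupleL1Linfty 𝕜).K t w ≤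
      (∫⁻ x in Ioi 0, ENNReal.ofReal (p x - s)) + t * ENNReal.ofReal s := by
  have hma : AEStronglyMeasurable (fun x => ((max (p x - s) 0 : ℝ) : 𝕜)) halfLine :=
    (RCLike.measurable_ofReal.comp ((hpm.sub_const s).max measurable_const)).aestronglyMeasurable
  have hmb : AEStronglyMeasurable (fun x => ((min (p x) s : ℝ) : 𝕜)) halfLine :=
    (RCLike.measurable_ofReal.comp (hpm.min measurable_const)).aestronglyMeasurable
  set a : L0 𝕜 := AEEqFun.mk _ hma
  set b : L0 𝕜 := AEEqFun.mk _ hmb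
  have ha : ∀ᵐ x ∂halfLine, a x = ((max (p x - s) 0 : ℝ) : 𝕜) := AEEqFun.coeFn_mk _ hma
  have hb : ∀ᵐ x ∂halfLine, b x = ((min (p x) s : ℝ) : 𝕜) := AEEqFun.coeFn_mk _ hmb
  have hab : a + b = w := by
    refine AEEqFun.ext ?_
    filter_upwards [AEEqFun.coeFn_add a b, ha, hb, hwp] with x hadd hax hbx hwx
    rw [hadd, Pi.add_apply, hax, hbx, hwx, ← RCLike.ofReal_add]
    congr 1
    rcases le_total (p x) s with h | h
    · rw [max_eq_right (by linarith), min_eq_left h, zero_add]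
    · rw [max_eq_left (by linarith), min_eq_right h, sub_add_cancel]
  have ha_nrm : (lebesgue 𝕜 1 le_rfl).nrm a = ∫⁻ x in Ioi 0, ENNReal.ofReal (p x - s) := by
    rw [nrm_L1]
    refine lintegral_congr_ae ?_
    filter_upwards [ha] with x hax
    rw [hax, enorm_ofReal_of_nonneg (le_max_right _ _), ENNReal.ofReal_max, ENNReal.ofReal_zero,
      max_eq_left zero_le]
  have hb_nrm : (lebesgue 𝕜 ∞ le_top).nrm b ≤ ENNReal.ofReal s := by
    refine (nrm_Linfty_le_iff _ _).2 ?_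
    filter_upwards [hb] with x hbx
    rw [hbx, enorm_ofReal_of_nonneg (le_min (hp0 x) hs)]
    exact ENNReal.ofReal_le_ofReal (min_le_right _ _)
  rw [← hab]
  exact (K_le_add _ t a b).trans (add_le_add ha_nrm.le (by gcongr; exact hb_nrm))

theorem K_le_lintegral {w : L0 𝕜} (hw : IsDecreasing w) {t : ℝ≥0} (ht : 0 < t) :
    (coupleL1Linfty 𝕜).K t w ≤ ∫⁻ x in Ioo 0 (t : ℝ), ‖w x‖ₑ := by
  obtain ⟨p, hpm, hp, hp0, hwp⟩ := hw
  have ht' : (0 : ℝ) < t := by exact_mod_cast ht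
  let u : ℝ → ℝ≥0∞ := fun x => ENNReal.ofReal (p x - p t)
  have hexcess : ∫⁻ x in Ioi 0, u x = ∫⁻ x in Ioo 0 (t : ℝ), u x := by
    rw [← inter_eq_left.2 (Ioo_subset_Ioi_self : Ioo 0 (t : ℝ) ⊆ Ioi 0),
      ← setLIntegral_indicator measurableSet_Ioo]
    refine setLIntegral_congr_fun measurableSet_Ioi fun x hx => ?_
    by_cases hxt : x < t
    · exact (indicator_of_mem (show x ∈ Ioo 0 (t : ℝ) from ⟨hx, hxt⟩) u).symm
    · have hpx : p x - p t ≤ 0 := sub_nonpos.2 (hp ht' hx (not_lt.1 hxt))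
      exact (ENNReal.ofReal_of_nonpos hpx).trans (indicator_of_notMem (fun h => hxt h.2) u).symm
  have hlevel : t * ENNReal.ofReal (p t) = ∫⁻ _ in Ioo 0 (t : ℝ), ENNReal.ofReal (p t) := by
    simp [mul_comm]
  refine (K_le_of_truncation hpm hp0 hwp t (hp0 t)).trans_eq ?_
  change (∫⁻ x in Ioi 0, u x) + _ = _
  rw [hexcess, hlevel, ← lintegral_add_right _ measurable_const]
  refine lintegral_congr_ae ?_
  filter_upwards [ae_Ioo hwp t, ae_restrict_mem measurableSet_Ioo] with x hx hxt
  have hpx : p t ≤ p x := hp hxt.1 ht' hxt.2.le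
  rw [hx, enorm_ofReal_of_nonneg (hp0 x), ← ENNReal.ofReal_add (by linarith) (hp0 t),
    sub_add_cancel]

end FunctionSpaces

/-! ### Primitives -/

section Primitives

variable {𝕜 : Type*} [RCLike 𝕜]

theorem Ioi_eq_iUnion_Ioo : Ioi (0 : ℝ) = ⋃ n : ℕ, Ioo (0 : ℝ) (n + 1) := by
  ext x
  simp only [mem_Ioi, mem_iUnion, mem_Ioo]
  refine ⟨fun hx => ?_, fun ⟨_, hn⟩ => hn.1⟩
  obtain ⟨n, hn⟩ := exists_nat_gt x
  exact ⟨n, hx, by linarith⟩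

theorem lintegral_Ioi_le {u : ℝ → ℝ≥0∞} {C : ℝ≥0∞}
    (h : ∀ t : ℝ, 0 < t → ∫⁻ x in Ioo 0 t, u x ≤ C) : ∫⁻ x in Ioi 0, u x ≤ C := by
  rw [Ioi_eq_iUnion_Ioo, setLIntegral_iUnion_of_directed]
  · exact iSup_le fun n => h _ (by positivity)
  · refine Monotone.directed_le fun m n hmn => Ioo_subset_Ioo_right ?_
    have : (m : ℝ) ≤ n := by exact_mod_cast hmn
    linarith

/-- `x ↦ ∫₀ˣ |h|`, with real values; junk unless `h` is integrable near `0`. -/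
noncomputable def realPrimitive (h : L0 𝕜) (t : ℝ) : ℝ := ∫ x in Ioo 0 t, ‖h x‖

variable {h : L0 𝕜}

theorem ofReal_realPrimitive (hh : HasFinitePrimitive h) (t : ℝ) :
    ENNReal.ofReal (realPrimitive h t) = ∫⁻ x in Ioo 0 t, ‖h x‖ₑ :=
  ofReal_integral_norm_eq_lintegral_enorm (hh t)

theorem realPrimitive_nonneg (h : L0 𝕜) (t : ℝ) : 0 ≤ realPrimitive h t :=
  integral_nonneg fun _ => norm_nonneg _

theorem realPrimitive_of_nonpos (h : L0 𝕜) {t : ℝ} (ht : t ≤ 0) : realPrimitive h t = 0 := by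
  simp [realPrimitive, Ioo_eq_empty (not_lt.2 ht)]

theorem monotone_realPrimitive (hh : HasFinitePrimitive h) :
    Monotone (realPrimitive h) := fun _ t hst =>
  setIntegral_mono_set (hh t).norm (ae_of_all _ fun _ => norm_nonneg _)
    (Ioo_subset_Ioo_right hst).eventuallyLE

theorem intervalIntegrable_indicator (hh : HasFinitePrimitive h) (a b : ℝ) :
    IntervalIntegrable ((Ioi 0).indicator fun x => ‖h x‖) volume a b := by
  rw [intervalIntegrable_iff, integrableOn_indicator_iff measurableSet_Ioi]
  refine IntegrableOn.mono_set (hh (max a b + 1)).norm fun x hx => ?_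
  exact ⟨hx.1, hx.2.2.trans_lt (lt_add_one _)⟩

theorem realPrimitive_eq_intervalIntegral (h : L0 𝕜) (t : ℝ) :
    realPrimitive h t = ∫ x in (0 : ℝ)..t, (Ioi 0).indicator (fun x => ‖h x‖) x := by
  rcases le_total t 0 with ht | ht
  · rw [realPrimitive_of_nonpos h ht, intervalIntegral.integral_of_ge ht,
      setIntegral_eq_zero_of_forall_eq_zero, neg_zero]
    exact fun x hx => indicator_of_notMem (not_lt.2 hx.2) _
  · rw [realPrimitive, intervalIntegral.integral_of_le ht, integral_Ioc_eq_integral_Ioo]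
    refine setIntegral_congr_fun measurableSet_Ioo fun x hx => ?_
    exact (indicator_of_mem (show x ∈ Ioi (0 : ℝ) from hx.1) fun x => ‖h x‖).symm

theorem continuous_realPrimitive (hh : HasFinitePrimitive h) :
    Continuous (realPrimitive h) := by
  have := intervalIntegral.continuous_primitive (intervalIntegrable_indicator hh) 0
  exact this.congr fun t => (realPrimitive_eq_intervalIntegral h t).symm

end Primitives

/-! ### Moving mass to the right -/

section Transport

open CompatibleCouple

variable {𝕜 : Type*} [RCLike 𝕜]

/-- The increasing map which transports the measure `|y(z)| dz` to the initial part of `|f(x)| dx`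
of the same mass. -/
noncomputable def transportMap (f y : L0 𝕜) (z : ℝ) : ℝ :=
  sInf {x | 0 ≤ x ∧ realPrimitive y z ≤ realPrimitive f x}

variable {f y : L0 𝕜}

theorem transportMap_nonneg (f y : L0 𝕜) (z : ℝ) : 0 ≤ transportMap f y z :=
  Real.sInf_nonneg fun _ hx => hx.1

theorem transportMap_set_nonempty (hfy : realPrimitive y ≤ realPrimitive f)
    (z : ℝ) : {x | 0 ≤ x ∧ realPrimitive y z ≤ realPrimitive f x}.Nonempty := by
  rcases le_or_gt z 0 with hz | hz
  · exact ⟨0, le_rfl, by rw [realPrimitive_of_nonpos y hz]; exact realPrimitive_nonneg f 0⟩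
  · exact ⟨z, hz.le, hfy z⟩

theorem transportMap_le_iff (hf : HasFinitePrimitive f)
    (hfy : realPrimitive y ≤ realPrimitive f)
    {z r : ℝ} (hr : 0 ≤ r) :
    transportMap f y z ≤ r ↔ realPrimitive y z ≤ realPrimitive f r := by
  refine ⟨fun h => ?_, fun h => csInf_le ⟨0, fun x hx => hx.1⟩ ⟨hr, h⟩⟩
  have hcl : IsClosed {x | 0 ≤ x ∧ realPrimitive y z ≤ realPrimitive f x} :=
    (isClosed_le continuous_const continuous_id).inter
      (isClosed_le continuous_const (continuous_realPrimitive hf))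
  have hmem := hcl.csInf_mem (transportMap_set_nonempty hfy z) ⟨0, fun x hx => hx.1⟩
  exact hmem.2.trans (monotone_realPrimitive hf h)

theorem monotone_transportMap (hf : HasFinitePrimitive f)
    (hy : HasFinitePrimitive y)
    (hfy : realPrimitive y ≤ realPrimitive f) :
    Monotone (transportMap f y) := fun _ b hab =>
  (transportMap_le_iff hf hfy (transportMap_nonneg f y b)).2
    ((monotone_realPrimitive hy hab).trans
      ((transportMap_le_iff hf hfy (transportMap_nonneg f y b)).1 le_rfl))

theorem transportMap_le_self (hf : HasFinitePrimitive f)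
    (hfy : realPrimitive y ≤ realPrimitive f)
    {z : ℝ} (hz : 0 < z) : transportMap f y z ≤ z :=
  (transportMap_le_iff hf hfy hz.le).2 (hfy z)

theorem realPrimitive_transportMap (hf : HasFinitePrimitive f)
    (hfy : realPrimitive y ≤ realPrimitive f) (t : ℝ) :
    realPrimitive f (transportMap f y t) = realPrimitive y t := by
  have hq0 : 0 ≤ transportMap f y t := transportMap_nonneg f y t
  refine le_antisymm ?_ ((transportMap_le_iff hf hfy hq0).1 le_rfl)
  rcases hq0.eq_or_lt with h0 | h0
  · rw [← h0, realPrimitive_of_nonpos f le_rfl]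
    exact realPrimitive_nonneg y t
  · refine le_of_tendsto ((continuous_realPrimitive hf).continuousAt.tendsto.mono_left
      (nhdsWithin_le_nhds (s := Iio (transportMap f y t)))) ?_
    filter_upwards [Ioo_mem_nhdsLT h0] with r hr
    exact (not_le.1 fun h => absurd ((transportMap_le_iff hf hfy hr.1.le).2 h)
      (not_le.2 hr.2)).le

theorem exists_sublevel_eq_Ioc (hy : HasFinitePrimitive y) {s t : ℝ} (hs : 0 ≤ s)
    (hst : s < realPrimitive y t) :
    ∃ r, realPrimitive y r = s ∧ Ioo 0 t ∩ {z | realPrimitive y z ≤ s} = Ioc 0 r := by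
  have hmono := monotone_realPrimitive hy
  have hcont := continuous_realPrimitive hy
  have ht : 0 < t := not_le.1 fun ht => by
    rw [realPrimitive_of_nonpos y ht] at hst
    exact hst.not_ge hs
  have hcompact : IsCompact (Icc 0 t ∩ {z | realPrimitive y z ≤ s}) :=
    isCompact_Icc.inter_right (isClosed_le hcont continuous_const)
  have h0mem : (0 : ℝ) ∈ Icc 0 t ∩ {z | realPrimitive y z ≤ s} :=
    ⟨⟨le_rfl, ht.le⟩, (realPrimitive_of_nonpos y le_rfl).trans_le hs⟩
  obtain ⟨r, ⟨hr, hrs⟩, hmax⟩ := hcompact.exists_isGreatest ⟨0, h0mem⟩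
  obtain ⟨q, hq, hqs⟩ := intermediate_value_Icc hr.2 hcont.continuousOn ⟨hrs, hst.le⟩
  obtain rfl : q = r := le_antisymm (hmax ⟨⟨hr.1.trans hq.1, hq.2⟩, hqs.le⟩) hq.1
  have hqt : q < t := hq.2.lt_of_ne fun h => by
    rw [h] at hqs
    exact hst.ne' hqs
  refine ⟨q, hqs, Subset.antisymm ?_ ?_⟩
  · exact fun z hz => ⟨hz.1.1, hmax ⟨⟨hz.1.1.le, hz.1.2.le⟩, hz.2⟩⟩
  · exact fun z hz => ⟨⟨hz.1, hz.2.trans_lt hqt⟩, (hmono hz.2).trans hrs⟩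

theorem lintegral_sublevel (hy : HasFinitePrimitive y) (t : ℝ) {s : ℝ} (hs : 0 ≤ s) :
    ∫⁻ z in Ioo 0 t ∩ {z | realPrimitive y z ≤ s}, ‖y z‖ₑ =
      ENNReal.ofReal (min (realPrimitive y t) s) := by
  rcases le_or_gt (realPrimitive y t) s with h | h
  · rw [min_eq_left h, ofReal_realPrimitive hy, inter_eq_left.2]
    exact fun z hz => (monotone_realPrimitive hy hz.2.le).trans h
  · obtain ⟨r, hrs, hset⟩ := exists_sublevel_eq_Ioc hy hs h
    rw [min_eq_right h.le, hset, setLIntegral_congr Ioo_ae_eq_Ioc.symm,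
      ← ofReal_realPrimitive hy, hrs]

theorem Iic_inter_Ioo_ae_eq (a q r : ℝ) :
    (Iic r ∩ Ioo a q : Set ℝ) =ᵐ[volume] Ioo a (min q r) := by
  rw [inter_comm, ← Ioo_inter_Iio]
  exact EventuallyEq.rfl.inter Iio_ae_eq_Iic.symm

theorem lintegral_transportMap_preimage_Iic (hf : HasFinitePrimitive f)
    (hy : HasFinitePrimitive y) (hfy : realPrimitive y ≤ realPrimitive f) (t r : ℝ) :
    ∫⁻ z in transportMap f y ⁻¹' Iic r ∩ Ioo 0 t, ‖y z‖ₑ =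
      ∫⁻ x in Iic r ∩ Ioo 0 (transportMap f y t), ‖f x‖ₑ := by
  rw [setLIntegral_congr (Iic_inter_Ioo_ae_eq 0 _ r), ← ofReal_realPrimitive hf]
  rcases lt_or_ge r 0 with hr | hr
  · have hempty : transportMap f y ⁻¹' Iic r = ∅ :=
      eq_empty_of_forall_notMem fun z hz =>
        (hr.trans_le (transportMap_nonneg f y z)).not_ge hz
    rw [hempty, realPrimitive_of_nonpos f ((min_le_right _ _).trans hr.le)]
    simp
  · have hpreimage : transportMap f y ⁻¹' Iic r = {z | realPrimitive y z ≤ realPrimitive f r} :=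
      ext fun z => transportMap_le_iff hf hfy hr
    rw [hpreimage, inter_comm, lintegral_sublevel hy t (realPrimitive_nonneg f r),
      ← realPrimitive_transportMap hf hfy, ← (monotone_realPrimitive hf).map_min]

theorem map_transportMap (hf : HasFinitePrimitive f) (hy : HasFinitePrimitive y)
    (hfy : realPrimitive y ≤ realPrimitive f) (t : ℝ) :
    Measure.map (transportMap f y) ((volume.restrict (Ioo 0 t)).withDensity fun z => ‖y z‖ₑ) =
      (volume.restrict (Ioo 0 (transportMap f y t))).withDensity fun x => ‖f x‖ₑ := by
  have hm : Measurable (transportMap f y) := (monotone_transportMap hf hy hfy).measurable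
  have hfin : IsFiniteMeasure ((volume.restrict (Ioo 0 t)).withDensity fun z => ‖y z‖ₑ) :=
    isFiniteMeasure_withDensity (hy t).2.ne
  refine Measure.ext_of_Iic _ _ fun r => ?_
  rw [Measure.map_apply hm measurableSet_Iic, withDensity_apply _ (hm measurableSet_Iic),
    withDensity_apply _ measurableSet_Iic, Measure.restrict_restrict (hm measurableSet_Iic),
    Measure.restrict_restrict measurableSet_Iic, lintegral_transportMap_preimage_Iic hf hy hfy]

theorem lintegral_transport_le (hf : HasFinitePrimitive f)
    (hy : HasFinitePrimitive y)
    (hfy : realPrimitive y ≤ realPrimitive f)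
    {φ : ℝ → ℝ≥0∞} (hφ : Measurable φ) {t : ℝ} (ht : 0 < t) :
    ∫⁻ z in Ioo 0 t, ‖y z‖ₑ * φ (transportMap f y z) ≤ ∫⁻ x in Ioo 0 t, ‖f x‖ₑ * φ x := by
  have hm : Measurable (transportMap f y) := (monotone_transportMap hf hy hfy).measurable
  have hym : Measurable fun z => ‖y z‖ₑ := y.stronglyMeasurable.measurable.enorm
  have hfm : Measurable fun z => ‖f z‖ₑ := f.stronglyMeasurable.measurable.enorm
  calc ∫⁻ z in Ioo 0 t, ‖y z‖ₑ * φ (transportMap f y z)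
      = ∫⁻ x in Ioo 0 (transportMap f y t), ‖f x‖ₑ * φ x := by
        have h := lintegral_withDensity_eq_lintegral_mul (volume.restrict (Ioo 0 t)) hym
          (hφ.comp hm)
        have h' := lintegral_withDensity_eq_lintegral_mul
          (volume.restrict (Ioo 0 (transportMap f y t))) hfm hφ
        rw [← map_transportMap hf hy hfy, lintegral_map hφ hm] at h'
        exact h.symm.trans h'
    _ ≤ _ := lintegral_mono_set (Ioo_subset_Ioo_right (transportMap_le_self hf hfy ht))

theorem ae_transport (hf : HasFinitePrimitive f)
    (hy : HasFinitePrimitive y)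
    (hfy : realPrimitive y ≤ realPrimitive f)
    {N : Set ℝ} (hN : MeasurableSet N)
    (h : ∀ᵐ x ∂halfLine, x ∈ N → f x = 0) :
    ∀ᵐ z ∂halfLine, transportMap f y z ∈ N → y z = 0 := by
  have hm : Measurable (transportMap f y) := (monotone_transportMap hf hy hfy).measurable
  have hym : Measurable fun z => ‖y z‖ₑ := y.stronglyMeasurable.measurable.enorm
  refine ae_halfLine fun n => ?_
  have h1 := lintegral_transport_le hf hy hfy (φ := N.indicator 1) (measurable_one.indicator hN)
    (t := n + 1) (by positivity)
  have h2 : ∫⁻ x in Ioo (0 : ℝ) (n + 1), ‖f x‖ₑ * N.indicator 1 x = 0 := by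
    rw [← lintegral_zero (μ := volume.restrict (Ioo (0 : ℝ) (n + 1)))]
    refine lintegral_congr_ae ?_
    filter_upwards [ae_Ioo h (n + 1)] with x hx
    by_cases hxN : x ∈ N
    · simp [hx hxN]
    · simp [hxN]
  rw [h2, nonpos_iff_eq_zero] at h1
  filter_upwards [(lintegral_eq_zero_iff
    (hym.mul ((measurable_one.indicator hN).comp hm))).1 h1] with z hz hzN
  simpa [hzN] using hz

theorem ae_transport_of_ae (hf : HasFinitePrimitive f)
    (hy : HasFinitePrimitive y)
    (hfy : realPrimitive y ≤ realPrimitive f)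
    {P : ℝ → Prop} (h : ∀ᵐ x ∂halfLine, P x) :
    ∀ᵐ z ∂halfLine, P (transportMap f y z) ∨ y z = 0 := by
  obtain ⟨N, hPN, hNm, hN0⟩ := exists_measurable_superset_of_null (ae_iff.1 h)
  have h1 : ∀ᵐ x ∂halfLine, x ∈ N → f x = 0 := by
    filter_upwards [measure_eq_zero_iff_ae_notMem.1 hN0] with x hx hx'
    exact absurd hx' hx
  filter_upwards [ae_transport hf hy hfy hNm h1] with z hz
  by_cases hz' : transportMap f y z ∈ N
  · exact Or.inr (hz hz')
  · exact Or.inl (by_contra fun hc => hz' (hPN hc))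

/-- The operator `h ↦ y · (h / f) ∘ τ` with `τ` the transport map. It takes `f` to `y`, since
`y` vanishes almost everywhere where `f ∘ τ` does, and `z / 0 = 0`. -/
noncomputable def transportOperator (f y h : L0 𝕜) (z : ℝ) : 𝕜 :=
  y z * (h (transportMap f y z) / f (transportMap f y z))

theorem lintegral_transportOperator_le (hf : HasFinitePrimitive f) (hy : HasFinitePrimitive y)
    (hfy : realPrimitive y ≤ realPrimitive f) {h k : L0 𝕜}
    (hk : k =ᵐ[halfLine] transportOperator f y h) {t : ℝ} (ht : 0 < t) :
    ∫⁻ x in Ioo 0 t, ‖k x‖ₑ ≤ ∫⁻ x in Ioo 0 t, ‖h x‖ₑ := by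
  let φ : ℝ → ℝ≥0∞ := fun x => ‖h x / f x‖ₑ
  have hφ : Measurable φ :=
    (h.stronglyMeasurable.measurable.div f.stronglyMeasurable.measurable).enorm
  calc ∫⁻ x in Ioo 0 t, ‖k x‖ₑ
      = ∫⁻ x in Ioo 0 t, ‖y x‖ₑ * φ (transportMap f y x) := by
        refine lintegral_congr_ae ?_
        filter_upwards [ae_Ioo hk t] with x hx
        rw [hx, transportOperator, enorm_mul]
    _ ≤ ∫⁻ x in Ioo 0 t, ‖f x‖ₑ * φ x := lintegral_transport_le hf hy hfy hφ ht
    _ ≤ ∫⁻ x in Ioo 0 t, ‖h x‖ₑ := by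
        refine lintegral_mono fun x => ?_
        rw [← enorm_mul]
        rcases eq_or_ne (f x) 0 with h0 | h0
        · simp [h0]
        · rw [mul_div_cancel₀ _ h0]

theorem ae_eq_transportOperator (hf : HasFinitePrimitive f) (hy : HasFinitePrimitive y)
    (hfy : realPrimitive y ≤ realPrimitive f) : y =ᵐ[halfLine] transportOperator f y f := by
  have hzero : MeasurableSet {x | f x = 0} :=
    f.stronglyMeasurable.measurable (measurableSet_singleton 0)
  filter_upwards [ae_transport hf hy hfy hzero (ae_of_all _ fun x hx => hx)] with z hz
  by_cases h0 : f (transportMap f y z) = 0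
  · simp [transportOperator, hz h0]
  · simp [transportOperator, div_self h0]

theorem realPrimitive_le_of_lintegral_le (hf : HasFinitePrimitive f) (hy : HasFinitePrimitive y)
    (hfy : ∀ t, 0 < t → ∫⁻ x in Ioo 0 t, ‖y x‖ₑ ≤ ∫⁻ x in Ioo 0 t, ‖f x‖ₑ) :
    realPrimitive y ≤ realPrimitive f := fun t => by
  rcases le_or_gt t 0 with ht | ht
  · rw [realPrimitive_of_nonpos y ht]
    exact realPrimitive_nonneg f t
  · rw [← ENNReal.ofReal_le_ofReal_iff (realPrimitive_nonneg f t), ofReal_realPrimitive hy,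
      ofReal_realPrimitive hf]
    exact hfy t ht

/-- Since `τ z ≤ z`, mass is moved to the right: this is why the transport operator is bounded for
the level norm, although it need not be for the norm of `L^∞`. -/
theorem isImage_of_lintegral_le (hf : f ∈ (coupleL1LevelLinfty 𝕜).sum)
    (hfy : ∀ t, 0 < t → ∫⁻ x in Ioo 0 t, ‖y x‖ₑ ≤ ∫⁻ x in Ioo 0 t, ‖f x‖ₑ) :
    IsImage 1 (coupleL1LevelLinfty 𝕜) (coupleL1LevelLinfty 𝕜) f y := by
  have hf' : HasFinitePrimitive f := hasFinitePrimitive_of_mem_sum hf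
  have hy : HasFinitePrimitive y :=
    hasFinitePrimitive_iff.2 fun t ht => (hfy t ht).trans_lt (hf' t).2
  replace hfy : realPrimitive y ≤ realPrimitive f := realPrimitive_le_of_lintegral_le hf' hy hfy
  have hm : Measurable (transportMap f y) := (monotone_transportMap hf' hy hfy).measurable
  refine isImage_of_fun (transportOperator f y) (fun h _ => ?_) (fun h _ k _ => ?_)
    (fun r h _ => ?_) (fun h k _ hk => ?_) (fun h k _ hk => ?_) hf
    (ae_eq_transportOperator hf' hy hfy)
  · exact (y.stronglyMeasurable.measurable.mul ((h.stronglyMeasurable.measurable.comp hm).div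
      (f.stronglyMeasurable.measurable.comp hm))).aestronglyMeasurable
  · filter_upwards [ae_transport_of_ae hf' hy hfy (AEEqFun.coeFn_add h k)] with z hz
    rcases hz with hz | hz
    · simp only [transportOperator, hz, Pi.add_apply]
      ring
    · simp [transportOperator, hz]
  · filter_upwards [ae_transport_of_ae hf' hy hfy (AEEqFun.coeFn_smul r h)] with z hz
    rcases hz with hz | hz
    · simp only [transportOperator, hz, Pi.smul_apply, smul_eq_mul]
      ring
    · simp [transportOperator, hz]
  · rw [ENNReal.coe_one, one_mul]
    refine (nrm_L1 k).trans_le (lintegral_Ioi_le fun t ht => ?_)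
    exact ((lintegral_transportOperator_le hf' hy hfy hk ht).trans
      (setLIntegral_Ioo_le _ _)).trans (nrm_L1 h).ge
  · rw [ENNReal.coe_one, one_mul]
    exact (levelNorm_le_iff k _).2 fun t ht =>
      (lintegral_transportOperator_le hf' hy hfy hk ht).trans (lintegral_le_levelNorm h ht)

end Transport

/-! ### Averages and generalized limits -/

section GeneralizedLimits

open CompatibleCouple

variable {𝕜 : Type*} [RCLike 𝕜]

/-- A generalized limit, along an ultrafilter, of the averages of `h` over the sets `B n`. Junk
unless these averages are bounded. -/
noncomputable def limAverage (B : ℕ → Set ℝ) (h : L0 𝕜) : 𝕜 :=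
  limUnder (hyperfilter ℕ : Filter ℕ) fun n => ⨍ x in B n, h x

/-- The averages of `|h|` over the sets `B n` exist and are bounded. -/
def HasBoundedAverages (B : ℕ → Set ℝ) (h : L0 𝕜) : Prop :=
  (∀ n, IntegrableOn h (B n)) ∧ ∃ C : ℝ, ∀ n, ⨍ x in B n, ‖h x‖ ≤ C

theorem norm_setAverage_le (f : ℝ → 𝕜) (s : Set ℝ) : ‖⨍ x in s, f x‖ ≤ ⨍ x in s, ‖f x‖ := by
  rw [setAverage_eq, setAverage_eq, norm_smul, norm_inv, Real.norm_of_nonneg measureReal_nonneg,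
    smul_eq_mul]
  gcongr
  exact norm_integral_le_integral_norm _

theorem tendsto_limAverage {B : ℕ → Set ℝ} {h : L0 𝕜} (hh : HasBoundedAverages B h) :
    Tendsto (fun n => ⨍ x in B n, h x) (hyperfilter ℕ) (𝓝 (limAverage B h)) := by
  obtain ⟨C, hC⟩ := hh.2
  refine tendsto_nhds_limUnder ?_
  obtain ⟨l, -, hl⟩ := (isCompact_closedBall (0 : 𝕜) C).ultrafilter_le_nhds
    ((hyperfilter ℕ).map fun n => ⨍ x in B n, h x) (by
      rw [Ultrafilter.coe_map]
      refine tendsto_principal.2 (Eventually.of_forall fun n => ?_)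
      rw [mem_closedBall_zero_iff]
      exact (norm_setAverage_le _ _).trans (hC n))
  exact ⟨l, hl⟩

theorem limAverage_eq {B : ℕ → Set ℝ} {h : L0 𝕜} {l : 𝕜}
    (hl : Tendsto (fun n => ⨍ x in B n, h x) atTop (𝓝 l)) : limAverage B h = l :=
  (hl.mono_left Nat.hyperfilter_le_atTop).limUnder_eq

theorem ae_restrict_of_subset_Ioi {B : Set ℝ} (hB : B ⊆ Ioi 0) {P : ℝ → Prop}
    (h : ∀ᵐ x ∂halfLine, P x) : ∀ᵐ x ∂volume.restrict B, P x :=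
  ae_mono (Measure.restrict_mono hB le_rfl) h

theorem setIntegral_coeFn_add {B : Set ℝ} (hB : B ⊆ Ioi 0) {h k : L0 𝕜} (hh : IntegrableOn h B)
    (hk : IntegrableOn k B) :
    ∫ x in B, (h + k : L0 𝕜) x = (∫ x in B, h x) + ∫ x in B, k x := by
  rw [← integral_add hh hk]
  exact integral_congr_ae (ae_restrict_of_subset_Ioi hB (AEEqFun.coeFn_add h k))

theorem setIntegral_coeFn_smul {B : Set ℝ} (hB : B ⊆ Ioi 0) (r : 𝕜) (h : L0 𝕜) :
    ∫ x in B, (r • h : L0 𝕜) x = r * ∫ x in B, h x := by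
  rw [← integral_const_mul]
  exact integral_congr_ae (ae_restrict_of_subset_Ioi hB (AEEqFun.coeFn_smul r h))

theorem HasBoundedAverages.add {B : ℕ → Set ℝ} (hB : ∀ n, B n ⊆ Ioi 0) {h k : L0 𝕜}
    (hh : HasBoundedAverages B h) (hk : HasBoundedAverages B k) :
    HasBoundedAverages B (h + k) := by
  obtain ⟨C, hC⟩ := hh.2
  obtain ⟨D, hD⟩ := hk.2
  have hae : ∀ n, (h + k : L0 𝕜) =ᵐ[volume.restrict (B n)] (⇑h + ⇑k) := fun n =>
    ae_restrict_of_subset_Ioi (hB n) (AEEqFun.coeFn_add h k)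
  have hinteg : ∀ n, IntegrableOn (⇑(h + k : L0 𝕜)) (B n) := fun n =>
    ((hh.1 n).add (hk.1 n)).congr (hae n).symm
  refine ⟨hinteg, C + D, fun n => ?_⟩
  refine le_trans ?_ (add_le_add (hC n) (hD n))
  simp only [setAverage_eq, smul_eq_mul]
  rw [← mul_add, ← integral_add (hh.1 n).norm (hk.1 n).norm]
  refine mul_le_mul_of_nonneg_left ?_ (inv_nonneg.2 measureReal_nonneg)
  refine integral_mono_ae (hinteg n).norm ((hh.1 n).norm.add (hk.1 n).norm) ?_
  filter_upwards [hae n] with x hx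
  simp only [hx, Pi.add_apply]
  exact norm_add_le _ _

theorem limAverage_add {B : ℕ → Set ℝ} (hB : ∀ n, B n ⊆ Ioi 0) {h k : L0 𝕜}
    (hh : HasBoundedAverages B h) (hk : HasBoundedAverages B k) :
    limAverage B (h + k) = limAverage B h + limAverage B k := by
  refine tendsto_nhds_unique (tendsto_limAverage (hh.add hB hk)) ?_
  refine ((tendsto_limAverage hh).add (tendsto_limAverage hk)).congr fun n => ?_
  simp only [setAverage_eq]
  rw [← smul_add, setIntegral_coeFn_add (hB n) (hh.1 n) (hk.1 n)]

theorem limAverage_smul {B : ℕ → Set ℝ} (hB : ∀ n, B n ⊆ Ioi 0) (r : 𝕜) {h : L0 𝕜}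
    (hh : HasBoundedAverages B h) : limAverage B (r • h) = r * limAverage B h := by
  refine (((tendsto_limAverage hh).const_mul r).congr fun n => ?_).limUnder_eq
  simp only [setAverage_eq]
  rw [setIntegral_coeFn_smul (hB n), mul_smul_comm]

theorem norm_limAverage_le {B : ℕ → Set ℝ} {h : L0 𝕜} (hh : HasBoundedAverages B h)
    {u : ℕ → ℝ} {M : ℝ} (hu : ∀ n, ⨍ x in B n, ‖h x‖ ≤ u n) (hM : Tendsto u atTop (𝓝 M)) :
    ‖limAverage B h‖ ≤ M :=
  le_of_tendsto_of_tendsto (tendsto_limAverage hh).norm (hM.mono_left Nat.hyperfilter_le_atTop)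
    (Eventually.of_forall fun n => (norm_setAverage_le _ _).trans (hu n))

theorem setAverage_norm_le_of_L1 {B : Set ℝ} (hB : B ⊆ Ioi 0) {h : L0 𝕜}
    (hh : IntegrableOn h (Ioi 0)) :
    ⨍ x in B, ‖h x‖ ≤ (volume.real B)⁻¹ * ∫ x in Ioi 0, ‖h x‖ := by
  rw [setAverage_eq, smul_eq_mul]
  refine mul_le_mul_of_nonneg_left ?_ (inv_nonneg.2 measureReal_nonneg)
  exact setIntegral_mono_set hh.norm (ae_of_all _ fun _ => norm_nonneg _) hB.eventuallyLE

theorem integrableOn_Ioi_of_nrm {h : L0 𝕜} (hh : (lebesgue 𝕜 1 le_rfl).nrm h < ∞) :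
    IntegrableOn h (Ioi 0) :=
  ⟨h.aestronglyMeasurable, by rw [nrm_L1] at hh; exact hh⟩

theorem hasBoundedAverages_of_L1 {B : ℕ → Set ℝ} (hB : ∀ n, B n ⊆ Ioi 0)
    (hvol : ∀ n, 1 ≤ volume.real (B n)) {h : L0 𝕜}
    (hh : (lebesgue 𝕜 1 le_rfl).nrm h < ∞) : HasBoundedAverages B h := by
  have hinteg := integrableOn_Ioi_of_nrm hh
  refine ⟨fun n => hinteg.mono_set (hB n), ∫ x in Ioi 0, ‖h x‖, fun n => ?_⟩
  refine (setAverage_norm_le_of_L1 (hB n) hinteg).trans ?_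
  have h0 : 0 ≤ ∫ x in Ioi 0, ‖h x‖ := integral_nonneg fun _ => norm_nonneg _
  exact mul_le_of_le_one_left h0 (inv_le_one_of_one_le₀ (hvol n))

theorem limAverage_of_L1 {B : ℕ → Set ℝ} (hB : ∀ n, B n ⊆ Ioi 0)
    (hvol : ∀ n, 1 ≤ volume.real (B n)) (hvol' : Tendsto (fun n => volume.real (B n)) atTop atTop)
    {h : L0 𝕜} (hh : (lebesgue 𝕜 1 le_rfl).nrm h < ∞) : limAverage B h = 0 := by
  have hinteg := integrableOn_Ioi_of_nrm hh
  have h1 := norm_limAverage_le (hasBoundedAverages_of_L1 hB hvol hh)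
    (fun n => setAverage_norm_le_of_L1 (hB n) hinteg)
    ((tendsto_inv_atTop_zero.comp hvol').mul_const _)
  rw [zero_mul] at h1
  exact norm_le_zero_iff.1 h1

end GeneralizedLimits

section IntervalMeans

variable {𝕜 : Type*} [RCLike 𝕜]

theorem measurableSet_between {α β : ℝ → ℝ} (hα : Measurable α) (hβ : Measurable β) :
    MeasurableSet {q : ℝ × ℝ | α q.1 < q.2 ∧ q.2 < β q.1} :=
  (measurableSet_lt (hα.comp measurable_fst) measurable_snd).inter
    (measurableSet_lt measurable_snd (hβ.comp measurable_fst))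

theorem stronglyMeasurable_integral_Ioo {α β : ℝ → ℝ} (hα : Measurable α) (hβ : Measurable β)
    {h : ℝ → 𝕜} (hh : StronglyMeasurable h) :
    StronglyMeasurable fun s => ∫ z in Ioo (α s) (β s), h z := by
  have h1 : StronglyMeasurable fun q : ℝ × ℝ =>
      {q : ℝ × ℝ | α q.1 < q.2 ∧ q.2 < β q.1}.indicator (fun q => h q.2) q :=
    (hh.comp_measurable measurable_snd).indicator (measurableSet_between hα hβ)
  have h2 := h1.integral_prod_right' (ν := volume)
  convert h2 using 2 with s
  rw [← integral_indicator measurableSet_Ioo]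
  rfl

theorem lintegral_mul_lintegral_Ioo_le {α β : ℝ → ℝ} (hα : Measurable α) (hβ : Measurable β)
    {c : ℝ → ℝ≥0∞} (hc : Measurable c) {u : ℝ → ℝ≥0∞} (hu : Measurable u) {E E' : Set ℝ}
    (hE' : MeasurableSet E') {C : ℝ≥0∞}
    (hker : ∀ z, ∫⁻ s in E, {s | α s < z ∧ z < β s}.indicator c s ≤ E'.indicator (fun _ => C) z) :
    ∫⁻ s in E, c s * ∫⁻ z in Ioo (α s) (β s), u z ≤ C * ∫⁻ z in E', u z := by
  set S : Set (ℝ × ℝ) := {q | α q.1 < q.2 ∧ q.2 < β q.1}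
  set k : ℝ × ℝ → ℝ≥0∞ := S.indicator fun q => c q.1 * u q.2
  have hk : Measurable k := ((hc.comp measurable_fst).mul (hu.comp measurable_snd)).indicator
    (measurableSet_between hα hβ)
  have hfactor (s z : ℝ) : k (s, z) = {s | α s < z ∧ z < β s}.indicator c s * u z := by
    by_cases hs : α s < z ∧ z < β s
    · exact (indicator_of_mem (show (s, z) ∈ S from hs) _).trans
        (congrArg (· * u z) (indicator_of_mem (s := {s | α s < z ∧ z < β s}) hs c).symm)
    · exact (indicator_of_notMem (show (s, z) ∉ S from hs) _).trans (by
        rw [indicator_of_notMem (s := {s | α s < z ∧ z < β s}) hs c, zero_mul])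
  calc ∫⁻ s in E, c s * ∫⁻ z in Ioo (α s) (β s), u z
      = ∫⁻ s in E, ∫⁻ z, k (s, z) := by
        refine lintegral_congr fun s => ?_
        rw [← lintegral_const_mul _ hu, ← lintegral_indicator measurableSet_Ioo]
        rfl
    _ = ∫⁻ z, ∫⁻ s in E, k (s, z) := lintegral_lintegral_swap hk.aemeasurable
    _ = ∫⁻ z, (∫⁻ s in E, {s | α s < z ∧ z < β s}.indicator c s) * u z := by
        refine lintegral_congr fun z => ?_
        have hmz : MeasurableSet {s | α s < z ∧ z < β s} :=
          (measurableSet_lt hα measurable_const).inter (measurableSet_lt measurable_const hβ)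
        rw [← lintegral_mul_const _ (hc.indicator hmz)]
        exact lintegral_congr fun s => hfactor s z
    _ ≤ ∫⁻ z, E'.indicator (fun _ => C) z * u z := by
        gcongr with z
        exact hker z
    _ = C * ∫⁻ z in E', u z := by
        rw [← lintegral_const_mul _ hu, ← lintegral_indicator hE']
        refine lintegral_congr fun z => ?_
        by_cases hz : z ∈ E' <;> simp [hz]

end IntervalMeans

/-! ### Decreasing functions -/

section Decreasing

open CompatibleCouple

variable {𝕜 : Type*} [RCLike 𝕜]

theorem integrableOn_Ioo_of_antitoneOn {p : ℝ → ℝ} (hp : AntitoneOn p (Ioi 0)) {a b : ℝ}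
    (ha : 0 < a) : IntegrableOn p (Ioo a b) :=
  ((hp.mono fun _ hx => ha.trans_le hx.1).integrableOn_isCompact isCompact_Icc).mono_set
    Ioo_subset_Icc_self

theorem mul_le_integral_Ioo {p : ℝ → ℝ} (hp : AntitoneOn p (Ioi 0)) {a b : ℝ} (ha : 0 < a)
    (hab : a < b) : p b * (b - a) ≤ ∫ x in Ioo a b, p x := by
  have h := setIntegral_mono_on (μ := volume) (s := Ioo a b) (f := fun _ => p b) (g := p)
    (by simp) (integrableOn_Ioo_of_antitoneOn hp ha) measurableSet_Ioo
    (fun x hx => hp (ha.trans hx.1) (ha.trans hab) hx.2.le)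
  rw [setIntegral_const, Real.volume_real_Ioo_of_le hab.le, smul_eq_mul] at h
  linarith

theorem integral_Ioo_le_mul {p : ℝ → ℝ} (hp : AntitoneOn p (Ioi 0)) {a b : ℝ} (ha : 0 < a)
    (hab : a < b) : ∫ x in Ioo a b, p x ≤ p a * (b - a) := by
  have h := setIntegral_mono_on (μ := volume) (s := Ioo a b) (f := p) (g := fun _ => p a)
    (integrableOn_Ioo_of_antitoneOn hp ha) (by simp) measurableSet_Ioo
    (fun x hx => hp ha (ha.trans hx.1) hx.1.le)
  rw [setIntegral_const, Real.volume_real_Ioo_of_le hab.le, smul_eq_mul] at h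
  linarith

theorem lintegral_doubling_kernel (z : ℝ) :
    ∫⁻ s in Ioi 0, {s : ℝ | s / 2 < z ∧ z < s}.indicator (fun s => ENNReal.ofReal (2 / s)) s ≤
      (Ioi (0 : ℝ)).indicator (fun _ => 2) z := by
  have hm : MeasurableSet {s : ℝ | s / 2 < z ∧ z < s} :=
    (measurableSet_lt (measurable_id.div_const 2) measurable_const).inter
      (measurableSet_lt measurable_const measurable_id)
  rw [lintegral_indicator hm, Measure.restrict_restrict hm]
  rcases le_or_gt z 0 with hz | hz
  · have : {s : ℝ | s / 2 < z ∧ z < s} ∩ Ioi 0 = ∅ := by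
      ext s
      simp only [mem_inter_iff, mem_ofPred_eq, mem_Ioi, mem_empty_iff_false, iff_false]
      rintro ⟨⟨h1, -⟩, h3⟩
      linarith
    rw [this]
    simp
  · have : {s : ℝ | s / 2 < z ∧ z < s} ∩ Ioi 0 ⊆ Ioo z (2 * z) := by
      rintro s ⟨⟨h1, h2⟩, -⟩
      exact ⟨h2, by linarith⟩
    rw [indicator_of_mem (show z ∈ Ioi (0 : ℝ) from hz)]
    calc _ ≤ ∫⁻ s in Ioo z (2 * z), ENNReal.ofReal (2 / s) := lintegral_mono_set this
      _ ≤ ∫⁻ s in Ioo z (2 * z), ENNReal.ofReal (2 / z) := by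
        refine setLIntegral_mono measurable_const fun s hs => ENNReal.ofReal_le_ofReal ?_
        exact div_le_div_of_nonneg_left (by norm_num) hz hs.1.le
      _ = 2 := by
        rw [setLIntegral_const, Real.volume_Ioo, ← ENNReal.ofReal_mul (by positivity),
          show 2 / z * (2 * z - z) = 2 by field_simp; ring]
        simp

/-- The operator `h ↦ (p(x) / ∫_{x/2}^x p) ∫_{x/2}^x h`, which fixes `p`. It factors through means
over the intervals `(x/2, x)` of comparable length and position, which is why it maps `(L^∞)ᵒ` into
`L^∞`. -/
noncomputable def doublingOperator (p : ℝ → ℝ) (h : L0 𝕜) (x : ℝ) : 𝕜 :=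
  ((p x / ∫ z in Ioo (x / 2) x, p z : ℝ) : 𝕜) * ∫ z in Ioo (x / 2) x, h z

variable {p : ℝ → ℝ}

theorem Ioo_half_subset {x : ℝ} (hx : 0 < x) : Ioo (x / 2) x ⊆ Ioo 0 x :=
  Ioo_subset_Ioo_left (half_pos hx).le

theorem mul_half_le_integral_Ioo_half (hp : AntitoneOn p (Ioi 0)) {x : ℝ} (hx : 0 < x) :
    p x * (x / 2) ≤ ∫ z in Ioo (x / 2) x, p z := by
  have := mul_le_integral_Ioo hp (half_pos hx) (half_lt_self hx)
  rwa [sub_half] at this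

theorem div_integral_Ioo_half_le (hp : AntitoneOn p (Ioi 0)) (hp0 : ∀ x, 0 ≤ p x) {x : ℝ}
    (hx : 0 < x) : p x / ∫ z in Ioo (x / 2) x, p z ≤ 2 / x := by
  have hP0 : 0 ≤ ∫ z in Ioo (x / 2) x, p z := integral_nonneg hp0
  rcases hP0.eq_or_lt with h | h
  · rw [← h, div_zero]
    positivity
  · rw [div_le_div_iff₀ h hx]
    linarith [mul_half_le_integral_Ioo_half hp hx]

theorem enorm_doublingOperator_le (hp : AntitoneOn p (Ioi 0)) (hp0 : ∀ x, 0 ≤ p x) (h : L0 𝕜)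
    {x : ℝ} (hx : 0 < x) :
    ‖doublingOperator p h x‖ₑ ≤ ENNReal.ofReal (2 / x) * ∫⁻ z in Ioo (x / 2) x, ‖h z‖ₑ := by
  rw [doublingOperator, enorm_mul,
    enorm_ofReal_of_nonneg (div_nonneg (hp0 x) (integral_nonneg hp0))]
  exact mul_le_mul' (ENNReal.ofReal_le_ofReal (div_integral_Ioo_half_le hp hp0 hx))
    (enorm_integral_le_lintegral_enorm _)

theorem measurable_doublingOperator (hpm : Measurable p) (h : L0 𝕜) :
    Measurable (doublingOperator p h) := by
  have hα : Measurable fun x : ℝ => x / 2 := measurable_id.div_const 2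
  exact (RCLike.measurable_ofReal.comp (hpm.div (stronglyMeasurable_integral_Ioo (𝕜 := ℝ) hα
    measurable_id hpm.stronglyMeasurable).measurable)).mul
    (stronglyMeasurable_integral_Ioo hα measurable_id h.stronglyMeasurable).measurable

theorem lintegral_doublingOperator_le (hp : AntitoneOn p (Ioi 0)) (hp0 : ∀ x, 0 ≤ p x)
    (h : L0 𝕜) :
    ∫⁻ x in Ioi 0, ‖doublingOperator p h x‖ₑ ≤ (2 : ℝ≥0) * ∫⁻ x in Ioi 0, ‖h x‖ₑ :=
  calc ∫⁻ x in Ioi 0, ‖doublingOperator p h x‖ₑ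
      ≤ ∫⁻ x in Ioi 0, ENNReal.ofReal (2 / x) * ∫⁻ z in Ioo (x / 2) x, ‖h z‖ₑ :=
        setLIntegral_mono' measurableSet_Ioi fun _ hx => enorm_doublingOperator_le hp hp0 h hx
    _ ≤ (2 : ℝ≥0) * ∫⁻ x in Ioi 0, ‖h x‖ₑ :=
        lintegral_mul_lintegral_Ioo_le (measurable_id.div_const 2) measurable_id
          (measurable_const.div measurable_id).ennreal_ofReal
          h.stronglyMeasurable.measurable.enorm measurableSet_Ioi lintegral_doubling_kernel

theorem enorm_doublingOperator_le_levelNorm (hp : AntitoneOn p (Ioi 0)) (hp0 : ∀ x, 0 ≤ p x)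
    (h : L0 𝕜) {x : ℝ} (hx : 0 < x) : ‖doublingOperator p h x‖ₑ ≤ 2 * levelNorm h := by
  have hmass : ∫⁻ z in Ioo (x / 2) x, ‖h z‖ₑ ≤ levelNorm h * ENNReal.ofReal x :=
    (lintegral_mono_set (Ioo_half_subset hx)).trans (lintegral_le_levelNorm h hx)
  calc ‖doublingOperator p h x‖ₑ
      ≤ ENNReal.ofReal (2 / x) * ∫⁻ z in Ioo (x / 2) x, ‖h z‖ₑ :=
        enorm_doublingOperator_le hp hp0 h hx
    _ ≤ ENNReal.ofReal (2 / x) * (levelNorm h * ENNReal.ofReal x) := by gcongr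
    _ = ENNReal.ofReal (2 / x * x) * levelNorm h := by
        rw [ENNReal.ofReal_mul (div_nonneg zero_le_two hx.le)]
        ring
    _ = 2 * levelNorm h := by
        rw [div_mul_cancel₀ _ hx.ne', ENNReal.ofReal_ofNat]

theorem doublingOperator_eq_self (hp : AntitoneOn p (Ioi 0)) (hp0 : ∀ x, 0 ≤ p x) {w : L0 𝕜}
    (hwp : ∀ᵐ x ∂halfLine, w x = (p x : 𝕜)) {x : ℝ} (hx : 0 < x) :
    doublingOperator p w x = p x := by
  have hint : ∫ z in Ioo (x / 2) x, w z = ((∫ z in Ioo (x / 2) x, p z : ℝ) : 𝕜) := by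
    rw [← integral_ofReal]
    exact integral_congr_ae
      (ae_restrict_of_subset_Ioi ((Ioo_half_subset hx).trans Ioo_subset_Ioi_self) hwp)
  rw [doublingOperator, hint, ← RCLike.ofReal_mul]
  congr 1
  have hP : p x * (x / 2) ≤ ∫ z in Ioo (x / 2) x, p z := mul_half_le_integral_Ioo_half hp hx
  refine div_mul_cancel_of_imp fun h0 => ?_
  rw [h0] at hP
  exact le_antisymm (nonpos_of_mul_nonpos_left hP (half_pos hx)) (hp0 x)

theorem isImage_two_of_isDecreasing {w : L0 𝕜} (hw : w ∈ (coupleL1LevelLinfty 𝕜).sum)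
    (hd : IsDecreasing w) :
    IsImage 2 (coupleL1LevelLinfty 𝕜) (coupleL1Linfty 𝕜) w w := by
  obtain ⟨p, hpm, hp, hp0, hwp⟩ := hd
  have hpos : ∀ᵐ x ∂halfLine, 0 < x := ae_restrict_mem measurableSet_Ioi
  have hsub {x : ℝ} (hx : 0 < x) : Ioo (x / 2) x ⊆ Ioi 0 :=
    (Ioo_half_subset hx).trans Ioo_subset_Ioi_self
  have hinteg {h : L0 𝕜} (hh : h ∈ (coupleL1LevelLinfty 𝕜).sum) {x : ℝ} (hx : 0 < x) :
      IntegrableOn h (Ioo (x / 2) x) :=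
    (hasFinitePrimitive_of_mem_sum hh x).mono_set (Ioo_half_subset hx)
  refine isImage_of_fun (doublingOperator p)
    (fun h _ => (measurable_doublingOperator hpm h).aestronglyMeasurable)
    (fun h hh k hk => ?_) (fun r h _ => ?_) (fun h k _ hk => ?_) (fun h k _ hk => ?_) hw ?_
  · filter_upwards [hpos] with x hx
    rw [doublingOperator, setIntegral_coeFn_add (hsub hx) (hinteg hh hx) (hinteg hk hx), mul_add]
    rfl
  · filter_upwards [hpos] with x hx
    rw [doublingOperator, setIntegral_coeFn_smul (hsub hx), mul_left_comm]
    rfl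
  · rw [show (coupleL1LevelLinfty 𝕜).X₀.nrm h = _ from nrm_L1 h]
    refine (nrm_L1 k).trans_le (le_trans ?_ (lintegral_doublingOperator_le hp hp0 h))
    exact (lintegral_congr_ae (hk.mono fun x hx => by rw [hx])).le
  · refine (nrm_Linfty_le_iff k _).2 ?_
    filter_upwards [hk, hpos] with x hx hx0
    exact hx ▸ enorm_doublingOperator_le_levelNorm hp hp0 h hx0
  · filter_upwards [hwp, hpos] with x hx hx0
    rw [hx, doublingOperator_eq_self hp hp0 hwp hx0]

variable {h : L0 𝕜}

theorem realPrimitive_sub (hh : HasFinitePrimitive h) {s t : ℝ} (hs : 0 ≤ s)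
    (hst : s ≤ t) : realPrimitive h t - realPrimitive h s = ∫ x in Ioo s t, ‖h x‖ := by
  rw [realPrimitive_eq_intervalIntegral, realPrimitive_eq_intervalIntegral,
    intervalIntegral.integral_interval_sub_left (intervalIntegrable_indicator hh _ _)
      (intervalIntegrable_indicator hh _ _), intervalIntegral.integral_of_le hst,
    integral_Ioc_eq_integral_Ioo]
  refine setIntegral_congr_fun measurableSet_Ioo fun x hx => ?_
  exact indicator_of_mem (show x ∈ Ioi (0 : ℝ) from hs.trans_lt hx.1) fun x => ‖h x‖

theorem ae_hasDerivAt_realPrimitive (hh : HasFinitePrimitive h) :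
    ∀ᵐ x ∂halfLine, HasDerivAt (realPrimitive h) ‖h x‖ x := by
  have hloc : LocallyIntegrable ((Ioi 0).indicator fun x => ‖h x‖) volume := by
    rw [locallyIntegrable_iff]
    intro K hK
    obtain ⟨R, hR⟩ := hK.isBounded.subset_closedBall 0
    rw [Real.closedBall_eq_Icc] at hR
    have := (intervalIntegrable_indicator hh (-(|R| + 1)) (|R| + 1)).1
    refine this.mono_set fun x hx => ?_
    have h1 := hR hx
    have h2 := le_abs_self R
    exact ⟨by linarith [h1.1], by linarith [h1.2]⟩
  filter_upwards [ae_restrict_of_ae (LocallyIntegrable.ae_hasDerivAt_integral hloc),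
    ae_restrict_mem measurableSet_Ioi] with x hx hx0
  have h1 := hx 0
  rw [indicator_of_mem hx0] at h1
  exact h1.congr_of_eventuallyEq (Eventually.of_forall (realPrimitive_eq_intervalIntegral h))

theorem primitive_eq_ofReal (hh : HasFinitePrimitive h) (t : ℝ) :
    primitive (fun x => ‖h x‖ₑ) t = ENNReal.ofReal (realPrimitive h t) :=
  (ofReal_realPrimitive hh t).symm

theorem lcm_primitive_ne_top (hh : h ∈ (coupleL1LevelLinfty 𝕜).sum) (y : ℝ) :
    leastConcaveMajorant (primitive fun x => ‖h x‖ₑ) y ≠ ∞ := by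
  obtain ⟨A, B, H⟩ := exists_affine_bound hh
  refine ne_top_of_le_ne_top ENNReal.ofReal_ne_top (leastConcaveMajorant_le
    (isConcaveMajorant_affine A.2 B.2 fun t ht => (H t ht).trans (le_of_eq ?_)) y)
  rw [ENNReal.ofReal_add A.2 (mul_nonneg B.2 ht.le), ENNReal.ofReal_mul B.2,
    show ((A : ℝ≥0).1 : ℝ) = (A : ℝ) from rfl, show ((B : ℝ≥0).1 : ℝ) = (B : ℝ) from rfl,
    ENNReal.ofReal_coe_nnreal, ENNReal.ofReal_coe_nnreal]

theorem levelFunction_eq_levelDeriv (hh : h ∈ (coupleL1LevelLinfty 𝕜).sum) :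
    (levelFunction fun x => ‖h x‖ₑ) = levelDeriv fun x => ‖h x‖ₑ := by
  funext x
  rw [levelFunction, if_pos fun y _ => lcm_primitive_ne_top hh y]

theorem concaveOn_realPrimitive (hh : HasFinitePrimitive h) (hd : IsDecreasing h) :
    ConcaveOn ℝ (Ioi 0) (realPrimitive h) := by
  obtain ⟨p, -, hp, hp0, hhp⟩ := hd
  have hsub {a b : ℝ} (ha : 0 < a) (hab : a < b) :
      realPrimitive h b - realPrimitive h a = ∫ x in Ioo a b, p x := by
    rw [realPrimitive_sub hh ha.le hab.le]
    refine integral_congr_ae (ae_restrict_of_subset_Ioi (fun x hx => ha.trans hx.1) ?_)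
    filter_upwards [hhp] with x hx
    rw [hx, RCLike.norm_ofReal, abs_of_nonneg (hp0 x)]
  refine concaveOn_of_slope_anti_adjacent (convex_Ioi 0) fun {x y z} hx _ hxy hyz => ?_
  have hy : 0 < y := (mem_Ioi.1 hx).trans hxy
  rw [hsub hx hxy, hsub hy hyz]
  calc (∫ x in Ioo y z, p x) / (z - y)
      ≤ p y := (div_le_iff₀ (sub_pos.2 hyz)).2 (integral_Ioo_le_mul hp hy hyz)
    _ ≤ (∫ x in Ioo x y, p x) / (y - x) :=
        (le_div_iff₀ (sub_pos.2 hxy)).2 (mul_le_integral_Ioo hp hx hxy)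

theorem leastConcaveMajorant_of_isDecreasing (hh : HasFinitePrimitive h) (hd : IsDecreasing h)
    {y : ℝ} (hy : 0 < y) :
    leastConcaveMajorant (primitive fun x => ‖h x‖ₑ) y = ENNReal.ofReal (realPrimitive h y) := by
  have hmaj : IsConcaveMajorant (primitive fun x => ‖h x‖ₑ) (realPrimitive h) :=
    ⟨concaveOn_realPrimitive hh hd,
      fun y _ => ⟨realPrimitive_nonneg h y, (primitive_eq_ofReal hh y).le⟩⟩
  exact le_antisymm (leastConcaveMajorant_le hmaj y)
    ((primitive_eq_ofReal hh y).symm.trans_le (le_leastConcaveMajorant hy))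

theorem levelFunction_of_isDecreasing (hh : HasFinitePrimitive h) (hd : IsDecreasing h) :
    ∀ᵐ x ∂halfLine, h x = (((levelFunction fun y => ‖h y‖ₑ) x).toReal : 𝕜) := by
  have hlevel : (levelFunction fun x => ‖h x‖ₑ) = levelDeriv fun x => ‖h x‖ₑ :=
    funext fun _ => if_pos fun y hy =>
      (leastConcaveMajorant_of_isDecreasing hh hd hy).trans_ne ENNReal.ofReal_ne_top
  obtain ⟨p, -, -, hp0, hhp⟩ := id hd
  filter_upwards [hhp, ae_hasDerivAt_realPrimitive hh, ae_restrict_mem measurableSet_Ioi]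
    with x hx hderiv hx0
  have hlcm : (fun y => (leastConcaveMajorant (primitive fun x => ‖h x‖ₑ) y).toReal) =ᶠ[𝓝 x]
      realPrimitive h := by
    filter_upwards [Ioi_mem_nhds hx0] with y hy
    rw [leastConcaveMajorant_of_isDecreasing hh hd hy,
      ENNReal.toReal_ofReal (realPrimitive_nonneg h y)]
  rw [hlevel, levelDeriv, hlcm.deriv_eq, hderiv.deriv, hx, RCLike.norm_ofReal,
    abs_of_nonneg (hp0 x), ENNReal.toReal_ofReal (hp0 x)]

end Decreasing

/-! ### Least concave majorants of increasing functions -/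

section ConcaveMajorants

/-- `g` is the least concave majorant on `[0, ∞)` of the increasing function `F`, and is continuous
with `g 0 = 0`. -/
structure IsLeastConcaveMajorant (F g : ℝ → ℝ) : Prop where
  mono : Monotone F
  nonneg : ∀ t, 0 ≤ F t
  continuous : Continuous F
  concave : ConcaveOn ℝ (Ici 0) g
  continuousOn : ContinuousOn g (Ici 0)
  zero : g 0 = 0
  le : ∀ t, 0 ≤ t → F t ≤ g t
  least : ∀ ψ : ℝ → ℝ, ConcaveOn ℝ (Ioi 0) ψ → (∀ t, 0 < t → F t ≤ ψ t) → ∀ t, 0 < t → g t ≤ ψ t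

theorem concaveOn_affine (a b : ℝ) {s : Set ℝ} (hs : Convex ℝ s) :
    ConcaveOn ℝ s fun t => a + b * t := by
  refine ⟨hs, fun x _ y _ c d _ _ hcd => le_of_eq ?_⟩
  simp only [smul_eq_mul]
  linear_combination a * hcd

variable {F g : ℝ → ℝ}

theorem concaveOn_chord_le {s : Set ℝ} (hg : ConcaveOn ℝ s g) {x t z : ℝ} (hx : x ∈ s)
    (hz : z ∈ s) (hxt : x ≤ t) (htz : t ≤ z) (hxz : x < z) :
    g x + (g z - g x) / (z - x) * (t - x) ≤ g t := by
  rcases hxt.eq_or_lt with rfl | hxt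
  · simp
  rcases htz.eq_or_lt with rfl | htz
  · rw [div_mul_cancel₀ _ (by linarith)]; linarith
  have h := hg.slope_anti_adjacent hx hz hxt htz
  rw [div_le_div_iff₀ (by linarith) (by linarith)] at h
  have h1 : (g z - g x) / (z - x) * (t - x) ≤ g t - g x := by
    rw [div_mul_eq_mul_div, div_le_iff₀ (by linarith)]
    nlinarith
  linarith

theorem concaveOn_le_chord {s : Set ℝ} (hg : ConcaveOn ℝ s g) {x t z : ℝ} (hx : x ∈ s)
    (ht : t ∈ s) (hz : z ∈ s) (hxz : x < z) (h : t < x ∨ z < t) :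
    g t ≤ g x + (g z - g x) / (z - x) * (t - x) := by
  rcases h with h | h
  · have h1 := hg.slope_anti_adjacent ht hz h hxz
    rw [le_div_iff₀ (by linarith)] at h1
    nlinarith
  · have h1 := hg.slope_anti_adjacent hx ht hxz h
    rw [div_le_iff₀ (by linarith)] at h1
    have h2 : (g z - g x) / (z - x) * (z - x) = g z - g x := div_mul_cancel₀ _ (by linarith)
    nlinarith

theorem IsLeastConcaveMajorant.le_affine (H : IsLeastConcaveMajorant F g) {a b : ℝ}
    (h : ∀ t, 0 < t → F t ≤ a + b * t) {t : ℝ} (ht : 0 < t) : g t ≤ a + b * t :=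
  H.least _ (concaveOn_affine a b (convex_Ioi 0)) h t ht

theorem IsLeastConcaveMajorant.exists_pos_add_le (H : IsLeastConcaveMajorant F g) {k : ℝ → ℝ}
    {x z δ : ℝ} (hx : 0 ≤ x) (hk : ContinuousOn k (Icc x z))
    (hgap : ∀ t ∈ Icc x z, δ ≤ k t → F t < g t) :
    ∃ η, 0 < η ∧ ∀ t ∈ Icc x z, δ ≤ k t → F t + η ≤ g t := by
  have hcompact : IsCompact (Icc x z ∩ k ⁻¹' Ici δ) := isCompact_Icc.of_isClosed_subset
    (hk.preimage_isClosed_of_isClosed isClosed_Icc isClosed_Ici) inter_subset_left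
  have hcont : ContinuousOn (fun t => g t - F t) (Icc x z ∩ k ⁻¹' Ici δ) :=
    (H.continuousOn.mono fun _ ht => hx.trans ht.1.1).sub H.continuous.continuousOn
  obtain ⟨η, hη, hle⟩ := hcompact.exists_forall_le' hcont
    (a := 0) fun t ht => sub_pos.2 (hgap t ht.1 ht.2)
  exact ⟨η, hη, fun t ht hkt => by linarith [hle t ⟨ht, hkt⟩]⟩

theorem IsLeastConcaveMajorant.affine (H : IsLeastConcaveMajorant F g) {x z : ℝ} (hx : 0 ≤ x)
    (hxz : x < z) (hgap : ∀ t ∈ Ioo x z, F t < g t) {t : ℝ} (ht : t ∈ Icc x z) :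
    g t = g x + (g z - g x) / (z - x) * (t - x) := by
  set m := (g z - g x) / (z - x) with hm
  have hz : 0 ≤ z := hx.trans hxz.le
  refine le_antisymm ?_ (concaveOn_chord_le H.concave hx hz ht.1 ht.2 hxz)
  by_contra! hlt
  -- If `g` rises above its chord, by `δ` at most, the chord raised by slightly less than `δ`
  -- still lies above `F`, so `g` is not the least majorant.
  let k : ℝ → ℝ := fun u => g u - (g x + m * (u - x))
  have hk : ContinuousOn k (Icc x z) :=
    (H.continuousOn.mono fun u hu => hx.trans hu.1).sub (by fun_prop)
  obtain ⟨y, hy, hmax⟩ := isCompact_Icc.exists_isMaxOn (nonempty_Icc.2 hxz.le) hk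
  have hδ : 0 < k y := lt_of_lt_of_le (sub_pos.2 hlt) (hmax ht)
  have hkx : k x = 0 := by simp [k]
  have hkz : k z = 0 := by
    simp only [k, hm]
    rw [div_mul_cancel₀ _ (by linarith)]; ring
  have hinterior : ∀ u ∈ Icc x z, 0 < k u → u ∈ Ioo x z := fun u hu hku =>
    ⟨lt_of_le_of_ne hu.1 (by rintro rfl; exact hku.ne' hkx),
      lt_of_le_of_ne hu.2 (by rintro rfl; exact hku.ne' hkz)⟩
  obtain ⟨η, hη, hle⟩ := H.exists_pos_add_le hx hk (δ := k y / 2)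
    fun u hu hku => hgap u (hinterior u hu (by linarith))
  set ε := min (k y / 2) η
  have hε : 0 < ε := lt_min (by linarith) hη
  have hεδ : ε ≤ k y / 2 := min_le_left _ _
  have hεη : ε ≤ η := min_le_right _ _
  have hmaj : ∀ u, 0 < u → F u ≤ (g x - m * x + k y - ε) + m * u := by
    intro u hu
    have hFg := H.le u hu.le
    by_cases hux : u ∈ Icc x z
    · have hku : g u - (g x + m * (u - x)) ≤ k y := hmax hux
      rcases le_or_gt (k y / 2) (k u) with h | h
      · linarith [hle u hux h]
      · have hku' : g u - (g x + m * (u - x)) < k y / 2 := h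
        linarith only [hku', hεδ, hFg]
    · have hchord : g u ≤ g x + m * (u - x) :=
        concaveOn_le_chord H.concave hx hu.le hz hxz (by by_contra! h; exact hux h)
      linarith
  have hgy := H.le_affine hmaj (hx.trans_lt (hinterior y hy hδ).1)
  have hky : g y - (g x + m * (y - x)) = k y := rfl
  linarith only [hgy, hky, hε]

theorem IsLeastConcaveMajorant.affine_unbounded (H : IsLeastConcaveMajorant F g) {a : ℝ}
    (ha : 0 ≤ a) (hgap : ∀ t, a < t → F t < g t) {t : ℝ} (ht : a ≤ t) :
    g t = g a + (g (a + 1) - g a) * (t - a) := by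
  have hlt : a < max t (a + 1) := lt_max_of_lt_right (lt_add_one a)
  have h1 := H.affine ha hlt (fun u hu => hgap u hu.1) (t := t) ⟨ht, le_max_left _ _⟩
  have h2 := H.affine ha hlt (fun u hu => hgap u hu.1) (t := a + 1)
    ⟨by linarith, le_max_right _ _⟩
  rw [h1, h2]
  ring

theorem IsLeastConcaveMajorant.le_of_eventually_affine (H : IsLeastConcaveMajorant F g)
    {a m r Y : ℝ} (ha : 0 ≤ a) (hr : 0 ≤ r) (haff : ∀ t, a ≤ t → g t = g a + m * (t - a))
    (hF : ∀ t, Y < t → F t ≤ F a + r * (t - a)) : m ≤ r := by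
  by_contra! hrm
  set W := max Y a
  have hW : 0 ≤ W := ha.trans (le_max_right _ _)
  have hg : ∀ t, 0 ≤ t → 0 ≤ g t := fun t ht => (H.nonneg t).trans (H.le t ht)
  have hmaj : ∀ t, 0 < t → F t ≤ (g W + g a) + r * t := by
    intro t ht
    rcases le_or_gt t W with htW | htW
    · nlinarith [(H.mono htW).trans (H.le W hW), hg a ha]
    · nlinarith [hF t ((le_max_left _ _).trans_lt htW), H.le a ha, hg W hW]
  have hpos : 0 < (g W + m * a + 1) / (m - r) :=
    div_pos (by nlinarith [hg W hW]) (sub_pos.2 hrm)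
  set t := a + (g W + m * a + 1) / (m - r)
  have hgt := H.le_affine hmaj (t := t) (by linarith)
  rw [haff t (by linarith)] at hgt
  have ht : (m - r) * (t - a) = g W + m * a + 1 := by
    rw [add_sub_cancel_left, mul_div_cancel₀ _ (sub_pos.2 hrm).ne']
  nlinarith

theorem IsLeastConcaveMajorant.exists_mean_slope_gt (H : IsLeastConcaveMajorant F g) {a m ε : ℝ}
    (ha : 0 ≤ a) (haff : ∀ t, a ≤ t → g t = g a + m * (t - a)) (hε : 0 < ε) (Y : ℝ) :
    ∃ y, Y < y ∧ F a + (m - ε) * (y - a) ≤ F y := by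
  rcases le_or_gt (m - ε) 0 with hmε | hmε
  · refine ⟨max Y a + 1, by linarith [le_max_left Y a], ?_⟩
    have hay : a ≤ max Y a + 1 := by linarith [le_max_right Y a]
    nlinarith [H.mono hay]
  · by_contra! h
    linarith [H.le_of_eventually_affine ha hmε.le haff fun t ht => (h t ht).le]

end ConcaveMajorants

/-! ### Gaps of a closed set -/

section Gaps

/-- The left end of the gap of `Z` that contains `t`. -/
noncomputable def gapLeft (Z : Set ℝ) (t : ℝ) : ℝ := sSup (Z ∩ Iic t)

open Classical in
/-- The right end of the gap of `Z` that contains `t`, if the gap is bounded. -/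
noncomputable def gapRight (Z : Set ℝ) (t : ℝ) : ℝ :=
  if (Z ∩ Ici t).Nonempty then sInf (Z ∩ Ici t) else t

/-- The points which are not to the right of the whole set `Z`. -/
def notBeyond (Z : Set ℝ) : Set ℝ := {s | ∃ w ∈ Z, s ≤ w}

/-- `Z` is a closed subset of `[0, ∞)` that contains `0`. -/
structure IsContactSet (Z : Set ℝ) : Prop where
  closed : IsClosed Z
  zero_mem : (0 : ℝ) ∈ Z
  nonneg : ∀ t ∈ Z, 0 ≤ t

variable {Z : Set ℝ}

theorem IsContactSet.gapLeft_mem (hZ : IsContactSet Z) {t : ℝ} (ht : 0 ≤ t) :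
    gapLeft Z t ∈ Z ∩ Iic t :=
  (hZ.closed.inter isClosed_Iic).csSup_mem ⟨0, hZ.zero_mem, ht⟩ ⟨t, fun _ hx => hx.2⟩

theorem le_gapLeft {w t : ℝ} (hw : w ∈ Z) (hwt : w ≤ t) : w ≤ gapLeft Z t :=
  le_csSup ⟨t, fun _ hx => hx.2⟩ ⟨hw, hwt⟩

theorem IsContactSet.gapLeft_nonneg (hZ : IsContactSet Z) (t : ℝ) : 0 ≤ gapLeft Z t :=
  Real.sSup_nonneg fun w hw => hZ.nonneg w hw.1

theorem IsContactSet.monotone_gapLeft (hZ : IsContactSet Z) : Monotone (gapLeft Z) := by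
  intro s t hst
  rcases lt_or_ge s 0 with hs | hs
  · have : Z ∩ Iic s = ∅ := by
      ext w
      simp only [mem_inter_iff, mem_Iic, mem_empty_iff_false, iff_false, not_and, not_le]
      exact fun hw => hs.trans_le (hZ.nonneg w hw)
    rw [gapLeft, this, Real.sSup_empty]
    exact hZ.gapLeft_nonneg t
  · have h := hZ.gapLeft_mem hs
    exact le_gapLeft h.1 (h.2.trans hst)

theorem nonempty_inter_Ici {t : ℝ} (ht : t ∈ notBeyond Z) : (Z ∩ Ici t).Nonempty :=
  let ⟨w, hw, htw⟩ := ht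
  ⟨w, hw, htw⟩

theorem IsContactSet.gapRight_mem (hZ : IsContactSet Z) {t : ℝ} (ht : t ∈ notBeyond Z) :
    gapRight Z t ∈ Z ∩ Ici t := by
  rw [gapRight, if_pos (nonempty_inter_Ici ht)]
  exact (hZ.closed.inter isClosed_Ici).csInf_mem (nonempty_inter_Ici ht) ⟨t, fun _ hx => hx.2⟩

theorem gapRight_le {w t : ℝ} (hw : w ∈ Z) (hwt : t ≤ w) : gapRight Z t ≤ w := by
  rw [gapRight, if_pos ⟨w, hw, hwt⟩]
  exact csInf_le ⟨t, fun _ hx => hx.2⟩ ⟨hw, hwt⟩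

theorem IsContactSet.monotone_gapRight (hZ : IsContactSet Z) : Monotone (gapRight Z) := by
  intro s t hst
  by_cases ht : t ∈ notBeyond Z
  · have h := hZ.gapRight_mem ht
    exact gapRight_le h.1 (hst.trans h.2)
  · have h1 : ¬ (Z ∩ Ici t).Nonempty := fun ⟨w, hw, htw⟩ => ht ⟨w, hw, htw⟩
    rw [show gapRight Z t = t by rw [gapRight, if_neg h1]]
    by_cases hs : s ∈ notBeyond Z
    · have h := hZ.gapRight_mem hs
      exact (not_le.1 fun h' => ht ⟨_, h.1, h'⟩).le
    · have h1 : ¬ (Z ∩ Ici s).Nonempty := fun ⟨w, hw, htw⟩ => hs ⟨w, hw, htw⟩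
      rwa [gapRight, if_neg h1]

theorem measurableSet_notBeyond : MeasurableSet (notBeyond Z) := by
  refine OrdConnected.measurableSet ⟨fun a _ b hb c hc => ?_⟩
  obtain ⟨w, hw, hbw⟩ := hb
  exact ⟨w, hw, hc.2.trans hbw⟩

theorem IsContactSet.gapLeft_lt (hZ : IsContactSet Z) {t : ℝ} (ht : 0 ≤ t) (htZ : t ∉ Z) :
    gapLeft Z t < t :=
  lt_of_le_of_ne (hZ.gapLeft_mem ht).2 fun h => htZ (h ▸ (hZ.gapLeft_mem ht).1)

theorem IsContactSet.lt_gapRight (hZ : IsContactSet Z) {t : ℝ} (ht : t ∈ notBeyond Z)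
    (htZ : t ∉ Z) : t < gapRight Z t :=
  lt_of_le_of_ne (hZ.gapRight_mem ht).2 fun h => htZ (h.symm ▸ (hZ.gapRight_mem ht).1)

theorem notMem_of_mem_gap {s z : ℝ} (hz : z ∈ Ioo (gapLeft Z s) (gapRight Z s)) : z ∉ Z := by
  intro hzZ
  rcases le_total z s with h | h
  · exact absurd (le_gapLeft hzZ h) (not_le.2 hz.1)
  · exact absurd (gapRight_le hzZ h) (not_le.2 hz.2)

theorem IsContactSet.gap_eq (hZ : IsContactSet Z) {s z : ℝ} (hs : s ∈ notBeyond Z)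
    (hs0 : 0 ≤ s) (hz : z ∈ Ioo (gapLeft Z s) (gapRight Z s)) :
    gapLeft Z z = gapLeft Z s ∧ gapRight Z z = gapRight Z s ∧ z ∈ notBeyond Z := by
  have hl := hZ.gapLeft_mem hs0
  have hr := hZ.gapRight_mem hs
  have hnot : ∀ w ∈ Z, w ≤ gapLeft Z s ∨ gapRight Z s ≤ w := by
    intro w hw
    by_contra! h
    exact notMem_of_mem_gap ⟨h.1, h.2⟩ hw
  have h1 : Z ∩ Iic z = Z ∩ Iic s := by
    ext w
    refine and_congr_right fun hw => ⟨fun h => ?_, fun h => ?_⟩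
    · rcases hnot w hw with h' | h'
      · exact h'.trans hl.2
      · exact absurd (h'.trans h) (not_le.2 hz.2)
    · exact (le_gapLeft hw h).trans hz.1.le
  have h2 : Z ∩ Ici z = Z ∩ Ici s := by
    ext w
    refine and_congr_right fun hw => ⟨fun h => ?_, fun h => ?_⟩
    · rcases hnot w hw with h' | h'
      · exact absurd (le_trans h h') (not_le.2 hz.1)
      · exact le_trans hr.2 h'
    · exact hz.2.le.trans (gapRight_le hw h)
  exact ⟨by rw [gapLeft, gapLeft, h1], by
    rw [gapRight, gapRight, h2, if_pos (nonempty_inter_Ici hs), if_pos (nonempty_inter_Ici hs)],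
    ⟨_, hr.1, hz.2.le⟩⟩

end Gaps

/-! ### Averaging over gaps -/

section GapAverages

open CompatibleCouple

variable {𝕜 : Type*} [RCLike 𝕜]

open Classical in
/-- Average `h` over the bounded gaps of `Z`, and replace it by a generalized limit of its means
on the unbounded gap, if there is one. -/
noncomputable def gapAverage (Z : Set ℝ) (B : ℕ → Set ℝ) (h : L0 𝕜) (s : ℝ) : 𝕜 :=
  if s ∈ Z then h s
  else if s ∈ notBeyond Z then
    (((gapRight Z s - gapLeft Z s)⁻¹ : ℝ) : 𝕜) * ∫ z in Ioo (gapLeft Z s) (gapRight Z s), h z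
  else limAverage B h

variable {Z : Set ℝ} {B : ℕ → Set ℝ} {a : ℝ} {y : ℕ → ℝ}

theorem measurable_gapAverage (hZ : IsContactSet Z) (B : ℕ → Set ℝ) (h : L0 𝕜) :
    Measurable (gapAverage Z B h) := by
  refine Measurable.ite hZ.closed.measurableSet h.stronglyMeasurable.measurable
    (Measurable.ite measurableSet_notBeyond ?_ measurable_const)
  exact (RCLike.measurable_ofReal.comp (hZ.monotone_gapRight.measurable.sub
    hZ.monotone_gapLeft.measurable).inv).mul (stronglyMeasurable_integral_Ioo
      hZ.monotone_gapLeft.measurable hZ.monotone_gapRight.measurable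
      h.stronglyMeasurable).measurable

theorem enorm_gapAverage_le (hZ : IsContactSet Z) (B : ℕ → Set ℝ) (h : L0 𝕜) {s : ℝ}
    (hs0 : 0 ≤ s) (hs : s ∈ notBeyond Z) (hsZ : s ∉ Z) :
    ‖gapAverage Z B h s‖ₑ ≤ ENNReal.ofReal (gapRight Z s - gapLeft Z s)⁻¹ *
      ∫⁻ z in Ioo (gapLeft Z s) (gapRight Z s), ‖h z‖ₑ := by
  have hpos : 0 ≤ (gapRight Z s - gapLeft Z s)⁻¹ :=
    inv_nonneg.2 (by linarith [hZ.gapLeft_lt hs0 hsZ, hZ.lt_gapRight hs hsZ])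
  rw [gapAverage, if_neg hsZ, if_pos hs, enorm_mul, enorm_ofReal_of_nonneg hpos]
  gcongr
  exact enorm_integral_le_lintegral_enorm _

/-- `E` contains, with each of its points, the whole gap of `Z` in which the point lies, and that
gap is bounded. Averaging over gaps does not increase the mass on such a set. -/
structure IsUnionOfGaps (Z E : Set ℝ) : Prop where
  measurableSet : MeasurableSet E
  subset_Ioi : E ⊆ Ioi 0
  subset_notBeyond : E ⊆ notBeyond Z
  gap_subset : ∀ s ∈ E, s ∉ Z → Ioo (gapLeft Z s) (gapRight Z s) ⊆ E

theorem IsContactSet.isUnionOfGaps_Ioo (hZ : IsContactSet Z) {w : ℝ} (hw : w ∈ Z) :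
    IsUnionOfGaps Z (Ioo 0 w) where
  measurableSet := measurableSet_Ioo
  subset_Ioi := Ioo_subset_Ioi_self
  subset_notBeyond := fun _ hs => ⟨w, hw, hs.2.le⟩
  gap_subset := fun s hs _ _ hz =>
    ⟨(hZ.gapLeft_nonneg s).trans_lt hz.1, hz.2.trans_le (gapRight_le hw hs.2.le)⟩

theorem IsContactSet.isUnionOfGaps_notBeyond (hZ : IsContactSet Z) :
    IsUnionOfGaps Z (Ioi 0 ∩ notBeyond Z) where
  measurableSet := measurableSet_Ioi.inter measurableSet_notBeyond
  subset_Ioi := inter_subset_left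
  subset_notBeyond := inter_subset_right
  gap_subset := fun s hs _ _ hz =>
    ⟨(hZ.gapLeft_nonneg s).trans_lt hz.1, _, (hZ.gapRight_mem hs.2).1, hz.2.le⟩

theorem lintegral_gap_kernel (hZ : IsContactSet Z) {E : Set ℝ} (hE : IsUnionOfGaps Z E) (z : ℝ) :
    ∫⁻ s in E \ Z, {s | gapLeft Z s < z ∧ z < gapRight Z s}.indicator
      (fun s => ENNReal.ofReal (gapRight Z s - gapLeft Z s)⁻¹) s ≤
      (E \ Z).indicator (fun _ => ((1 : ℝ≥0) : ℝ≥0∞)) z := by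
  have hZm := hZ.closed.measurableSet
  have hm : MeasurableSet {s | gapLeft Z s < z ∧ z < gapRight Z s} :=
    (measurableSet_lt hZ.monotone_gapLeft.measurable measurable_const).inter
      (measurableSet_lt measurable_const hZ.monotone_gapRight.measurable)
  rw [lintegral_indicator hm, Measure.restrict_restrict hm]
  set S := {s | gapLeft Z s < z ∧ z < gapRight Z s} ∩ (E \ Z)
  by_cases hz : z ∈ E \ Z
  · rw [indicator_of_mem hz]
    have hlt : gapLeft Z z < gapRight Z z :=
      (hZ.gapLeft_lt (le_of_lt (hE.subset_Ioi hz.1)) hz.2).trans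
        (hZ.lt_gapRight (hE.subset_notBeyond hz.1) hz.2)
    have heq : ∀ s ∈ S, gapLeft Z z = gapLeft Z s ∧ gapRight Z z = gapRight Z s := fun s hs =>
      let h := hZ.gap_eq (hE.subset_notBeyond hs.2.1) (le_of_lt (hE.subset_Ioi hs.2.1)) hs.1
      ⟨h.1, h.2.1⟩
    calc ∫⁻ s in S, ENNReal.ofReal (gapRight Z s - gapLeft Z s)⁻¹
        = ∫⁻ _ in S, ENNReal.ofReal (gapRight Z z - gapLeft Z z)⁻¹ := by
          refine setLIntegral_congr_fun (hm.inter (hE.measurableSet.diff hZm)) fun s hs => ?_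
          rw [(heq s hs).1, (heq s hs).2]
      _ ≤ ∫⁻ _ in Ioo (gapLeft Z z) (gapRight Z z),
          ENNReal.ofReal (gapRight Z z - gapLeft Z z)⁻¹ := by
          refine lintegral_mono_set fun s hs => ?_
          rw [(heq s hs).1, (heq s hs).2]
          exact ⟨hZ.gapLeft_lt (le_of_lt (hE.subset_Ioi hs.2.1)) hs.2.2,
            hZ.lt_gapRight (hE.subset_notBeyond hs.2.1) hs.2.2⟩
      _ = (1 : ℝ≥0) := by
          rw [setLIntegral_const, Real.volume_Ioo,
            ← ENNReal.ofReal_mul (inv_nonneg.2 (by linarith)),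
            inv_mul_cancel₀ (by linarith), ENNReal.ofReal_one, ENNReal.coe_one]
  · have hempty : S = ∅ := eq_empty_of_forall_notMem fun s hs =>
      hz ⟨hE.gap_subset s hs.2.1 hs.2.2 hs.1, notMem_of_mem_gap hs.1⟩
    rw [hempty, Measure.restrict_empty, lintegral_zero_measure]
    exact zero_le

theorem lintegral_gapAverage_le (hZ : IsContactSet Z) (B : ℕ → Set ℝ) (h : L0 𝕜) {E : Set ℝ}
    (hE : IsUnionOfGaps Z E) :
    ∫⁻ s in E, ‖gapAverage Z B h s‖ₑ ≤ ∫⁻ s in E, ‖h s‖ₑ := by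
  have hZm := hZ.closed.measurableSet
  rw [← lintegral_inter_add_sdiff _ E hZm, ← lintegral_inter_add_sdiff (fun s => ‖h s‖ₑ) E hZm]
  refine add_le_add (le_of_eq ?_) ?_
  · refine setLIntegral_congr_fun (hE.measurableSet.inter hZm) fun s hs => ?_
    rw [gapAverage, if_pos hs.2]
  · calc ∫⁻ s in E \ Z, ‖gapAverage Z B h s‖ₑ
        ≤ ∫⁻ s in E \ Z, ENNReal.ofReal (gapRight Z s - gapLeft Z s)⁻¹ *
            ∫⁻ z in Ioo (gapLeft Z s) (gapRight Z s), ‖h z‖ₑ := by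
          refine lintegral_mono_ae ?_
          filter_upwards [ae_restrict_mem (hE.measurableSet.diff hZm)] with s hs
          exact enorm_gapAverage_le hZ B h (le_of_lt (hE.subset_Ioi hs.1))
            (hE.subset_notBeyond hs.1) hs.2
      _ ≤ (1 : ℝ≥0) * ∫⁻ z in E \ Z, ‖h z‖ₑ :=
          lintegral_mul_lintegral_Ioo_le hZ.monotone_gapLeft.measurable
            hZ.monotone_gapRight.measurable (hZ.monotone_gapRight.measurable.sub
            hZ.monotone_gapLeft.measurable).inv.ennreal_ofReal
            h.stronglyMeasurable.measurable.enorm (hE.measurableSet.diff hZm)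
            (lintegral_gap_kernel hZ hE)
      _ = _ := by rw [ENNReal.coe_one, one_mul]

/-- The intervals `(a, y n)`, over which `gapAverage` takes means on the unbounded gap, start at the
left end `a` of that gap, if there is one, and exhaust it. -/
structure IsMeanSequence (Z : Set ℝ) (a : ℝ) (y : ℕ → ℝ) : Prop where
  nonneg : 0 ≤ a
  add_one_le : ∀ n, a + 1 ≤ y n
  tendsto : Tendsto y atTop atTop
  greatest : ∀ s, s ∉ notBeyond Z → IsGreatest Z a

theorem IsMeanSequence.volume_eq (hy : IsMeanSequence Z a y) (n : ℕ) :
    volume.real (Ioo a (y n)) = y n - a :=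
  Real.volume_real_Ioo_of_le (by linarith [hy.add_one_le n])

theorem IsMeanSequence.subset (hy : IsMeanSequence Z a y) (n : ℕ) : Ioo a (y n) ⊆ Ioi 0 :=
  fun _ hx => hy.nonneg.trans_lt hx.1

theorem realPrimitive_le_of_levelNorm {h : L0 𝕜} (hh : levelNorm h < ∞) {t : ℝ} (ht : 0 ≤ t) :
    realPrimitive h t ≤ (levelNorm h).toReal * t := by
  rcases ht.eq_or_lt with rfl | ht
  · rw [realPrimitive_of_nonpos h le_rfl, mul_zero]
  have h1 := lintegral_le_levelNorm h ht
  rw [← ofReal_realPrimitive (hasFinitePrimitive_of_mem_sum (mem_sum_right hh)),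
    ← ENNReal.ofReal_toReal hh.ne, ← ENNReal.ofReal_mul ENNReal.toReal_nonneg] at h1
  exact (ENNReal.ofReal_le_ofReal_iff (by positivity)).1 h1

theorem IsMeanSequence.setAverage_le (hy : IsMeanSequence Z a y) {h : L0 𝕜}
    (hh : levelNorm h < ∞) (n : ℕ) :
    ⨍ x in Ioo a (y n), ‖h x‖ ≤ (levelNorm h).toReal * (1 + a * (y n - a)⁻¹) := by
  have h1 := hy.add_one_le n
  have hfin : HasFinitePrimitive h := hasFinitePrimitive_of_mem_sum (mem_sum_right hh)
  rw [setAverage_eq, hy.volume_eq, smul_eq_mul, ← realPrimitive_sub hfin hy.nonneg (by linarith)]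
  have hya : 0 < y n - a := by linarith
  have h2 := realPrimitive_le_of_levelNorm hh (t := y n) (by linarith [hy.nonneg])
  have h3 := realPrimitive_nonneg h a
  rw [inv_mul_le_iff₀ hya]
  have h4 : (y n - a) * ((levelNorm h).toReal * (1 + a * (y n - a)⁻¹)) =
      (levelNorm h).toReal * y n := by
    field_simp; ring
  linarith

theorem IsMeanSequence.hasBoundedAverages (hy : IsMeanSequence Z a y) {h : L0 𝕜}
    (hh : h ∈ (coupleL1LevelLinfty 𝕜).sum) : HasBoundedAverages (fun n => Ioo a (y n)) h := by
  obtain ⟨u, v, hu, hv, rfl⟩ := mem_sum_iff.1 hh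
  refine HasBoundedAverages.add hy.subset (hasBoundedAverages_of_L1 hy.subset (fun n => ?_) hu)
    ⟨fun n => ?_, (levelNorm v).toReal * (1 + a), fun n => (hy.setAverage_le hv n).trans ?_⟩
  · rw [hy.volume_eq]; linarith [hy.add_one_le n]
  · exact (hasFinitePrimitive_of_mem_sum (mem_sum_right hv) (y n)).mono_set
      (Ioo_subset_Ioo_left hy.nonneg)
  · have h1 : (y n - a)⁻¹ ≤ 1 := inv_le_one_of_one_le₀ (by linarith [hy.add_one_le n])
    have h2 : a * (y n - a)⁻¹ ≤ a := mul_le_of_le_one_right hy.nonneg h1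
    gcongr

theorem IsMeanSequence.norm_limAverage_le (hy : IsMeanSequence Z a y) {h : L0 𝕜}
    (hh : levelNorm h < ∞) :
    ‖limAverage (fun n => Ioo a (y n)) h‖ ≤ (levelNorm h).toReal := by
  refine CalderonMityagin.norm_limAverage_le (hy.hasBoundedAverages (mem_sum_right hh))
    (hy.setAverage_le hh) ?_
  have h1 : Tendsto (fun n => (y n - a)⁻¹) atTop (𝓝 0) :=
    tendsto_inv_atTop_zero.comp (tendsto_atTop_add_const_right _ _ hy.tendsto)
  simpa using ((h1.const_mul a).const_add 1).const_mul (levelNorm h).toReal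

theorem IsMeanSequence.limAverage_of_L1 (hy : IsMeanSequence Z a y) {h : L0 𝕜}
    (hh : (lebesgue 𝕜 1 le_rfl).nrm h < ∞) : limAverage (fun n => Ioo a (y n)) h = 0 := by
  refine CalderonMityagin.limAverage_of_L1 hy.subset (fun n => ?_) ?_ hh
  · rw [hy.volume_eq]; linarith [hy.add_one_le n]
  · simp only [hy.volume_eq]
    exact tendsto_atTop_add_const_right _ _ hy.tendsto

theorem enorm_gapAverage_le_slope (hZ : IsContactSet Z) (B : ℕ → Set ℝ) {h : L0 𝕜}
    (hh : HasFinitePrimitive h) {t : ℝ} (ht : 0 ≤ t) (htR : t ∈ notBeyond Z) {s : ℝ}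
    (hs : s ∈ Ioo (gapLeft Z t) (gapRight Z t)) :
    ‖gapAverage Z B h s‖ₑ ≤ ENNReal.ofReal ((gapRight Z t - gapLeft Z t)⁻¹ *
      (realPrimitive h (gapRight Z t) - realPrimitive h (gapLeft Z t))) := by
  have hl : 0 ≤ gapLeft Z t := hZ.gapLeft_nonneg t
  have hlr : gapLeft Z t ≤ gapRight Z t := (hZ.gapLeft_mem ht).2.trans (hZ.gapRight_mem htR).2
  obtain ⟨hleft, hright, hsR⟩ := hZ.gap_eq htR ht hs
  refine (enorm_gapAverage_le hZ B h (hl.trans hs.1.le) hsR (notMem_of_mem_gap hs)).trans_eq ?_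
  rw [hleft, hright, ENNReal.ofReal_mul (inv_nonneg.2 (sub_nonneg.2 hlr)),
    realPrimitive_sub hh hl hlr, ofReal_integral_norm_eq_lintegral_enorm
      ((hh (gapRight Z t)).mono_set (Ioo_subset_Ioo_left hl))]

theorem IsMeanSequence.eq_gapLeft (hy : IsMeanSequence Z a y) (hZ : IsContactSet Z) {t : ℝ}
    (ht : 0 ≤ t) (htR : t ∉ notBeyond Z) : a = gapLeft Z t := by
  have ha := hy.greatest t htR
  exact le_antisymm (le_gapLeft ha.1 (not_le.1 fun h => htR ⟨a, ha.1, h⟩).le)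
    (ha.2 (hZ.gapLeft_mem ht).1)

theorem IsMeanSequence.notMem_notBeyond (hy : IsMeanSequence Z a y) (hZ : IsContactSet Z) {s t : ℝ}
    (ht : 0 ≤ t) (htR : t ∉ notBeyond Z) (hs : gapLeft Z t < s) : s ∉ notBeyond Z := by
  rintro ⟨w, hw, hsw⟩
  rw [← hy.eq_gapLeft hZ ht htR] at hs
  exact (hs.trans_le hsw).not_ge ((hy.greatest t htR).2 hw)

theorem gapAverage_of_notMem_notBeyond (B : ℕ → Set ℝ) (h : L0 𝕜) {s : ℝ}
    (hs : s ∉ notBeyond Z) : gapAverage Z B h s = limAverage B h := by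
  rw [gapAverage, if_neg fun hsZ => hs ⟨s, hsZ, le_rfl⟩, if_neg hs]

theorem exists_enorm_gapAverage_le (hZ : IsContactSet Z) (hy : IsMeanSequence Z a y) {h : L0 𝕜}
    (hh : levelNorm h < ∞) {t : ℝ} (ht : 0 < t) :
    ∃ c : ℝ, 0 ≤ c ∧
      realPrimitive h (gapLeft Z t) + c * (t - gapLeft Z t) ≤ (levelNorm h).toReal * t ∧
      ∀ s ∈ Ioo (gapLeft Z t) t,
        ‖gapAverage Z (fun n => Ioo a (y n)) h s‖ₑ ≤ ENNReal.ofReal c := by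
  have hfin : HasFinitePrimitive h := hasFinitePrimitive_of_mem_sum (mem_sum_right hh)
  have hl0 : 0 ≤ gapLeft Z t := hZ.gapLeft_nonneg t
  have hVl := realPrimitive_le_of_levelNorm hh hl0
  by_cases htZ : t ∈ Z
  · have hl : gapLeft Z t = t := le_antisymm (hZ.gapLeft_mem ht.le).2 (le_gapLeft htZ le_rfl)
    rw [hl] at hVl ⊢
    exact ⟨0, le_rfl, by linarith, fun s hs => absurd hs.1 hs.2.not_gt⟩
  by_cases htR : t ∈ notBeyond Z
  · have hlt : gapLeft Z t < t := hZ.gapLeft_lt ht.le htZ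
    have htr : t < gapRight Z t := hZ.lt_gapRight htR htZ
    refine ⟨(gapRight Z t - gapLeft Z t)⁻¹ *
      (realPrimitive h (gapRight Z t) - realPrimitive h (gapLeft Z t)),
      mul_nonneg (inv_nonneg.2 (by linarith))
        (sub_nonneg.2 (monotone_realPrimitive hfin (by linarith))), ?_,
      fun s hs => enorm_gapAverage_le_slope hZ _ hfin ht.le htR ⟨hs.1, hs.2.trans htr⟩⟩
    have hVr := realPrimitive_le_of_levelNorm hh (t := gapRight Z t) (by linarith)
    generalize gapLeft Z t = l at *
    generalize gapRight Z t = r at *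
    have hrl : 0 < r - l := by linarith
    have hchord : (realPrimitive h l + (r - l)⁻¹ * (realPrimitive h r - realPrimitive h l) *
        (t - l)) * (r - l) = realPrimitive h l * (r - t) + realPrimitive h r * (t - l) := by
      field_simp; ring
    refine le_of_mul_le_mul_right ?_ hrl
    rw [hchord]
    nlinarith
  · refine ⟨(levelNorm h).toReal, ENNReal.toReal_nonneg, by linarith, fun s hs => ?_⟩
    rw [gapAverage_of_notMem_notBeyond _ _ (hy.notMem_notBeyond hZ ht.le htR hs.1), ← ofReal_norm]
    exact ENNReal.ofReal_le_ofReal (hy.norm_limAverage_le hh)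

theorem lintegral_gapAverage_le_levelNorm (hZ : IsContactSet Z) (hy : IsMeanSequence Z a y)
    {h : L0 𝕜} (hh : levelNorm h < ∞) {t : ℝ} (ht : 0 < t) :
    ∫⁻ s in Ioo 0 t, ‖gapAverage Z (fun n => Ioo a (y n)) h s‖ₑ ≤
      levelNorm h * ENNReal.ofReal t := by
  have hfin : HasFinitePrimitive h := hasFinitePrimitive_of_mem_sum (mem_sum_right hh)
  obtain ⟨hlZ, hlt⟩ := hZ.gapLeft_mem ht.le
  obtain ⟨c, hc0, hcM, hc⟩ := exists_enorm_gapAverage_le hZ hy hh ht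
  set l := gapLeft Z t
  calc ∫⁻ s in Ioo 0 t, ‖gapAverage Z (fun n => Ioo a (y n)) h s‖ₑ
      ≤ ∫⁻ s in Ioc 0 l ∪ Ioo l t, ‖gapAverage Z (fun n => Ioo a (y n)) h s‖ₑ := by
        refine lintegral_mono_set fun s hs => ?_
        rcases le_or_gt s l with hsl | hsl
        · exact Or.inl ⟨hs.1, hsl⟩
        · exact Or.inr ⟨hsl, hs.2⟩
    _ ≤ (∫⁻ s in Ioc 0 l, ‖gapAverage Z (fun n => Ioo a (y n)) h s‖ₑ) +
        ∫⁻ s in Ioo l t, ‖gapAverage Z (fun n => Ioo a (y n)) h s‖ₑ := lintegral_union_le _ _ _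
    _ ≤ ENNReal.ofReal (realPrimitive h l) + ∫⁻ _ in Ioo l t, ENNReal.ofReal c := by
        refine add_le_add ?_ (setLIntegral_mono measurable_const hc)
        rw [setLIntegral_congr Ioo_ae_eq_Ioc.symm, ofReal_realPrimitive hfin]
        exact lintegral_gapAverage_le hZ _ h (hZ.isUnionOfGaps_Ioo hlZ)
    _ = ENNReal.ofReal (realPrimitive h l + c * (t - l)) := by
        rw [setLIntegral_const, Real.volume_Ioo, ← ENNReal.ofReal_mul hc0,
          ENNReal.ofReal_add (realPrimitive_nonneg h l) (mul_nonneg hc0 (sub_nonneg.2 hlt))]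
    _ ≤ ENNReal.ofReal ((levelNorm h).toReal * t) := ENNReal.ofReal_le_ofReal hcM
    _ = levelNorm h * ENNReal.ofReal t := by
        rw [ENNReal.ofReal_mul ENNReal.toReal_nonneg, ENNReal.ofReal_toReal hh.ne]

theorem lintegral_Ioi_gapAverage_le (hZ : IsContactSet Z) (hy : IsMeanSequence Z a y) {h : L0 𝕜}
    (hh : (lebesgue 𝕜 1 le_rfl).nrm h < ∞) :
    ∫⁻ s in Ioi 0, ‖gapAverage Z (fun n => Ioo a (y n)) h s‖ₑ ≤ ∫⁻ s in Ioi 0, ‖h s‖ₑ := by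
  have hbeyond : ∫⁻ s in Ioi 0 \ notBeyond Z,
      ‖gapAverage Z (fun n => Ioo a (y n)) h s‖ₑ = 0 := by
    rw [← lintegral_zero (μ := volume.restrict (Ioi 0 \ notBeyond Z))]
    refine setLIntegral_congr_fun (measurableSet_Ioi.diff measurableSet_notBeyond) fun s hs => ?_
    rw [gapAverage_of_notMem_notBeyond _ _ hs.2, hy.limAverage_of_L1 hh, enorm_zero]
  rw [← lintegral_inter_add_sdiff _ (Ioi (0 : ℝ)) (measurableSet_notBeyond (Z := Z)), hbeyond,
    add_zero]
  exact (lintegral_gapAverage_le hZ _ h hZ.isUnionOfGaps_notBeyond).trans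
    (lintegral_mono_set inter_subset_left)

theorem IsContactSet.gap_subset (hZ : IsContactSet Z) (s : ℝ) :
    Ioo (gapLeft Z s) (gapRight Z s) ⊆ Ioo 0 (gapRight Z s) :=
  Ioo_subset_Ioo_left (hZ.gapLeft_nonneg s)

theorem gapAverage_add (hZ : IsContactSet Z) (hy : IsMeanSequence Z a y) {h k : L0 𝕜}
    (hh : h ∈ (coupleL1LevelLinfty 𝕜).sum) (hk : k ∈ (coupleL1LevelLinfty 𝕜).sum) :
    ∀ᵐ s ∂halfLine, gapAverage Z (fun n => Ioo a (y n)) (h + k) s =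
      gapAverage Z (fun n => Ioo a (y n)) h s + gapAverage Z (fun n => Ioo a (y n)) k s := by
  filter_upwards [AEEqFun.coeFn_add h k] with s hs
  simp only [gapAverage]
  split_ifs
  · rw [hs, Pi.add_apply]
  · rw [← mul_add, setIntegral_coeFn_add ((hZ.gap_subset s).trans Ioo_subset_Ioi_self)
      ((hasFinitePrimitive_of_mem_sum hh _).mono_set (hZ.gap_subset s))
      ((hasFinitePrimitive_of_mem_sum hk _).mono_set (hZ.gap_subset s))]
  · exact limAverage_add hy.subset (hy.hasBoundedAverages hh) (hy.hasBoundedAverages hk)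

theorem gapAverage_smul (hZ : IsContactSet Z) (hy : IsMeanSequence Z a y) (r : 𝕜) {h : L0 𝕜}
    (hh : h ∈ (coupleL1LevelLinfty 𝕜).sum) :
    ∀ᵐ s ∂halfLine, gapAverage Z (fun n => Ioo a (y n)) (r • h) s =
      r * gapAverage Z (fun n => Ioo a (y n)) h s := by
  filter_upwards [AEEqFun.coeFn_smul r h] with s hs
  simp only [gapAverage]
  split_ifs
  · rw [hs, Pi.smul_apply, smul_eq_mul]
  · rw [mul_left_comm, setIntegral_coeFn_smul ((hZ.gap_subset s).trans Ioo_subset_Ioi_self)]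
  · exact limAverage_smul hy.subset r (hy.hasBoundedAverages hh)

theorem isImage_gapAverage (hZ : IsContactSet Z) (hy : IsMeanSequence Z a y) {f v : L0 𝕜}
    (hf : f ∈ (coupleL1LevelLinfty 𝕜).sum)
    (hv : v =ᵐ[halfLine] gapAverage Z (fun n => Ioo a (y n)) f) :
    IsImage 1 (coupleL1LevelLinfty 𝕜) (coupleL1LevelLinfty 𝕜) f v := by
  refine isImage_of_fun (gapAverage Z fun n => Ioo a (y n))
    (fun h _ => (measurable_gapAverage hZ _ h).aestronglyMeasurable)
    (fun h hh k hk => gapAverage_add hZ hy hh hk) (fun r h hh => gapAverage_smul hZ hy r hh)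
    (fun h k hh hk => ?_) (fun h k hh hk => ?_) hf hv
  · rw [ENNReal.coe_one, one_mul]
    refine (nrm_L1 k).trans_le (le_trans ?_ (nrm_L1 h).ge)
    rw [lintegral_congr_ae (g := fun s => ‖gapAverage Z (fun n => Ioo a (y n)) h s‖ₑ)
      (by filter_upwards [hk] with s hs; rw [hs])]
    exact lintegral_Ioi_gapAverage_le hZ hy hh
  · rw [ENNReal.coe_one, one_mul]
    refine (levelNorm_le_iff k _).2 fun t ht => ?_
    rw [lintegral_congr_ae (g := fun s => ‖gapAverage Z (fun n => Ioo a (y n)) h s‖ₑ)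
      (by filter_upwards [ae_Ioo hk t] with s hs; rw [hs])]
    exact lintegral_gapAverage_le_levelNorm hZ hy hh ht

end GapAverages

/-! ### Level functions -/

section LevelFunctions

open CompatibleCouple

theorem mul_le_mul_of_concaveOn {g : ℝ → ℝ} (hg : ConcaveOn ℝ (Ioi 0) g)
    (h0 : ∀ t, 0 < t → 0 ≤ g t) {u v : ℝ} (hu : 0 < u) (huv : u < v) : u * g v ≤ v * g u := by
  have key : ∀ e ∈ Ioo 0 u, (g v - g u) * (u - e) ≤ g u * (v - u) := by
    intro e he
    have h := hg.slope_anti_adjacent he.1 (show v ∈ Ioi (0 : ℝ) from hu.trans huv) he.2 huv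
    rw [div_le_div_iff₀ (by linarith) (by linarith [he.2])] at h
    nlinarith [h0 e he.1]
  have hlim : Tendsto (fun e => (g v - g u) * (u - e)) (𝓝[>] 0) (𝓝 ((g v - g u) * (u - 0))) :=
    (Continuous.tendsto (by fun_prop) 0).mono_left nhdsWithin_le_nhds
  have := le_of_tendsto hlim (by filter_upwards [Ioo_mem_nhdsGT hu] with e he using key e he)
  nlinarith

variable {𝕜 : Type*} [RCLike 𝕜]

open Classical in
/-- The least concave majorant of the primitive of `|f|`, with real values and extended by zero. -/
noncomputable def levelMajorant (f : L0 𝕜) (t : ℝ) : ℝ :=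
  if 0 < t then (leastConcaveMajorant (primitive fun x => ‖f x‖ₑ) t).toReal else 0

variable {f : L0 𝕜}

theorem levelMajorant_of_pos (f : L0 𝕜) {t : ℝ} (ht : 0 < t) :
    levelMajorant f t = (leastConcaveMajorant (primitive fun x => ‖f x‖ₑ) t).toReal := if_pos ht

theorem levelMajorant_of_nonpos (f : L0 𝕜) {t : ℝ} (ht : t ≤ 0) : levelMajorant f t = 0 :=
  if_neg (not_lt.2 ht)

theorem levelMajorant_nonneg (f : L0 𝕜) (t : ℝ) : 0 ≤ levelMajorant f t := by
  rw [levelMajorant]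
  split_ifs
  · exact ENNReal.toReal_nonneg
  · exact le_rfl

theorem levelMajorant_le (hf : HasFinitePrimitive f) {ψ : ℝ → ℝ} (hψ : ConcaveOn ℝ (Ioi 0) ψ)
    (h : ∀ t, 0 < t → realPrimitive f t ≤ ψ t) {t : ℝ} (ht : 0 < t) : levelMajorant f t ≤ ψ t := by
  rw [levelMajorant_of_pos f ht]
  refine toReal_lcm_le ⟨hψ, fun y hy => ⟨(realPrimitive_nonneg f y).trans (h y hy), ?_⟩⟩ ht
  rw [primitive_eq_ofReal hf]
  exact ENNReal.ofReal_le_ofReal (h y hy)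

theorem realPrimitive_le_levelMajorant (hf : f ∈ (coupleL1LevelLinfty 𝕜).sum) (t : ℝ) :
    realPrimitive f t ≤ levelMajorant f t := by
  rcases le_or_gt t 0 with ht | ht
  · rw [realPrimitive_of_nonpos f ht, levelMajorant_of_nonpos f ht]
  · rw [levelMajorant_of_pos f ht]
    refine (ENNReal.ofReal_le_iff_le_toReal (lcm_primitive_ne_top hf t)).1 ?_
    rw [← primitive_eq_ofReal (hasFinitePrimitive_of_mem_sum hf)]
    exact le_leastConcaveMajorant ht

theorem concaveOn_Ioi_levelMajorant (hf : f ∈ (coupleL1LevelLinfty 𝕜).sum) :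
    ConcaveOn ℝ (Ioi 0) (levelMajorant f) :=
  (concaveOn_lcm fun y _ => lcm_primitive_ne_top hf y).congr fun _ ht =>
    (levelMajorant_of_pos f ht).symm

theorem mul_levelMajorant_le (hf : f ∈ (coupleL1LevelLinfty 𝕜).sum) {u v : ℝ} (hu : 0 < u)
    (huv : u < v) : u * levelMajorant f v ≤ v * levelMajorant f u :=
  mul_le_mul_of_concaveOn (concaveOn_Ioi_levelMajorant hf) (fun t _ => levelMajorant_nonneg f t)
    hu huv

theorem concaveOn_levelMajorant (hf : f ∈ (coupleL1LevelLinfty 𝕜).sum) :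
    ConcaveOn ℝ (Ici 0) (levelMajorant f) := by
  refine concaveOn_of_slope_anti_adjacent (convex_Ici 0) fun {x y z} hx _ hxy hyz => ?_
  rcases (show (0 : ℝ) ≤ x from hx).eq_or_lt with rfl | hx
  · have h := mul_levelMajorant_le hf hxy hyz
    rw [levelMajorant_of_nonpos f le_rfl, div_le_div_iff₀ (by linarith) (by linarith)]
    nlinarith
  · exact (concaveOn_Ioi_levelMajorant hf).slope_anti_adjacent hx
      (show (0 : ℝ) < z by linarith) hxy hyz

theorem levelMajorant_le_add_mul (hf : f ∈ (coupleL1LevelLinfty 𝕜).sum) {δ t : ℝ} (hδ : 0 < δ)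
    (ht : 0 < t) :
    levelMajorant f t ≤ realPrimitive f δ + levelMajorant f δ / δ * t := by
  have hfin : HasFinitePrimitive f := hasFinitePrimitive_of_mem_sum hf
  refine levelMajorant_le hfin (concaveOn_affine _ _ (convex_Ioi 0)) (fun u hu => ?_) ht
  rcases le_or_gt u δ with hle | hlt
  · have hnonneg := mul_nonneg (div_nonneg (levelMajorant_nonneg f δ) hδ.le) hu.le
    linarith [monotone_realPrimitive hfin hle]
  · have hslope : levelMajorant f u ≤ levelMajorant f δ / δ * u := by
      rw [div_mul_eq_mul_div, le_div_iff₀ hδ]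
      linarith [mul_levelMajorant_le hf hδ hlt]
    linarith [realPrimitive_le_levelMajorant hf u, realPrimitive_nonneg f δ]

theorem tendsto_levelMajorant_zero (hf : f ∈ (coupleL1LevelLinfty 𝕜).sum) :
    Tendsto (levelMajorant f) (𝓝[≥] 0) (𝓝 0) := by
  refine tendsto_order.2 ⟨fun b hb => Eventually.of_forall fun t =>
    hb.trans_le (levelMajorant_nonneg f t), fun b hb => ?_⟩
  have hF : Tendsto (realPrimitive f) (𝓝[>] 0) (𝓝 0) := by
    have h := (continuous_realPrimitive (hasFinitePrimitive_of_mem_sum hf)).tendsto 0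
    rw [realPrimitive_of_nonpos f le_rfl] at h
    exact h.mono_left nhdsWithin_le_nhds
  obtain ⟨δ, hδb, hδ⟩ := ((hF.eventually (gt_mem_nhds hb)).and self_mem_nhdsWithin).exists
  have hlim : Tendsto (fun t => realPrimitive f δ + levelMajorant f δ / δ * t) (𝓝[≥] 0)
      (𝓝 (realPrimitive f δ + levelMajorant f δ / δ * 0)) :=
    (Continuous.tendsto (by fun_prop) 0).mono_left nhdsWithin_le_nhds
  rw [mul_zero, add_zero] at hlim
  filter_upwards [hlim.eventually (gt_mem_nhds hδb), self_mem_nhdsWithin] with t ht ht0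
  rcases (show (0 : ℝ) ≤ t from ht0).eq_or_lt with rfl | ht0
  · rwa [levelMajorant_of_nonpos f le_rfl]
  · exact (levelMajorant_le_add_mul hf hδ ht0).trans_lt ht

theorem continuousOn_levelMajorant (hf : f ∈ (coupleL1LevelLinfty 𝕜).sum) :
    ContinuousOn (levelMajorant f) (Ici 0) := by
  intro t ht
  rcases (show (0 : ℝ) ≤ t from ht).eq_or_lt with rfl | ht
  · rw [ContinuousWithinAt, levelMajorant_of_nonpos f le_rfl]
    exact tendsto_levelMajorant_zero hf
  · exact (((concaveOn_Ioi_levelMajorant hf).continuousOn isOpen_Ioi).continuousAt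
      (Ioi_mem_nhds ht)).continuousWithinAt

theorem isLeastConcaveMajorant_levelMajorant (hf : f ∈ (coupleL1LevelLinfty 𝕜).sum) :
    IsLeastConcaveMajorant (realPrimitive f) (levelMajorant f) where
  mono := monotone_realPrimitive (hasFinitePrimitive_of_mem_sum hf)
  nonneg := realPrimitive_nonneg f
  continuous := continuous_realPrimitive (hasFinitePrimitive_of_mem_sum hf)
  concave := concaveOn_levelMajorant hf
  continuousOn := continuousOn_levelMajorant hf
  zero := levelMajorant_of_nonpos f le_rfl
  le := fun t _ => realPrimitive_le_levelMajorant hf t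
  least := fun _ hψ h _ ht => levelMajorant_le (hasFinitePrimitive_of_mem_sum hf) hψ h ht

open Classical in
/-- The right derivative of the least concave majorant of the primitive of `|f|`. -/
noncomputable def levelSlope (f : L0 𝕜) (t : ℝ) : ℝ :=
  if 0 < t then derivWithin (levelMajorant f) (Ioi t) t else 0

theorem levelSlope_of_pos (f : L0 𝕜) {t : ℝ} (ht : 0 < t) :
    levelSlope f t = derivWithin (levelMajorant f) (Ioi t) t := if_pos ht

theorem measurable_levelSlope (f : L0 𝕜) : Measurable (levelSlope f) :=
  Measurable.ite measurableSet_Ioi (measurable_derivWithin_Ioi _) measurable_const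

theorem levelSlope_eq (f : L0 𝕜) {t m : ℝ} (ht : 0 < t) (h : HasDerivAt (levelMajorant f) m t) :
    levelSlope f t = m := by
  rw [levelSlope_of_pos f ht]
  exact h.hasDerivWithinAt.derivWithin (uniqueDiffWithinAt_Ioi t)

theorem levelSlope_of_eventuallyEq_affine {b m c t : ℝ} (ht : 0 < t)
    (h : ∀ᶠ u in 𝓝 t, levelMajorant f u = b + m * (u - c)) : levelSlope f t = m := by
  have hder : HasDerivAt (fun u => b + m * (u - c)) m t := by
    simpa using (((hasDerivAt_id t).sub_const c).const_mul m).const_add b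
  exact levelSlope_eq f ht (hder.congr_of_eventuallyEq h)

theorem hasDerivWithinAt_levelMajorant (hf : f ∈ (coupleL1LevelLinfty 𝕜).sum) {t : ℝ}
    (ht : 0 < t) : HasDerivWithinAt (levelMajorant f) (levelSlope f t) (Ioi t) t := by
  have hc := (isLeastConcaveMajorant_levelMajorant hf).concave
  have h := (hc.neg.differentiableWithinAt_Ioi_of_mem_interior (x := t)
    (by rwa [interior_Ici])).neg
  rw [neg_neg] at h
  rw [levelSlope_of_pos f ht]
  exact h.hasDerivWithinAt

theorem antitoneOn_levelSlope (hf : f ∈ (coupleL1LevelLinfty 𝕜).sum) :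
    AntitoneOn (levelSlope f) (Ioi 0) := by
  have hc := (isLeastConcaveMajorant_levelMajorant hf).concave
  intro s hs t ht hst
  have h := hc.neg.monotoneOn_rightDeriv (by rwa [interior_Ici]) (by rwa [interior_Ici]) hst
  simp only [derivWithin.neg] at h
  rw [levelSlope_of_pos f hs, levelSlope_of_pos f ht]
  exact neg_le_neg_iff.1 h

theorem monotoneOn_levelMajorant (hf : f ∈ (coupleL1LevelLinfty 𝕜).sum) :
    MonotoneOn (levelMajorant f) (Ioi 0) :=
  monotoneOn_of_concaveOn ((isLeastConcaveMajorant_levelMajorant hf).concave.subset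
    Ioi_subset_Ici_self (convex_Ioi 0)) (levelMajorant_nonneg f)

theorem levelSlope_nonneg (hf : f ∈ (coupleL1LevelLinfty 𝕜).sum) (t : ℝ) :
    0 ≤ levelSlope f t := by
  rw [levelSlope]
  split_ifs with ht
  · exact ((monotoneOn_levelMajorant hf).mono (Ioi_subset_Ioi ht.le)).derivWithin_nonneg
  · exact le_rfl

theorem lintegral_levelSlope (hf : f ∈ (coupleL1LevelLinfty 𝕜).sum) {t : ℝ} (ht : 0 < t) :
    ∫⁻ x in Ioo 0 t, ENNReal.ofReal (levelSlope f x) = ENNReal.ofReal (levelMajorant f t) := by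
  have H := isLeastConcaveMajorant_levelMajorant hf
  have hcont : ContinuousOn (levelMajorant f) (Icc 0 t) := H.continuousOn.mono Icc_subset_Ici_self
  have hder : ∀ x ∈ Ioo 0 t, HasDerivWithinAt (levelMajorant f) (levelSlope f x) (Ioi x) x :=
    fun x hx => hasDerivWithinAt_levelMajorant hf hx.1
  have hinteg : IntegrableOn (levelSlope f) (Ioc 0 t) :=
    intervalIntegral.integrableOn_deriv_right_of_nonneg hcont hder
      fun x _ => levelSlope_nonneg hf x
  have h := intervalIntegral.integral_eq_sub_of_hasDeriv_right
    (by rwa [uIcc_of_le ht.le]) (by rwa [min_eq_left ht.le, max_eq_right ht.le])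
    ((intervalIntegrable_iff_integrableOn_Ioc_of_le ht.le).2 hinteg)
  rw [H.zero, sub_zero, intervalIntegral.integral_of_le ht.le] at h
  rw [setLIntegral_congr Ioo_ae_eq_Ioc, ← ofReal_integral_eq_lintegral_ofReal hinteg
    (ae_of_all _ fun x => levelSlope_nonneg hf x), h]

theorem ae_differentiableAt_levelMajorant (hf : f ∈ (coupleL1LevelLinfty 𝕜).sum) :
    ∀ᵐ x ∂halfLine, DifferentiableAt ℝ (levelMajorant f) x := by
  have h := (ae_restrict_iff' measurableSet_Ioi).2
    (monotoneOn_levelMajorant hf).ae_differentiableWithinAt_of_mem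
  filter_upwards [h, ae_restrict_mem measurableSet_Ioi] with x hx hx0
  exact hx.differentiableAt (Ioi_mem_nhds hx0)

theorem levelFunction_eq_levelSlope (hf : f ∈ (coupleL1LevelLinfty 𝕜).sum) :
    ∀ᵐ x ∂halfLine, ((levelFunction fun y => ‖f y‖ₑ) x).toReal = levelSlope f x := by
  filter_upwards [ae_differentiableAt_levelMajorant hf, ae_restrict_mem measurableSet_Ioi]
    with x hx hx0
  have heq : (fun y => (leastConcaveMajorant (primitive fun x => ‖f x‖ₑ) y).toReal) =ᶠ[𝓝 x]
      levelMajorant f := by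
    filter_upwards [Ioi_mem_nhds hx0] with y hy using (levelMajorant_of_pos f hy).symm
  rw [levelFunction_eq_levelDeriv hf, levelDeriv, heq.deriv_eq, ← levelSlope_eq f hx0 hx.hasDerivAt,
    ENNReal.toReal_ofReal (levelSlope_nonneg hf x)]

/-- The set where the primitive of `|f|` meets its least concave majorant. -/
def contactSet (f : L0 𝕜) : Set ℝ := {t | 0 ≤ t ∧ realPrimitive f t = levelMajorant f t}

theorem isContactSet_contactSet (hf : f ∈ (coupleL1LevelLinfty 𝕜).sum) :
    IsContactSet (contactSet f) := by
  have H := isLeastConcaveMajorant_levelMajorant hf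
  refine ⟨?_, ⟨le_rfl, ?_⟩, fun t ht => ht.1⟩
  · have h := (H.continuous.continuousOn.sub H.continuousOn).preimage_isClosed_of_isClosed
      isClosed_Ici (isClosed_singleton (x := (0 : ℝ)))
    convert h using 1
    ext t
    exact and_congr_right fun _ => sub_eq_zero.symm
  · rw [realPrimitive_of_nonpos f le_rfl, levelMajorant_of_nonpos f le_rfl]

theorem lt_levelMajorant (hf : f ∈ (coupleL1LevelLinfty 𝕜).sum) {t : ℝ} (ht : 0 ≤ t)
    (htZ : t ∉ contactSet f) : realPrimitive f t < levelMajorant f t :=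
  lt_of_le_of_ne (realPrimitive_le_levelMajorant hf t) fun h => htZ ⟨ht, h⟩

theorem levelSlope_of_mem_contactSet (hf : f ∈ (coupleL1LevelLinfty 𝕜).sum) :
    ∀ᵐ x ∂halfLine, x ∈ contactSet f → levelSlope f x = ‖f x‖ := by
  filter_upwards [ae_differentiableAt_levelMajorant hf,
    ae_hasDerivAt_realPrimitive (hasFinitePrimitive_of_mem_sum hf),
    ae_restrict_mem measurableSet_Ioi] with x hmajorant hprimitive hx0 hx
  have hmin : IsLocalMin (fun t => levelMajorant f t - realPrimitive f t) x := by
    refine Eventually.of_forall fun t => ?_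
    simp only
    rw [hx.2, sub_self]
    exact sub_nonneg.2 (realPrimitive_le_levelMajorant hf t)
  rw [levelSlope_eq f hx0 hmajorant.hasDerivAt]
  exact sub_eq_zero.1 (hmin.hasDerivAt_eq_zero (hmajorant.hasDerivAt.sub hprimitive))

theorem levelSlope_of_mem_gap (hf : f ∈ (coupleL1LevelLinfty 𝕜).sum) {s : ℝ} (hs0 : 0 < s)
    (hs : s ∈ notBeyond (contactSet f)) (hsZ : s ∉ contactSet f) :
    levelSlope f s = (gapRight (contactSet f) s - gapLeft (contactSet f) s)⁻¹ *
      ∫ z in Ioo (gapLeft (contactSet f) s) (gapRight (contactSet f) s), ‖f z‖ := by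
  have H := isLeastConcaveMajorant_levelMajorant hf
  have hZ := isContactSet_contactSet hf
  have hls := hZ.gapLeft_lt hs0.le hsZ
  have hsr := hZ.lt_gapRight hs hsZ
  have hl0 := hZ.gapLeft_nonneg s
  have hl : realPrimitive f _ = levelMajorant f _ := (hZ.gapLeft_mem hs0.le).1.2
  have hr : realPrimitive f _ = levelMajorant f _ := (hZ.gapRight_mem hs).1.2
  rw [← realPrimitive_sub (hasFinitePrimitive_of_mem_sum hf) hl0 (hls.trans hsr).le, hl, hr,
    ← div_eq_inv_mul]
  refine levelSlope_of_eventuallyEq_affine (b := levelMajorant f (gapLeft (contactSet f) s))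
    (c := gapLeft (contactSet f) s) hs0 ?_
  filter_upwards [Ioo_mem_nhds hls hsr] with t ht
  exact H.affine hl0 (hls.trans hsr)
    (fun u hu => lt_levelMajorant hf (hl0.trans hu.1.le) (notMem_of_mem_gap hu))
    (Ioo_subset_Icc_self ht)

theorem lt_levelMajorant_of_isGreatest (hf : f ∈ (coupleL1LevelLinfty 𝕜).sum) {a t : ℝ}
    (ha : IsGreatest (contactSet f) a) (ht : a < t) : realPrimitive f t < levelMajorant f t :=
  lt_levelMajorant hf (ha.1.1.trans ht.le) fun h => (ha.2 h).not_gt ht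

theorem levelSlope_of_isGreatest (hf : f ∈ (coupleL1LevelLinfty 𝕜).sum) {a s : ℝ}
    (ha : IsGreatest (contactSet f) a) (hs : a < s) :
    levelSlope f s = levelMajorant f (a + 1) - levelMajorant f a := by
  refine levelSlope_of_eventuallyEq_affine (b := levelMajorant f a) (c := a)
    (ha.1.1.trans_lt hs) ?_
  filter_upwards [Ioi_mem_nhds hs] with t ht
  exact (isLeastConcaveMajorant_levelMajorant hf).affine_unbounded ha.1.1
    (fun _ => lt_levelMajorant_of_isGreatest hf ha) (le_of_lt ht)

/-- The modulus of an element of `L⁰`. -/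
noncomputable def absL0 (f : L0 𝕜) : L0 𝕜 :=
  AEEqFun.mk (fun x => ((‖f x‖ : ℝ) : 𝕜))
    (RCLike.measurable_ofReal.comp f.stronglyMeasurable.measurable.norm).aestronglyMeasurable

theorem coeFn_absL0 (f : L0 𝕜) : ∀ᵐ x ∂halfLine, absL0 f x = ((‖f x‖ : ℝ) : 𝕜) :=
  AEEqFun.coeFn_mk _ _

theorem enorm_absL0 (f : L0 𝕜) : ∀ᵐ x ∂halfLine, ‖absL0 f x‖ₑ = ‖f x‖ₑ := by
  filter_upwards [coeFn_absL0 f] with x hx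
  rw [hx, enorm_ofReal_of_nonneg (norm_nonneg _), ofReal_norm]

theorem integral_absL0 (f : L0 𝕜) {s : Set ℝ} (hs : s ⊆ Ioi 0) :
    ∫ x in s, absL0 f x = ((∫ x in s, ‖f x‖ : ℝ) : 𝕜) := by
  rw [← integral_ofReal]
  exact integral_congr_ae (ae_restrict_of_subset_Ioi hs (coeFn_absL0 f))

theorem setAverage_absL0 (hf : HasFinitePrimitive f) {a y : ℝ} (ha : 0 ≤ a) (hay : a ≤ y) :
    ⨍ x in Ioo a y, absL0 f x =
      (((realPrimitive f y - realPrimitive f a) / (y - a) : ℝ) : 𝕜) := by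
  rw [setAverage_eq, Real.volume_real_Ioo_of_le hay,
    integral_absL0 f fun x hx => ha.trans_lt hx.1, ← realPrimitive_sub hf ha hay,
    RCLike.real_smul_eq_coe_mul, ← RCLike.ofReal_mul, div_eq_inv_mul]

theorem exists_isMeanSequence_of_isGreatest (hf : f ∈ (coupleL1LevelLinfty 𝕜).sum) {a : ℝ}
    (ha : IsGreatest (contactSet f) a) :
    ∃ y : ℕ → ℝ, IsMeanSequence (contactSet f) a y ∧
      limAverage (fun n => Ioo a (y n)) (absL0 f) =
        ((levelMajorant f (a + 1) - levelMajorant f a : ℝ) : 𝕜) := by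
  have H := isLeastConcaveMajorant_levelMajorant hf
  have ha0 : 0 ≤ a := ha.1.1
  have haff : ∀ t, a ≤ t → _ := fun t => H.affine_unbounded ha0
    fun _ => lt_levelMajorant_of_isGreatest hf ha
  set m := levelMajorant f (a + 1) - levelMajorant f a
  choose y hyY hy using fun n : ℕ =>
    H.exists_mean_slope_gt ha0 haff (ε := 1 / ((n : ℝ) + 1)) (by positivity) (a + 1 + n)
  have hy1 : ∀ n, a + 1 ≤ y n := fun n => by linarith [hyY n, n.cast_nonneg (α := ℝ)]
  refine ⟨y, ⟨ha0, hy1, tendsto_atTop_mono (fun n => ?_) tendsto_natCast_atTop_atTop,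
    fun _ _ => ha⟩, limAverage_eq ?_⟩
  · linarith [hyY n]
  simp only [fun n => setAverage_absL0 (hasFinitePrimitive_of_mem_sum hf) ha0
    (show a ≤ y n by linarith [hy1 n])]
  refine (RCLike.continuous_ofReal.tendsto m).comp (tendsto_of_tendsto_of_tendsto_of_le_of_le
    (g := fun n : ℕ => m - 1 / ((n : ℝ) + 1)) (h := fun _ => m) ?_ tendsto_const_nhds
    (fun n => ?_) (fun n => ?_))
  · simpa using tendsto_const_nhds.sub (tendsto_one_div_add_atTop_nhds_zero_nat (𝕜 := ℝ))
  · simp only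
    rw [le_div_iff₀ (by linarith [hy1 n])]
    linarith [hy n]
  · simp only
    rw [div_le_iff₀ (by linarith [hy1 n]), ha.1.2]
    linarith [haff (y n) (by linarith [hy1 n]), realPrimitive_le_levelMajorant hf (y n)]

theorem exists_isMeanSequence (hf : f ∈ (coupleL1LevelLinfty 𝕜).sum) :
    ∃ (a : ℝ) (y : ℕ → ℝ), IsMeanSequence (contactSet f) a y ∧
      ∀ s, s ∉ notBeyond (contactSet f) →
        limAverage (fun n => Ioo a (y n)) (absL0 f) = ((levelSlope f s : ℝ) : 𝕜) := by
  have hZ := isContactSet_contactSet hf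
  by_cases! hb : ∃ s, s ∉ notBeyond (contactSet f)
  · obtain ⟨s₀, hs₀⟩ := hb
    have hbdd : BddAbove (contactSet f) := ⟨s₀, fun w hw => (not_le.1 fun h => hs₀ ⟨w, hw, h⟩).le⟩
    have ha : IsGreatest (contactSet f) (sSup (contactSet f)) :=
      ⟨hZ.closed.csSup_mem ⟨0, hZ.zero_mem⟩ hbdd, fun w hw => le_csSup hbdd hw⟩
    obtain ⟨y, hy, hlim⟩ := exists_isMeanSequence_of_isGreatest hf ha
    refine ⟨_, y, hy, fun s hs => ?_⟩
    rw [hlim, levelSlope_of_isGreatest hf ha (not_le.1 fun h => hs ⟨_, ha.1, h⟩)]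
  · refine ⟨0, fun n => n + 1, ⟨le_rfl, fun n => ?_,
      tendsto_atTop_add_const_right _ _ tendsto_natCast_atTop_atTop,
      fun s hs => absurd (hb s) hs⟩, fun s hs => absurd (hb s) hs⟩
    linarith [n.cast_nonneg (α := ℝ)]

/-- The level function of `f`, as an element of `L⁰`. -/
noncomputable def levelL0 (f : L0 𝕜) : L0 𝕜 :=
  AEEqFun.mk (fun x => ((levelSlope f x : ℝ) : 𝕜))
    (RCLike.measurable_ofReal.comp (measurable_levelSlope f)).aestronglyMeasurable

theorem coeFn_levelL0 (f : L0 𝕜) : ∀ᵐ x ∂halfLine, levelL0 f x = ((levelSlope f x : ℝ) : 𝕜) :=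
  AEEqFun.coeFn_mk _ _

theorem isDecreasing_levelL0 (hf : f ∈ (coupleL1LevelLinfty 𝕜).sum) :
    IsDecreasing (levelL0 f) :=
  ⟨levelSlope f, measurable_levelSlope f, antitoneOn_levelSlope hf, levelSlope_nonneg hf,
    coeFn_levelL0 f⟩

theorem levelL0_eq_levelFunction (hf : f ∈ (coupleL1LevelLinfty 𝕜).sum) :
    ∀ᵐ x ∂halfLine, levelL0 f x = (((levelFunction fun y => ‖f y‖ₑ) x).toReal : 𝕜) := by
  filter_upwards [coeFn_levelL0 f, levelFunction_eq_levelSlope hf] with x h1 h2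
  rw [h1, h2]

theorem isImage_levelL0 (hf : f ∈ (coupleL1LevelLinfty 𝕜).sum) :
    IsImage 1 (coupleL1LevelLinfty 𝕜) (coupleL1LevelLinfty 𝕜) f (levelL0 f) := by
  have h1 : IsImage 1 (coupleL1LevelLinfty 𝕜) (coupleL1LevelLinfty 𝕜) f (absL0 f) :=
    isImage_of_enorm_le isSolid_coupleL1LevelLinfty hf ((enorm_absL0 f).mono fun _ hx => hx.le)
  obtain ⟨a, y, hy, hlim⟩ := exists_isMeanSequence hf
  have hZ := isContactSet_contactSet hf
  have h2 : IsImage 1 (coupleL1LevelLinfty 𝕜) (coupleL1LevelLinfty 𝕜) (absL0 f) (levelL0 f) := by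
    refine isImage_gapAverage hZ hy h1.mem_right ?_
    filter_upwards [coeFn_levelL0 f, coeFn_absL0 f, levelSlope_of_mem_contactSet hf,
      ae_restrict_mem measurableSet_Ioi] with s h1 h2 h3 hs0
    rw [h1, gapAverage]
    split_ifs with hs hs'
    · rw [h2, h3 hs]
    · rw [integral_absL0 f fun x hx => (hZ.gapLeft_nonneg s).trans_lt hx.1, ← RCLike.ofReal_mul,
        levelSlope_of_mem_gap hf hs0 hs' hs]
    · exact (hlim s hs').symm
  simpa using h1.trans h2

theorem levelL0_mem_sum (hf : f ∈ (coupleL1LevelLinfty 𝕜).sum) :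
    levelL0 f ∈ (coupleL1LevelLinfty 𝕜).sum := (isImage_levelL0 hf).mem_right

theorem isImage_of_levelL0 (hf : f ∈ (coupleL1LevelLinfty 𝕜).sum) :
    IsImage 1 (coupleL1LevelLinfty 𝕜) (coupleL1LevelLinfty 𝕜) (levelL0 f) f := by
  refine isImage_of_lintegral_le (levelL0_mem_sum hf) fun t ht => ?_
  calc ∫⁻ x in Ioo 0 t, ‖f x‖ₑ
      = ENNReal.ofReal (realPrimitive f t) :=
        (ofReal_realPrimitive (hasFinitePrimitive_of_mem_sum hf) t).symm
    _ ≤ ENNReal.ofReal (levelMajorant f t) :=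
        ENNReal.ofReal_le_ofReal (realPrimitive_le_levelMajorant hf t)
    _ = ∫⁻ x in Ioo 0 t, ENNReal.ofReal (levelSlope f x) := (lintegral_levelSlope hf ht).symm
    _ = ∫⁻ x in Ioo 0 t, ‖levelL0 f x‖ₑ := by
        refine lintegral_congr_ae ?_
        filter_upwards [ae_Ioo (coeFn_levelL0 f) t] with x hx
        rw [hx, enorm_ofReal_of_nonneg (levelSlope_nonneg hf x)]

end LevelFunctions

/-! ### Operators between functions with equal distribution -/

section Transfer

open CompatibleCouple ProbabilityTheory

theorem restrict_Iic_union_Ioi_apply_Iic {m : Measure ℝ} {c s : ℝ} (hm : m (Iic c) = 0)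
    (hfin : m (Ioi s) ≠ ∞) (a : ℝ) :
    m.restrict (Iic c ∪ Ioi s) (Iic a) = if a < s then 0 else m (Ioi s) - m (Ioi a) := by
  rw [Measure.restrict_apply measurableSet_Iic]
  split_ifs with ha
  · refine measure_mono_null ?_ hm
    rintro x ⟨hx, hx' | hx'⟩
    · exact hx'
    · exact absurd ha (hx'.le.trans hx).not_gt
  · have hsub : Ioi a ⊆ Ioi s := Ioi_subset_Ioi (not_lt.1 ha)
    rw [← measure_sdiff hsub measurableSet_Ioi.nullMeasurableSet
      (ne_top_of_le_ne_top hfin (measure_mono hsub)), Ioi_sdiff_Ioi]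
    refine measure_congr ?_
    filter_upwards [measure_eq_zero_iff_ae_notMem.1 hm] with x hx
    exact propext ⟨fun h => ⟨h.2.resolve_left hx, h.1⟩, fun h => ⟨h.2, Or.inr h.1⟩⟩

theorem eq_and_sigmaFinite_of_Ioi_eq {m₁ m₂ : Measure ℝ} {c : ℝ} (h₁ : m₁ (Iic c) = 0)
    (h₂ : m₂ (Iic c) = 0) (h : ∀ s, c < s → m₁ (Ioi s) = m₂ (Ioi s))
    (hfin : ∀ s, c < s → m₁ (Ioi s) ≠ ∞) : m₁ = m₂ ∧ SigmaFinite m₁ := by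
  let s : ℕ → ℝ := fun n => c + 1 / ((n : ℝ) + 1)
  have hs : ∀ n, c < s n := fun n => lt_add_of_pos_right _ (by positivity)
  let S : ℕ → Set ℝ := fun n => Iic c ∪ Ioi (s n)
  have hSu : ⋃ n, S n = univ := by
    refine eq_univ_of_forall fun x => mem_iUnion.2 ?_
    rcases le_or_gt x c with hx | hx
    · exact ⟨0, Or.inl hx⟩
    · obtain ⟨n, hn⟩ := exists_nat_one_div_lt (sub_pos.2 hx)
      exact ⟨n, Or.inr (lt_sub_iff_add_lt'.1 hn)⟩
  have hSf : ∀ n, m₁ (S n) < ∞ := fun n => by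
    refine (measure_union_le _ _).trans_lt ?_
    rw [h₁, zero_add]
    exact lt_top_iff_ne_top.2 (hfin _ (hs n))
  refine ⟨(Measure.ext_iff_of_iUnion_eq_univ hSu).2 fun n => ?_,
    ⟨⟨⟨S, fun _ => trivial, hSf, hSu⟩⟩⟩⟩
  have : IsFiniteMeasure (m₁.restrict (S n)) := ⟨by
    rw [Measure.restrict_apply_univ]; exact hSf n⟩
  refine Measure.ext_of_Iic _ _ fun a => ?_
  rw [restrict_Iic_union_Ioi_apply_Iic h₁ (hfin _ (hs n)),
    restrict_Iic_union_Ioi_apply_Iic h₂ (h _ (hs n) ▸ hfin _ (hs n))]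
  split_ifs with ha
  · rfl
  · rw [h _ (hs n), h a ((hs n).trans_le (not_lt.1 ha))]

theorem map_restrict_apply_Ioi {w : ℝ → ℝ} (hw : Measurable w) {m : Measure ℝ} {c s : ℝ}
    (hs : c < s) : Measure.map w (m.restrict {x | c < w x}) (Ioi s) = m {x | s < w x} := by
  rw [Measure.map_apply hw measurableSet_Ioi, Measure.restrict_apply (hw measurableSet_Ioi)]
  congr 1
  exact inter_eq_left.2 fun x hx => hs.trans hx

theorem map_restrict_apply_Iic {w : ℝ → ℝ} (hw : Measurable w) (m : Measure ℝ) (c : ℝ) :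
    Measure.map w (m.restrict {x | c < w x}) (Iic c) = 0 := by
  rw [Measure.map_apply hw measurableSet_Iic, Measure.restrict_apply (hw measurableSet_Iic)]
  convert measure_empty (μ := m)
  exact disjoint_iff_inter_eq_empty.1 (disjoint_left.2
    fun x (h : w x ≤ c) (h' : c < w x) => not_lt_of_ge h h')

/-- The kernel `κ` disintegrates `m₁` along `u` over the law of `v` under `m₂`: integration against
`κ (v t)` turns a function on the source space of `u` into one on the source space of `v`. -/
def IsTransferKernel (κ : Kernel ℝ ℝ) (m₁ m₂ : Measure ℝ) (u v : ℝ → ℝ) : Prop :=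
  ∀ φ : ℝ × ℝ → ℝ≥0∞, Measurable φ →
    ∫⁻ t, ∫⁻ z, φ (v t, z) ∂κ (v t) ∂m₂ = ∫⁻ z, φ (u z, z) ∂m₁

/-- Only finite measures can be disintegrated, whence the weight `W`. -/
theorem exists_isFiniteMeasure_graph (m₁ : Measure ℝ) {u : ℝ → ℝ} (hu : Measurable u)
    [SigmaFinite (Measure.map u m₁)] :
    ∃ (W : ℝ → ℝ≥0) (ρ : Measure (ℝ × ℝ)), (∀ s, 0 < W s) ∧ Measurable W ∧ IsFiniteMeasure ρ ∧
      ∀ ψ : ℝ × ℝ → ℝ≥0∞, Measurable ψ → ∫⁻ q, ψ q ∂ρ = ∫⁻ z, W (u z) * ψ (u z, z) ∂m₁ := by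
  obtain ⟨W, hW0, hWm, hW⟩ := exists_pos_lintegral_lt_of_sigmaFinite (Measure.map u m₁)
    one_ne_zero
  have hWm' : Measurable fun s => (W s : ℝ≥0∞) := hWm.coe_nnreal_ennreal
  have hfin : IsFiniteMeasure (m₁.withDensity fun z => (W (u z) : ℝ≥0∞)) := by
    refine isFiniteMeasure_withDensity ?_
    rw [lintegral_map hWm' hu] at hW
    exact (hW.trans ENNReal.one_lt_top).ne
  have hgraph : Measurable fun z => (u z, z) := hu.prodMk measurable_id
  refine ⟨W, Measure.map (fun z => (u z, z)) (m₁.withDensity fun z => (W (u z) : ℝ≥0∞)), hW0, hWm,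
    inferInstance, fun ψ hψ => ?_⟩
  rw [lintegral_map hψ hgraph]
  exact lintegral_withDensity_eq_lintegral_mul _ (hWm'.comp hu) (hψ.comp hgraph)

theorem exists_isTransferKernel {m₁ m₂ : Measure ℝ} {u v : ℝ → ℝ} (hu : Measurable u)
    (hv : Measurable v) (h : Measure.map u m₁ = Measure.map v m₂)
    [SigmaFinite (Measure.map u m₁)] :
    ∃ κ : Kernel ℝ ℝ, IsMarkovKernel κ ∧ IsTransferKernel κ m₁ m₂ u v := by
  obtain ⟨W, ρ, hW0, hWm, hρ, hρint⟩ := exists_isFiniteMeasure_graph m₁ hu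
  refine ⟨ρ.condKernel, inferInstance, fun φ hφ => ?_⟩
  have hW : Measurable fun s => (W s : ℝ≥0∞)⁻¹ := hWm.coe_nnreal_ennreal.inv
  have hcancel : ∀ (s : ℝ) (r : ℝ≥0∞), (W s : ℝ≥0∞) * (r * (W s : ℝ≥0∞)⁻¹) = r := fun s r => by
    rw [mul_left_comm, ENNReal.mul_inv_cancel (by exact_mod_cast (hW0 s).ne') ENNReal.coe_ne_top,
      mul_one]
  have hψ : Measurable fun q : ℝ × ℝ => φ q * (W q.1 : ℝ≥0∞)⁻¹ := hφ.mul (hW.comp measurable_fst)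
  have hfibre : Measurable fun s => ∫⁻ z, φ (s, z) ∂ρ.condKernel s :=
    hφ.lintegral_kernel_prod_right'
  have hinner : ∀ s, ∫⁻ z, φ (s, z) * (W s : ℝ≥0∞)⁻¹ ∂ρ.condKernel s =
      (∫⁻ z, φ (s, z) ∂ρ.condKernel s) * (W s : ℝ≥0∞)⁻¹ := fun s =>
    lintegral_mul_const _ (hφ.comp measurable_prodMk_left)
  have hweighted : Measurable fun s => (∫⁻ z, φ (s, z) ∂ρ.condKernel s) * (W s : ℝ≥0∞)⁻¹ :=
    hfibre.mul hW
  calc ∫⁻ t, ∫⁻ z, φ (v t, z) ∂ρ.condKernel (v t) ∂m₂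
      = ∫⁻ s, ∫⁻ z, φ (s, z) ∂ρ.condKernel s ∂Measure.map u m₁ := by
        rw [h, lintegral_map hfibre hv]
    _ = ∫⁻ z, W (u z) * ((∫⁻ z', φ (u z, z') ∂ρ.condKernel (u z)) * (W (u z) : ℝ≥0∞)⁻¹) ∂m₁ := by
        rw [lintegral_map hfibre hu]
        simp only [hcancel]
    _ = ∫⁻ q, (∫⁻ z', φ (q.1, z') ∂ρ.condKernel q.1) * (W q.1 : ℝ≥0∞)⁻¹ ∂ρ :=
        (hρint _ (hweighted.comp measurable_fst)).symm
    _ = ∫⁻ s, (∫⁻ z', φ (s, z') ∂ρ.condKernel s) * (W s : ℝ≥0∞)⁻¹ ∂ρ.fst := by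
        rw [Measure.fst, lintegral_map hweighted measurable_fst]
    _ = ∫⁻ q, φ q * (W q.1 : ℝ≥0∞)⁻¹ ∂ρ := by
        rw [← Measure.lintegral_condKernel hψ]
        simp only [hinner]
    _ = ∫⁻ z, φ (u z, z) ∂m₁ := by
        rw [hρint _ hψ]
        simp only [hcancel]

namespace IsTransferKernel

variable {κ : Kernel ℝ ℝ} [IsMarkovKernel κ] {m₁ m₂ : Measure ℝ} {u v : ℝ → ℝ}

theorem ae_ae_notMem (hκ : IsTransferKernel κ m₁ m₂ u v) (hv : Measurable v) {N : Set (ℝ × ℝ)}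
    (hN : MeasurableSet N) (hN0 : ∀ᵐ z ∂m₁, (u z, z) ∉ N) :
    ∀ᵐ t ∂m₂, ∀ᵐ z ∂κ (v t), (v t, z) ∉ N := by
  have hNm : Measurable (N.indicator (1 : ℝ × ℝ → ℝ≥0∞)) := measurable_one.indicator hN
  have hzero : ∫⁻ t, ∫⁻ z, N.indicator (1 : ℝ × ℝ → ℝ≥0∞) (v t, z) ∂κ (v t) ∂m₂ = 0 := by
    rw [hκ _ hNm, ← lintegral_zero (μ := m₁)]
    refine lintegral_congr_ae ?_
    filter_upwards [hN0] with z hz using indicator_of_notMem hz _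
  have hmeas : Measurable fun s => ∫⁻ z, N.indicator (1 : ℝ × ℝ → ℝ≥0∞) (s, z) ∂κ s :=
    hNm.lintegral_kernel_prod_right'
  filter_upwards [(lintegral_eq_zero_iff (hmeas.comp hv)).1 hzero] with t ht
  filter_upwards [(lintegral_eq_zero_iff (hNm.comp measurable_prodMk_left)).1 ht] with z hz hzN
  simp [hzN] at hz

theorem ae_ae_of_ae (hκ : IsTransferKernel κ m₁ m₂ u v) (hv : Measurable v) {P : ℝ → Prop}
    (hP : ∀ᵐ x ∂m₁, P x) : ∀ᵐ t ∂m₂, ∀ᵐ z ∂κ (v t), P z := by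
  obtain ⟨N, hPN, hNm, hN0⟩ := exists_measurable_superset_of_null (ae_iff.1 hP)
  filter_upwards [hκ.ae_ae_notMem hv (measurable_snd hNm)
    (measure_eq_zero_iff_ae_notMem.1 hN0)] with t ht
  filter_upwards [ht] with z hz
  exact not_not.1 fun hPz => hz (hPN hPz)

theorem ae_ae_eq (hκ : IsTransferKernel κ m₁ m₂ u v) (hu : Measurable u) (hv : Measurable v) :
    ∀ᵐ t ∂m₂, ∀ᵐ z ∂κ (v t), u z = v t := by
  have hN : MeasurableSet {q : ℝ × ℝ | u q.2 ≠ q.1} :=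
    (measurableSet_eq_fun (hu.comp measurable_snd) measurable_fst).compl
  filter_upwards [hκ.ae_ae_notMem hv hN (ae_of_all _ fun z hz => hz rfl)] with t ht
  filter_upwards [ht] with z hz using not_not.1 hz

end IsTransferKernel

variable {𝕜 : Type*} [RCLike 𝕜]

/-- The sets `B n` grow in measure, and `u` tends to the value `c` along them. -/
structure IsConcentrating (u : ℝ → ℝ) (c : ℝ) (B : ℕ → Set ℝ) : Prop where
  measurableSet (n : ℕ) : MeasurableSet (B n)
  subset_Ioi (n : ℕ) : B n ⊆ Ioi 0
  volume_ne_top (n : ℕ) : volume (B n) ≠ ∞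
  le_volume (n : ℕ) : (n : ℝ) + 1 ≤ volume.real (B n)
  abs_sub_le (n : ℕ) : ∀ x ∈ B n, |u x - c| ≤ 1 / ((n : ℝ) + 1)

theorem exists_subset_le_volume {S : Set ℝ} (hSm : MeasurableSet S) (hS : halfLine S = ∞) (M : ℝ) :
    ∃ B ⊆ S, MeasurableSet B ∧ B ⊆ Ioi 0 ∧ volume B ≠ ∞ ∧ M ≤ volume.real B := by
  have hunion : volume (⋃ k : ℕ, S ∩ Ioo (0 : ℝ) (k + 1)) = ∞ := by
    rwa [← inter_iUnion, ← Ioi_eq_iUnion_Ioo, ← Measure.restrict_apply hSm]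
  have hmono : Monotone fun k : ℕ => S ∩ Ioo (0 : ℝ) (k + 1) := fun k l hkl =>
    inter_subset_inter_right _ (Ioo_subset_Ioo_right (by gcongr))
  rw [hmono.measure_iUnion] at hunion
  obtain ⟨k, hk⟩ := lt_iSup_iff.1 (hunion ▸ ENNReal.ofReal_lt_top :
    ENNReal.ofReal M < ⨆ k : ℕ, volume (S ∩ Ioo (0 : ℝ) (k + 1)))
  have hfin : volume (S ∩ Ioo (0 : ℝ) (k + 1)) ≠ ∞ :=
    ne_top_of_le_ne_top (by simp) (measure_mono inter_subset_right)
  exact ⟨S ∩ Ioo (0 : ℝ) (k + 1), inter_subset_left, hSm.inter measurableSet_Ioo,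
    fun x hx => hx.2.1, hfin, (ENNReal.ofReal_le_iff_le_toReal hfin).1 hk.le⟩

theorem exists_isConcentrating {u : ℝ → ℝ} (hu : Measurable u) {c : ℝ}
    (hc : ∀ ε, 0 < ε → halfLine {x | |u x - c| ≤ ε} = ∞) : ∃ B, IsConcentrating u c B := by
  have hsets : ∀ ε, MeasurableSet {x | |u x - c| ≤ ε} := fun ε =>
    measurableSet_le (hu.sub_const c).norm measurable_const
  choose B hsub hmeas hIoi hfin hle using fun n : ℕ =>
    exists_subset_le_volume (hsets (1 / ((n : ℝ) + 1))) (hc _ (by positivity)) ((n : ℝ) + 1)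
  exact ⟨B, hmeas, hIoi, hfin, hle, hsub⟩

theorem norm_le_of_Linfty {h : L0 𝕜} (hh : (lebesgue 𝕜 ∞ le_top).nrm h < ∞) :
    ∀ᵐ x ∂halfLine, ‖h x‖ ≤ ((lebesgue 𝕜 ∞ le_top).nrm h).toReal := by
  filter_upwards [(nrm_Linfty_le_iff h _).1 le_rfl] with x hx
  rw [← toReal_enorm]
  exact ENNReal.toReal_mono hh.ne hx

/-- A mean at infinity: a functional that is linear on `L¹ + L^∞`, vanishes on `L¹`, and has norm at
most one on `L^∞`. -/
structure IsMeanAtInfinity (Λ : L0 𝕜 → 𝕜) : Prop where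
  map_add : ∀ h ∈ (coupleL1Linfty 𝕜).sum, ∀ k ∈ (coupleL1Linfty 𝕜).sum, Λ (h + k) = Λ h + Λ k
  map_smul (r : 𝕜) : ∀ h ∈ (coupleL1Linfty 𝕜).sum, Λ (r • h) = r * Λ h
  map_L1 (h) : (lebesgue 𝕜 1 le_rfl).nrm h < ∞ → Λ h = 0
  enorm_le (h) : (lebesgue 𝕜 ∞ le_top).nrm h < ∞ → ‖Λ h‖ₑ ≤ (lebesgue 𝕜 ∞ le_top).nrm h

namespace IsConcentrating

variable {u : ℝ → ℝ} {c : ℝ} {B : ℕ → Set ℝ}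

theorem one_le_volume (hB : IsConcentrating u c B) (n : ℕ) : 1 ≤ volume.real (B n) :=
  (le_add_of_nonneg_left n.cast_nonneg).trans (hB.le_volume n)

theorem tendsto_volume (hB : IsConcentrating u c B) :
    Tendsto (fun n => volume.real (B n)) atTop atTop :=
  tendsto_atTop_mono (fun n => (le_add_of_nonneg_right zero_le_one).trans (hB.le_volume n))
    tendsto_natCast_atTop_atTop

theorem integrableOn_of_Linfty (hB : IsConcentrating u c B) {h : L0 𝕜}
    (hh : (lebesgue 𝕜 ∞ le_top).nrm h < ∞) (n : ℕ) : IntegrableOn h (B n) :=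
  Measure.integrableOn_of_bounded (hB.volume_ne_top n)
    h.stronglyMeasurable.aestronglyMeasurable
    (ae_restrict_of_subset_Ioi (hB.subset_Ioi n) (norm_le_of_Linfty hh))

theorem setAverage_norm_le_of_Linfty (hB : IsConcentrating u c B) {h : L0 𝕜}
    (hh : (lebesgue 𝕜 ∞ le_top).nrm h < ∞) (n : ℕ) :
    ⨍ x in B n, ‖h x‖ ≤ ((lebesgue 𝕜 ∞ le_top).nrm h).toReal := by
  rw [setAverage_eq, smul_eq_mul, inv_mul_le_iff₀ (one_pos.trans_le (hB.one_le_volume n))]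
  have hle := integral_mono_ae (hB.integrableOn_of_Linfty hh n).norm
    (integrableOn_const (hB.volume_ne_top n))
    (ae_restrict_of_subset_Ioi (hB.subset_Ioi n) (norm_le_of_Linfty hh))
  rwa [setIntegral_const, smul_eq_mul] at hle

theorem hasBoundedAverages_of_Linfty (hB : IsConcentrating u c B) {h : L0 𝕜}
    (hh : (lebesgue 𝕜 ∞ le_top).nrm h < ∞) : HasBoundedAverages B h :=
  ⟨hB.integrableOn_of_Linfty hh, _, hB.setAverage_norm_le_of_Linfty hh⟩

theorem hasBoundedAverages (hB : IsConcentrating u c B) {h : L0 𝕜}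
    (hh : h ∈ (coupleL1Linfty 𝕜).sum) : HasBoundedAverages B h := by
  obtain ⟨a, b, ha, hb, rfl⟩ := mem_sum_iff.1 hh
  exact (hasBoundedAverages_of_L1 hB.subset_Ioi hB.one_le_volume ha).add hB.subset_Ioi
    (hB.hasBoundedAverages_of_Linfty hb)

theorem isMeanAtInfinity_limAverage (hB : IsConcentrating u c B) :
    IsMeanAtInfinity (limAverage B : L0 𝕜 → 𝕜) where
  map_add _ hh _ hk :=
    limAverage_add hB.subset_Ioi (hB.hasBoundedAverages hh) (hB.hasBoundedAverages hk)
  map_smul r _ hh := limAverage_smul hB.subset_Ioi r (hB.hasBoundedAverages hh)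
  map_L1 _ hh := limAverage_of_L1 hB.subset_Ioi hB.one_le_volume hB.tendsto_volume hh
  enorm_le h hh := by
    rw [← ofReal_norm, ENNReal.ofReal_le_iff_le_toReal hh.ne]
    exact norm_limAverage_le (hB.hasBoundedAverages_of_Linfty hh)
      (hB.setAverage_norm_le_of_Linfty hh) tendsto_const_nhds

theorem integrableOn (hB : IsConcentrating u c B) (hu : Measurable u) (n : ℕ) :
    IntegrableOn u (B n) := by
  refine Measure.integrableOn_of_bounded (hB.volume_ne_top n) hu.aestronglyMeasurable
    (M := 1 / ((n : ℝ) + 1) + |c|) ?_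
  filter_upwards [ae_restrict_mem (hB.measurableSet n)] with x hx
  calc ‖u x‖ = |(u x - c) + c| := by rw [sub_add_cancel, Real.norm_eq_abs]
    _ ≤ |u x - c| + |c| := abs_add_le _ _
    _ ≤ 1 / ((n : ℝ) + 1) + |c| := by gcongr; exact hB.abs_sub_le n x hx

theorem abs_setAverage_sub_le (hB : IsConcentrating u c B) (hu : Measurable u) (n : ℕ) :
    |(⨍ x in B n, u x) - c| ≤ 1 / ((n : ℝ) + 1) := by
  have hpos : 0 < volume.real (B n) := one_pos.trans_le (hB.one_le_volume n)
  have hdiff : (⨍ x in B n, u x) - c = (volume.real (B n))⁻¹ * ∫ x in B n, (u x - c) := by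
    rw [integral_sub (hB.integrableOn hu n) (integrableOn_const (hB.volume_ne_top n)),
      setIntegral_const, setAverage_eq, smul_eq_mul, smul_eq_mul, mul_sub, ← mul_assoc,
      inv_mul_cancel₀ hpos.ne', one_mul]
  rw [hdiff, abs_mul, abs_inv, abs_of_pos hpos, inv_mul_le_iff₀ hpos, mul_comm]
  exact norm_setIntegral_le_of_norm_le_const (f := fun x => u x - c)
    (lt_top_iff_ne_top.2 (hB.volume_ne_top n)) (hB.abs_sub_le n)

theorem limAverage_eq_ofReal (hB : IsConcentrating u c B) (hu : Measurable u) {U : L0 𝕜}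
    (hU : ∀ᵐ x ∂halfLine, U x = (u x : 𝕜)) : limAverage B U = (c : 𝕜) := by
  refine limAverage_eq ?_
  have hval : ∀ n, ⨍ x in B n, U x = ((⨍ x in B n, u x : ℝ) : 𝕜) := fun n => by
    rw [setAverage_eq, setAverage_eq, RCLike.real_smul_eq_coe_mul, smul_eq_mul,
      RCLike.ofReal_mul, ← integral_ofReal]
    congr 1
    exact integral_congr_ae (ae_restrict_of_subset_Ioi (hB.subset_Ioi n) hU)
  simp only [hval]
  refine (RCLike.continuous_ofReal.tendsto c).comp (tendsto_iff_norm_sub_tendsto_zero.2 ?_)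
  exact squeeze_zero (fun _ => norm_nonneg _) (hB.abs_setAverage_sub_le hu)
    tendsto_one_div_add_atTop_nhds_zero_nat

end IsConcentrating

/-- Above the level `c` of `v` average over the fibres of `κ`; below it multiply the value of `Λ` by
`v / c` (if `c = 0` this factor is `0`, as is `v` there when it is nonnegative). -/
noncomputable def transfer (κ : Kernel ℝ ℝ) (v : ℝ → ℝ) (c : ℝ) (Λ : L0 𝕜 → 𝕜) (h : L0 𝕜)
    (t : ℝ) : 𝕜 :=
  if c < v t then ∫ z, h z ∂κ (v t) else ((v t / c : ℝ) : 𝕜) * Λ h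

theorem measurable_transfer {κ : Kernel ℝ ℝ} {v : ℝ → ℝ} {c : ℝ} {Λ : L0 𝕜 → 𝕜} (hv : Measurable v)
    (h : L0 𝕜) : Measurable (transfer κ v c Λ h) :=
  Measurable.ite (measurableSet_lt measurable_const hv)
    ((h.stronglyMeasurable.integral_kernel (κ := κ)).measurable.comp hv)
    ((RCLike.measurable_ofReal.comp (hv.div_const c)).mul_const _)

namespace IsTransferKernel

variable {κ : Kernel ℝ ℝ} {m₁ : Measure ℝ} {u v : ℝ → ℝ} {c : ℝ} {Λ : L0 𝕜 → 𝕜}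

theorem lintegral_enorm_le (hκ : IsTransferKernel κ m₁ (halfLine.restrict {x | c < v x}) u v)
    (hm₁ : m₁ ≤ halfLine) (h : L0 𝕜) :
    ∫⁻ t in {x | c < v x}, ∫⁻ z, ‖h z‖ₑ ∂κ (v t) ∂halfLine ≤ (lebesgue 𝕜 1 le_rfl).nrm h := by
  rw [hκ (fun q => ‖h q.2‖ₑ) (h.stronglyMeasurable.measurable.enorm.comp measurable_snd), nrm_L1]
  exact lintegral_mono' hm₁ le_rfl

theorem lintegral_enorm_transfer_le
    (hκ : IsTransferKernel κ m₁ (halfLine.restrict {x | c < v x}) u v) (hm₁ : m₁ ≤ halfLine)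
    (hv : Measurable v) (hΛ : IsMeanAtInfinity Λ) {h : L0 𝕜}
    (hh : (lebesgue 𝕜 1 le_rfl).nrm h < ∞) :
    ∫⁻ t, ‖transfer κ v c Λ h t‖ₑ ∂halfLine ≤ (lebesgue 𝕜 1 le_rfl).nrm h := by
  refine le_trans ?_ (hκ.lintegral_enorm_le hm₁ h)
  rw [← lintegral_indicator (measurableSet_lt measurable_const hv)]
  refine lintegral_mono fun t => ?_
  by_cases hct : c < v t
  · rw [indicator_of_mem (s := {x | c < v x}) hct]
    simp only [transfer, if_pos hct]
    exact enorm_integral_le_lintegral_enorm _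
  · simp only [transfer, if_neg hct]
    rw [hΛ.map_L1 h hh, mul_zero, enorm_zero]
    exact zero_le

variable [IsMarkovKernel κ]

theorem ae_lt_imp (hκ : IsTransferKernel κ m₁ (halfLine.restrict {x | c < v x}) u v)
    (hm₁ : m₁ ≤ halfLine) (hv : Measurable v) {P : ℝ → Prop} (hP : ∀ᵐ x ∂halfLine, P x) :
    ∀ᵐ t ∂halfLine, c < v t → ∀ᵐ z ∂κ (v t), P z :=
  (ae_restrict_iff' (measurableSet_lt measurable_const hv)).1
    (hκ.ae_ae_of_ae hv (hm₁.absolutelyContinuous.ae_le hP))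

theorem ae_integrable (hκ : IsTransferKernel κ m₁ (halfLine.restrict {x | c < v x}) u v)
    (hm₁ : m₁ ≤ halfLine) (hv : Measurable v) {h : L0 𝕜} (hh : h ∈ (coupleL1Linfty 𝕜).sum) :
    ∀ᵐ t ∂halfLine, c < v t → Integrable h (κ (v t)) := by
  obtain ⟨a, b, ha, hb, rfl⟩ := mem_sum_iff.1 hh
  have hmeas : Measurable fun t => ∫⁻ z, ‖a z‖ₑ ∂κ (v t) :=
    (a.stronglyMeasurable.measurable.enorm.lintegral_kernel).comp hv
  have hfin : ∀ᵐ t ∂halfLine, c < v t → ∫⁻ z, ‖a z‖ₑ ∂κ (v t) < ∞ :=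
    (ae_restrict_iff' (measurableSet_lt measurable_const hv)).1
      (ae_lt_top hmeas (ne_top_of_le_ne_top ha.ne (hκ.lintegral_enorm_le hm₁ a)))
  filter_upwards [hfin, hκ.ae_lt_imp hm₁ hv (norm_le_of_Linfty hb),
    hκ.ae_lt_imp hm₁ hv (AEEqFun.coeFn_add a b)] with t hat hbt hadd hct
  have hia : Integrable a (κ (v t)) :=
    ⟨a.stronglyMeasurable.aestronglyMeasurable, hat hct⟩
  have hib : Integrable b (κ (v t)) :=
    Integrable.of_bound b.stronglyMeasurable.aestronglyMeasurable _ (hbt hct)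
  exact (hia.add hib).congr ((hadd hct).mono fun z hz => hz.symm)

theorem transfer_add (hκ : IsTransferKernel κ m₁ (halfLine.restrict {x | c < v x}) u v)
    (hm₁ : m₁ ≤ halfLine) (hv : Measurable v) (hΛ : IsMeanAtInfinity Λ) {h k : L0 𝕜}
    (hh : h ∈ (coupleL1Linfty 𝕜).sum) (hk : k ∈ (coupleL1Linfty 𝕜).sum) :
    ∀ᵐ t ∂halfLine, transfer κ v c Λ (h + k) t = transfer κ v c Λ h t + transfer κ v c Λ k t := by
  filter_upwards [hκ.ae_integrable hm₁ hv hh, hκ.ae_integrable hm₁ hv hk,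
    hκ.ae_lt_imp hm₁ hv (AEEqFun.coeFn_add h k)] with t hht hkt hadd
  simp only [transfer]
  split_ifs with ht
  · rw [← integral_add (hht ht) (hkt ht)]
    exact integral_congr_ae (hadd ht)
  · rw [hΛ.map_add h hh k hk, mul_add]

theorem transfer_smul (hκ : IsTransferKernel κ m₁ (halfLine.restrict {x | c < v x}) u v)
    (hm₁ : m₁ ≤ halfLine) (hv : Measurable v) (hΛ : IsMeanAtInfinity Λ) (r : 𝕜) {h : L0 𝕜}
    (hh : h ∈ (coupleL1Linfty 𝕜).sum) :
    ∀ᵐ t ∂halfLine, transfer κ v c Λ (r • h) t = r * transfer κ v c Λ h t := by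
  filter_upwards [hκ.ae_lt_imp hm₁ hv (AEEqFun.coeFn_smul r h)] with t hsmul
  simp only [transfer]
  split_ifs with ht
  · rw [← integral_const_mul]
    exact integral_congr_ae (hsmul ht)
  · rw [hΛ.map_smul r h hh]
    ring

theorem enorm_transfer_le (hκ : IsTransferKernel κ m₁ (halfLine.restrict {x | c < v x}) u v)
    (hm₁ : m₁ ≤ halfLine) (hv : Measurable v) (hv0 : ∀ x, 0 ≤ v x) (hc0 : 0 ≤ c)
    (hΛ : IsMeanAtInfinity Λ) {h : L0 𝕜} (hh : (lebesgue 𝕜 ∞ le_top).nrm h < ∞) :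
    ∀ᵐ t ∂halfLine, ‖transfer κ v c Λ h t‖ₑ ≤ (lebesgue 𝕜 ∞ le_top).nrm h := by
  filter_upwards [hκ.ae_lt_imp hm₁ hv ((nrm_Linfty_le_iff h _).1 le_rfl)] with t ht
  by_cases hct : c < v t
  · simp only [transfer, if_pos hct]
    refine (enorm_integral_le_lintegral_enorm _).trans ((lintegral_mono_ae (ht hct)).trans ?_)
    rw [lintegral_const, measure_univ, mul_one]
  · simp only [transfer, if_neg hct]
    rw [enorm_mul, enorm_ofReal_of_nonneg (div_nonneg (hv0 t) hc0)]
    refine (mul_le_of_le_one_left' ?_).trans (hΛ.enorm_le h hh)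
    rw [ENNReal.ofReal_le_one]
    exact div_le_one_of_le₀ (not_lt.1 hct) hc0

theorem transfer_eq (hκ : IsTransferKernel κ m₁ (halfLine.restrict {x | c < v x}) u v)
    (hm₁ : m₁ ≤ halfLine) (hu : Measurable u) (hv : Measurable v) (hv0 : ∀ x, 0 ≤ v x)
    (hc0 : 0 ≤ c) {U : L0 𝕜} (hU : ∀ᵐ x ∂halfLine, U x = (u x : 𝕜)) (hΛU : Λ U = (c : 𝕜)) :
    ∀ᵐ t ∂halfLine, transfer κ v c Λ U t = (v t : 𝕜) := by
  filter_upwards [hκ.ae_lt_imp hm₁ hv hU, (ae_restrict_iff' (measurableSet_lt measurable_const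
    hv)).1 (hκ.ae_ae_eq hu hv)] with t hUt huv
  simp only [transfer]
  split_ifs with hct
  · have hconst : (fun z => U z) =ᵐ[κ (v t)] fun _ => (v t : 𝕜) := by
      filter_upwards [hUt hct, huv hct] with z hz hz'
      rw [hz, hz']
    rw [integral_congr_ae hconst, integral_const, probReal_univ, one_smul]
  · rw [hΛU, ← RCLike.ofReal_mul]
    congr 1
    rcases hc0.eq_or_lt with h0 | h0
    · rw [le_antisymm (h0 ▸ not_lt.1 hct) (hv0 t), zero_div, zero_mul]
    · rw [div_mul_cancel₀ _ h0.ne']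

end IsTransferKernel

theorem isImage_of_distribution_eq {u v : ℝ → ℝ} (hu : Measurable u) (hv : Measurable v)
    (hv0 : ∀ x, 0 ≤ v x) {c : ℝ} (hc0 : 0 ≤ c)
    (hc : ∀ ε, 0 < ε → halfLine {x | |u x - c| ≤ ε} = ∞)
    (hdist : ∀ s, c < s → halfLine {x | s < u x} = halfLine {x | s < v x})
    (hfin : ∀ s, c < s → halfLine {x | s < u x} ≠ ∞) {U V : L0 𝕜}
    (hU : ∀ᵐ x ∂halfLine, U x = (u x : 𝕜)) (hV : ∀ᵐ x ∂halfLine, V x = (v x : 𝕜))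
    (hUs : U ∈ (coupleL1Linfty 𝕜).sum) :
    IsImage 1 (coupleL1Linfty 𝕜) (coupleL1Linfty 𝕜) U V := by
  obtain ⟨B, hB⟩ := exists_isConcentrating hu hc
  have hΛ : IsMeanAtInfinity (limAverage B : L0 𝕜 → 𝕜) := hB.isMeanAtInfinity_limAverage
  have hIoi : ∀ {w : ℝ → ℝ}, Measurable w → ∀ s, c < s →
      Measure.map w (halfLine.restrict {x | c < w x}) (Ioi s) = halfLine {x | s < w x} :=
    fun hw _ hs => map_restrict_apply_Ioi hw hs
  obtain ⟨hmap, hσ⟩ := eq_and_sigmaFinite_of_Ioi_eq (map_restrict_apply_Iic hu halfLine c)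
    (map_restrict_apply_Iic hv halfLine c)
    (fun s hs => by rw [hIoi hu s hs, hIoi hv s hs, hdist s hs])
    (fun s hs => by rw [hIoi hu s hs]; exact hfin s hs)
  obtain ⟨κ, hmarkov, hκ⟩ := exists_isTransferKernel hu hv hmap
  have hm₁ : halfLine.restrict {x | c < u x} ≤ halfLine := Measure.restrict_le_self
  refine isImage_of_fun (transfer κ v c (limAverage B))
    (fun h _ => (measurable_transfer hv h).aestronglyMeasurable)
    (fun h hh k hk => hκ.transfer_add hm₁ hv hΛ hh hk)
    (fun r h hh => hκ.transfer_smul hm₁ hv hΛ r hh) (fun h k hh hk => ?_) (fun h k hh hk => ?_)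
    hUs ?_
  · rw [ENNReal.coe_one, one_mul]
    refine (nrm_L1 k).trans_le ((lintegral_mono_ae ?_).trans
      (hκ.lintegral_enorm_transfer_le hm₁ hv hΛ hh))
    filter_upwards [hk] with t ht using ht ▸ le_rfl
  · rw [ENNReal.coe_one, one_mul]
    refine (nrm_Linfty_le_iff k _).2 ?_
    filter_upwards [hk, hκ.enorm_transfer_le hm₁ hv hv0 hc0 hΛ hh] with t ht hle using ht ▸ hle
  · filter_upwards [hV, hκ.transfer_eq hm₁ hu hv hv0 hc0 hU (hB.limAverage_eq_ofReal hu hU)]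
      with t hVt ht
    rw [hVt, ht]

end Transfer

/-! ### The decreasing rearrangement -/

section Rearrangement

open CompatibleCouple

/-- The distribution function of `u` on the half line. -/
noncomputable def distribution (u : ℝ → ℝ) (s : ℝ) : ℝ≥0∞ := halfLine {x | s < u x}

theorem antitone_distribution (u : ℝ → ℝ) : Antitone (distribution u) := fun _ _ hst =>
  measure_mono fun _ hx => lt_of_le_of_lt hst hx

/-- The infimum of the levels above which `u` lives on a set of finite measure. -/
noncomputable def essLimit (u : ℝ → ℝ) : ℝ := sInf {s | distribution u s ≠ ∞}

/-- The decreasing rearrangement of `u` on `(0, ∞)`, extended by `0`. The bound `essLimit u ≤ s`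
keeps the set of levels bounded below for every `u`. -/
noncomputable def rearrangement (u : ℝ → ℝ) (t : ℝ) : ℝ :=
  if 0 < t then sInf {s | essLimit u ≤ s ∧ distribution u s ≤ ENNReal.ofReal t} else 0

/-- The values of the distribution function of `u` become arbitrarily small. -/
def VanishesAtTop (u : ℝ → ℝ) : Prop :=
  ∀ t : ℝ, 0 < t → ∃ s, distribution u s ≤ ENNReal.ofReal t

variable {u : ℝ → ℝ}

theorem distribution_of_neg (hu0 : ∀ x, 0 ≤ u x) {s : ℝ} (hs : s < 0) :
    distribution u s = ∞ := by
  have : {x | s < u x} = univ := eq_univ_of_forall fun x => hs.trans_le (hu0 x)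
  rw [distribution, this, Measure.restrict_apply_univ, Real.volume_Ioi]

theorem nonneg_of_distribution_ne_top (hu0 : ∀ x, 0 ≤ u x) {s : ℝ} (hs : distribution u s ≠ ∞) :
    0 ≤ s :=
  not_lt.1 fun h => hs (distribution_of_neg hu0 h)

theorem essLimit_nonneg (hu0 : ∀ x, 0 ≤ u x) : 0 ≤ essLimit u :=
  Real.sInf_nonneg fun _ => nonneg_of_distribution_ne_top hu0

theorem distribution_of_lt_essLimit (hu0 : ∀ x, 0 ≤ u x) {s : ℝ} (hs : s < essLimit u) :
    distribution u s = ∞ := by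
  by_contra h
  exact notMem_of_lt_csInf hs ⟨0, fun _ => nonneg_of_distribution_ne_top hu0⟩ h

theorem distribution_ne_top (hv : VanishesAtTop u) {s : ℝ} (hs : essLimit u < s) :
    distribution u s ≠ ∞ := by
  obtain ⟨s₀, hs₀⟩ := hv 1 one_pos
  obtain ⟨r, hr, hrs⟩ := exists_lt_of_csInf_lt
    ⟨s₀, ne_top_of_le_ne_top ENNReal.ofReal_ne_top hs₀⟩ hs
  exact ne_top_of_le_ne_top hr (antitone_distribution u hrs.le)

theorem distribution_le_of_forall_gt {s : ℝ} {C : ℝ≥0∞}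
    (h : ∀ r, s < r → distribution u r ≤ C) : distribution u s ≤ C := by
  have hunion : {x | s < u x} = ⋃ n : ℕ, {x | s + 1 / ((n : ℝ) + 1) < u x} := by
    ext x
    simp only [mem_ofPred_eq, mem_iUnion]
    refine ⟨fun hx => ?_, fun ⟨n, hn⟩ => (lt_add_of_pos_right s (by positivity)).trans hn⟩
    obtain ⟨n, hn⟩ := exists_nat_one_div_lt (sub_pos.2 hx)
    exact ⟨n, lt_sub_iff_add_lt'.1 hn⟩
  have hmono : Monotone fun n : ℕ => {x | s + 1 / ((n : ℝ) + 1) < u x} :=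
    fun m n hmn x (hx : s + 1 / ((m : ℝ) + 1) < u x) =>
      ((add_le_add_iff_left s).2 (Nat.one_div_le_one_div hmn)).trans_lt hx
  rw [distribution, hunion, hmono.measure_iUnion]
  exact iSup_le fun n => h _ (lt_add_of_pos_right _ (by positivity))

theorem rearrangement_set_nonempty (hv : VanishesAtTop u) {t : ℝ} (ht : 0 < t) :
    {s | essLimit u ≤ s ∧ distribution u s ≤ ENNReal.ofReal t}.Nonempty := by
  obtain ⟨s, hs⟩ := hv t ht
  exact ⟨max s (essLimit u), le_max_right _ _,
    (antitone_distribution u (le_max_left _ _)).trans hs⟩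

theorem rearrangement_le_iff (hv : VanishesAtTop u) {s t : ℝ} (ht : 0 < t)
    (hs : essLimit u ≤ s) :
    rearrangement u t ≤ s ↔ distribution u s ≤ ENNReal.ofReal t := by
  rw [rearrangement, if_pos ht]
  refine ⟨fun h => distribution_le_of_forall_gt fun r hr => ?_,
    fun h => csInf_le ⟨essLimit u, fun _ hr => hr.1⟩ ⟨hs, h⟩⟩
  obtain ⟨q, hq, hqr⟩ := exists_lt_of_csInf_lt (rearrangement_set_nonempty hv ht)
    (h.trans_lt hr)
  exact (antitone_distribution u hqr.le).trans hq.2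

theorem essLimit_le_rearrangement (hv : VanishesAtTop u) {t : ℝ} (ht : 0 < t) :
    essLimit u ≤ rearrangement u t := by
  rw [rearrangement, if_pos ht]
  exact le_csInf (rearrangement_set_nonempty hv ht) fun _ hs => hs.1

theorem rearrangement_nonneg (hu0 : ∀ x, 0 ≤ u x) (hv : VanishesAtTop u) (t : ℝ) :
    0 ≤ rearrangement u t := by
  rcases le_or_gt t 0 with ht | ht
  · rw [rearrangement, if_neg (not_lt.2 ht)]
  · exact (essLimit_nonneg hu0).trans (essLimit_le_rearrangement hv ht)

theorem antitoneOn_rearrangement (hv : VanishesAtTop u) :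
    AntitoneOn (rearrangement u) (Ioi 0) := fun _ hs _ ht hst =>
  (rearrangement_le_iff hv ht (essLimit_le_rearrangement hv hs)).2
    (((rearrangement_le_iff hv hs (essLimit_le_rearrangement hv hs)).1 le_rfl).trans
      (ENNReal.ofReal_le_ofReal hst))

theorem measurable_rearrangement (hv : VanishesAtTop u) : Measurable (rearrangement u) := by
  refine measurable_of_restrict_of_restrict_compl (measurableSet_Ioi (a := (0 : ℝ))) ?_ ?_
  · exact Antitone.measurable (f := (Ioi (0 : ℝ)).domRestrict (rearrangement u))
      fun s t hst => antitoneOn_rearrangement hv s.2 t.2 hst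
  · have hzero : (Ioi (0 : ℝ))ᶜ.domRestrict (rearrangement u) = fun _ => 0 :=
      funext fun t => if_neg t.2
    exact hzero ▸ measurable_const

theorem halfLine_ofReal_lt (D : ℝ≥0∞) : halfLine {x | ENNReal.ofReal x < D} = D := by
  rw [Measure.restrict_apply (measurableSet_lt ENNReal.measurable_ofReal measurable_const)]
  rcases eq_or_ne D ∞ with rfl | hD
  · have huniv : {x | ENNReal.ofReal x < ∞} = univ :=
      eq_univ_of_forall fun _ => ENNReal.ofReal_lt_top
    rw [huniv, univ_inter, Real.volume_Ioi]
  · have hset : {x | ENNReal.ofReal x < D} ∩ Ioi 0 = Ioo 0 D.toReal := by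
      ext x
      exact ⟨fun h => ⟨h.2, (ENNReal.ofReal_lt_iff_lt_toReal (le_of_lt h.2) hD).1 h.1⟩,
        fun h => ⟨(ENNReal.ofReal_lt_iff_lt_toReal h.1.le hD).2 h.2, h.1⟩⟩
    rw [hset, Real.volume_Ioo, sub_zero, ENNReal.ofReal_toReal hD]

theorem distribution_rearrangement (hv : VanishesAtTop u) {s : ℝ} (hs : essLimit u ≤ s) :
    distribution (rearrangement u) s = distribution u s := by
  refine Eq.trans (measure_congr ?_) (halfLine_ofReal_lt (distribution u s))
  filter_upwards [ae_restrict_mem measurableSet_Ioi] with t ht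
  exact propext (lt_iff_lt_of_le_iff_le (rearrangement_le_iff hv ht hs))

theorem measure_near_essLimit (hu0 : ∀ x, 0 ≤ u x) (hv : VanishesAtTop u) {ε : ℝ} (hε : 0 < ε) :
    halfLine {x | |u x - essLimit u| ≤ ε} = ∞ := by
  have hbelow : distribution u (essLimit u - ε) = ∞ :=
    distribution_of_lt_essLimit hu0 (sub_lt_self _ hε)
  have habove : distribution u (essLimit u + ε) ≠ ∞ :=
    distribution_ne_top hv (lt_add_of_pos_right _ hε)
  have hle : distribution u (essLimit u - ε) ≤
      halfLine {x | |u x - essLimit u| ≤ ε} + distribution u (essLimit u + ε) := by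
    refine (measure_mono fun x hx => ?_).trans (measure_union_le _ _)
    have hx' : essLimit u - ε < u x := hx
    rcases le_or_gt (u x) (essLimit u + ε) with h | h
    · exact Or.inl (abs_sub_le_iff.2 ⟨sub_le_iff_le_add'.2 h, sub_le_comm.1 hx'.le⟩)
    · exact Or.inr h
  rw [hbelow, top_le_iff, ENNReal.add_eq_top] at hle
  exact hle.resolve_right habove

theorem measure_rearrangement_near_essLimit (hv : VanishesAtTop u) {ε : ℝ} (hε : 0 < ε) :
    halfLine {x | |rearrangement u x - essLimit u| ≤ ε} = ∞ := by
  have habove : distribution u (essLimit u + ε) ≠ ∞ :=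
    distribution_ne_top hv (lt_add_of_pos_right _ hε)
  have hm : MeasurableSet {x | |rearrangement u x - essLimit u| ≤ ε} :=
    measurableSet_le ((measurable_rearrangement hv).sub_const _).norm measurable_const
  rw [Measure.restrict_apply hm, ← top_le_iff,
    ← Real.volume_Ioi (a := (distribution u (essLimit u + ε)).toReal)]
  refine measure_mono fun t ht => ?_
  have ht0 : 0 < t := lt_of_le_of_lt ENNReal.toReal_nonneg ht
  have hle : rearrangement u t ≤ essLimit u + ε :=
    (rearrangement_le_iff hv ht0 (le_add_of_nonneg_right hε.le)).2
      ((ENNReal.le_ofReal_iff_toReal_le habove ht0.le).2 (le_of_lt ht))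
  have hge := essLimit_le_rearrangement hv ht0
  exact ⟨abs_sub_le_iff.2 ⟨sub_le_iff_le_add'.2 hle, (sub_nonpos.2 hge).trans hε.le⟩, ht0⟩

variable {𝕜 : Type*} [RCLike 𝕜]

theorem exists_measure_enorm_ge_le {a : L0 𝕜} (ha : (lebesgue 𝕜 1 le_rfl).nrm a < ∞) {t : ℝ}
    (ht : 0 < t) : ∃ r, halfLine {x | ENNReal.ofReal r ≤ ‖a x‖ₑ} ≤ ENNReal.ofReal t := by
  have hA : ∫⁻ x in Ioi 0, ‖a x‖ₑ = ENNReal.ofReal ((lebesgue 𝕜 1 le_rfl).nrm a).toReal := by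
    rw [ENNReal.ofReal_toReal ha.ne, nrm_L1]
  set A := ((lebesgue 𝕜 1 le_rfl).nrm a).toReal
  have hr0 : 0 < A / t + 1 := add_pos_of_nonneg_of_pos (by positivity) one_pos
  refine ⟨A / t + 1, (meas_ge_le_lintegral_div a.stronglyMeasurable.measurable.enorm.aemeasurable
    (ENNReal.ofReal_pos.2 hr0).ne' ENNReal.ofReal_ne_top).trans ?_⟩
  rw [hA, ← ENNReal.ofReal_div_of_pos hr0]
  refine ENNReal.ofReal_le_ofReal ((div_le_iff₀ hr0).2 ?_)
  rw [mul_add, mul_div_cancel₀ A ht.ne', mul_one]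
  exact le_add_of_nonneg_right ht.le

theorem vanishesAtTop_norm {x : L0 𝕜} (hx : x ∈ (coupleL1Linfty 𝕜).sum) :
    VanishesAtTop fun z => ‖x z‖ := by
  obtain ⟨a, b, ha, hb, rfl⟩ := mem_sum_iff.1 hx
  intro t ht
  obtain ⟨r, hr⟩ := exists_measure_enorm_ge_le ha ht
  refine ⟨((lebesgue 𝕜 ∞ le_top).nrm b).toReal + r, le_trans (measure_mono_ae ?_) hr⟩
  filter_upwards [norm_le_of_Linfty hb, AEEqFun.coeFn_add a b] with z hbz hadd
  intro (hz : _ < ‖(a + b : L0 𝕜) z‖)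
  rw [hadd, Pi.add_apply] at hz
  change ENNReal.ofReal r ≤ ‖a z‖ₑ
  rw [← ofReal_norm]
  exact ENNReal.ofReal_le_ofReal (by linarith only [hz, hbz, norm_add_le (a z) (b z)])

theorem exists_rearrangement {x : L0 𝕜} (hx : x ∈ (coupleL1Linfty 𝕜).sum) :
    ∃ w : L0 𝕜, IsDecreasing w ∧ IsImage 1 (coupleL1Linfty 𝕜) (coupleL1Linfty 𝕜) x w ∧
      IsImage 1 (coupleL1Linfty 𝕜) (coupleL1Linfty 𝕜) w x := by
  let u : ℝ → ℝ := fun z => ‖x z‖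
  have hum : Measurable u := x.stronglyMeasurable.measurable.norm
  have hu0 : ∀ z, 0 ≤ u z := fun z => norm_nonneg _
  have hv : VanishesAtTop u := vanishesAtTop_norm hx
  have hwm := measurable_rearrangement hv
  have hw0 := rearrangement_nonneg hu0 hv
  let w : L0 𝕜 := AEEqFun.mk (fun t => ((rearrangement u t : ℝ) : 𝕜))
    (RCLike.measurable_ofReal.comp hwm).aestronglyMeasurable
  have hw : ∀ᵐ t ∂halfLine, w t = ((rearrangement u t : ℝ) : 𝕜) := AEEqFun.coeFn_mk _ _
  have habs : IsImage 1 (coupleL1Linfty 𝕜) (coupleL1Linfty 𝕜) x (absL0 x) :=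
    isImage_of_enorm_le isSolid_coupleL1Linfty hx ((enorm_absL0 x).mono fun _ h => h.le)
  have habs' : IsImage 1 (coupleL1Linfty 𝕜) (coupleL1Linfty 𝕜) (absL0 x) x :=
    isImage_of_enorm_le isSolid_coupleL1Linfty habs.mem_right ((enorm_absL0 x).mono fun _ h => h.ge)
  have hrearr : IsImage 1 (coupleL1Linfty 𝕜) (coupleL1Linfty 𝕜) (absL0 x) w :=
    isImage_of_distribution_eq hum hwm hw0 (essLimit_nonneg hu0)
      (fun ε hε => measure_near_essLimit hu0 hv hε)
      (fun s hs => (distribution_rearrangement hv hs.le).symm)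
      (fun s hs => distribution_ne_top hv hs) (coeFn_absL0 x) hw habs.mem_right
  have hrearr' : IsImage 1 (coupleL1Linfty 𝕜) (coupleL1Linfty 𝕜) w (absL0 x) :=
    isImage_of_distribution_eq hwm hum hu0 (essLimit_nonneg hu0)
      (fun ε hε => measure_rearrangement_near_essLimit hv hε)
      (fun s hs => distribution_rearrangement hv hs.le)
      (fun s hs => (distribution_rearrangement hv hs.le).trans_ne (distribution_ne_top hv hs))
      hw (coeFn_absL0 x) hrearr.mem_right
  refine ⟨w, ⟨_, hwm, antitoneOn_rearrangement hv, hw0, hw⟩, habs.trans_one hrearr,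
    hrearr'.trans_one habs'⟩

end Rearrangement

/-! ### Calderón–Mityagin pairs -/

section Pairs

open CompatibleCouple

variable {𝕜 : Type*} [RCLike 𝕜]

theorem isLevelConstant_two : IsLevelConstant 𝕜 2 := fun f => by
  have h := (isImage_levelL0 f.2).one_trans
    (isImage_two_of_isDecreasing (levelL0_mem_sum f.2) (isDecreasing_levelL0 f.2))
  obtain ⟨_, T, hT, hTf⟩ := h
  exact ⟨T, hT, hTf ▸ levelL0_eq_levelFunction f.2⟩

theorem isImage_level_level {x y : L0 𝕜} (hx : x ∈ (coupleL1LevelLinfty 𝕜).sum)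
    (h : ∀ t : ℝ≥0, 0 < t →
      (coupleL1LevelLinfty 𝕜).K t y ≤ (coupleL1LevelLinfty 𝕜).K t x) :
    IsImage 1 (coupleL1LevelLinfty 𝕜) (coupleL1LevelLinfty 𝕜) x y := by
  refine (isImage_levelL0 hx).one_trans
    (isImage_of_lintegral_le (levelL0_mem_sum hx) fun t ht => ?_)
  lift t to ℝ≥0 using ht.le
  calc ∫⁻ z in Ioo 0 (t : ℝ), ‖y z‖ₑ
      ≤ (coupleL1LevelLinfty 𝕜).K t y := lintegral_le_K y ht
    _ ≤ (coupleL1LevelLinfty 𝕜).K t x := h t ht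
    _ ≤ (coupleL1LevelLinfty 𝕜).K t (levelL0 x) := (isImage_of_levelL0 hx).K_le ht
    _ ≤ (coupleL1Linfty 𝕜).K t (levelL0 x) := K_level_le_K t _
    _ ≤ ∫⁻ z in Ioo 0 (t : ℝ), ‖levelL0 x z‖ₑ := K_le_lintegral (isDecreasing_levelL0 hx) ht

theorem isImage_Linfty_level {x y : L0 𝕜} (hx : x ∈ (coupleL1Linfty 𝕜).sum)
    (h : ∀ t : ℝ≥0, 0 < t → (coupleL1LevelLinfty 𝕜).K t y ≤ (coupleL1Linfty 𝕜).K t x) :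
    IsImage 1 (coupleL1Linfty 𝕜) (coupleL1LevelLinfty 𝕜) x y := by
  obtain ⟨w, hw, hxw, hwx⟩ := exists_rearrangement hx
  refine (hxw.trans_one (isImage_inclusion hxw.mem_right)).trans_one
    (isImage_of_lintegral_le (sum_le_sum_level hxw.mem_right) fun t ht => ?_)
  lift t to ℝ≥0 using ht.le
  calc ∫⁻ z in Ioo 0 (t : ℝ), ‖y z‖ₑ
      ≤ (coupleL1LevelLinfty 𝕜).K t y := lintegral_le_K y ht
    _ ≤ (coupleL1Linfty 𝕜).K t x := h t ht
    _ ≤ (coupleL1Linfty 𝕜).K t w := hwx.K_le ht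
    _ ≤ ∫⁻ z in Ioo 0 (t : ℝ), ‖w z‖ₑ := K_le_lintegral hw ht

theorem isImage_level_Linfty_of_isDecreasing {n : ℝ≥0} (hn : IsLevelConstant 𝕜 n) {w : L0 𝕜}
    (hw : w ∈ (coupleL1Linfty 𝕜).sum) (hd : IsDecreasing w) :
    IsImage n (coupleL1LevelLinfty 𝕜) (coupleL1Linfty 𝕜) w w := by
  have hwo := sum_le_sum_level hw
  obtain ⟨N, hN, hNw⟩ := hn ⟨w, hwo⟩
  refine ⟨hwo, N, hN, AEEqFun.ext ?_⟩
  filter_upwards [hNw, levelFunction_of_isDecreasing (hasFinitePrimitive_of_mem_sum hwo) hd]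
    with z hNz hwz
  rw [hNz, hwz]

theorem isImage_level_Linfty {n : ℝ≥0} (hn : IsLevelConstant 𝕜 n) {x y : L0 𝕜}
    (hx : x ∈ (coupleL1LevelLinfty 𝕜).sum) (hy : y ∈ (coupleL1Linfty 𝕜).sum)
    (h : ∀ t : ℝ≥0, 0 < t → (coupleL1Linfty 𝕜).K t y ≤ (coupleL1LevelLinfty 𝕜).K t x) :
    IsImage n (coupleL1LevelLinfty 𝕜) (coupleL1Linfty 𝕜) x y := by
  obtain ⟨w, hw, hyw, hwy⟩ := exists_rearrangement hy
  have hxw : IsImage 1 (coupleL1LevelLinfty 𝕜) (coupleL1LevelLinfty 𝕜) x w :=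
    isImage_level_level hx fun t ht =>
      (K_level_le_K t w).trans <| (hyw.K_le ht).trans (h t ht)
  exact (hxw.one_trans (isImage_level_Linfty_of_isDecreasing hn hyw.mem_right hw)).trans_one hwy

end Pairs

/-! ### The staircase function -/

section Staircase

open CompatibleCouple

variable {𝕜 : Type*} [RCLike 𝕜]

variable (𝕜) in
/-- The characteristic function of `[a, b)`. -/
noncomputable def indicatorIco (a b : ℝ) : L0 𝕜 :=
  AEEqFun.mk ((Ico a b).indicator fun _ => (1 : 𝕜))
    (measurable_const.indicator measurableSet_Ico).aestronglyMeasurable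

theorem coeFn_indicatorIco (a b : ℝ) :
    ∀ᵐ x ∂halfLine, indicatorIco 𝕜 a b x = (Ico a b).indicator (fun _ => (1 : 𝕜)) x :=
  AEEqFun.coeFn_mk _ _

theorem enorm_indicatorIco (a b : ℝ) : ∀ᵐ x ∂halfLine,
    ‖indicatorIco 𝕜 a b x‖ₑ = (Ico a b).indicator (fun _ => (1 : ℝ≥0∞)) x := by
  filter_upwards [coeFn_indicatorIco (𝕜 := 𝕜) a b] with x hx
  rw [hx]
  by_cases h : x ∈ Ico a b <;> simp [h]

theorem indicatorIco_add {a b c : ℝ} (hab : a ≤ b) (hbc : b ≤ c) :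
    indicatorIco 𝕜 a b + indicatorIco 𝕜 b c = indicatorIco 𝕜 a c := by
  refine AEEqFun.ext ?_
  filter_upwards [AEEqFun.coeFn_add (indicatorIco 𝕜 a b) (indicatorIco 𝕜 b c),
    coeFn_indicatorIco (𝕜 := 𝕜) a b, coeFn_indicatorIco (𝕜 := 𝕜) b c,
    coeFn_indicatorIco (𝕜 := 𝕜) a c] with x h1 h2 h3 h4
  rw [h1, Pi.add_apply, h2, h3, h4, ← Ico_union_Ico_eq_Ico hab hbc, indicator_union_of_disjoint
    (Ico_disjoint_Ico_same)]

theorem setLIntegral_indicatorIco_le {s : Set ℝ} (hs : s ⊆ Ioi 0) (a b : ℝ) :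
    ∫⁻ x in s, ‖indicatorIco 𝕜 a b x‖ₑ ≤ volume (Ico a b ∩ s) := by
  rw [lintegral_congr_ae (ae_restrict_of_ae_restrict_of_subset hs (enorm_indicatorIco a b)),
    lintegral_indicator_const measurableSet_Ico, one_mul, Measure.restrict_apply measurableSet_Ico]

theorem levelNorm_indicatorIco_le_one (a b : ℝ) : levelNorm (indicatorIco 𝕜 a b) ≤ 1 :=
  (levelNorm_le_iff _ _).2 fun x _ =>
    (setLIntegral_indicatorIco_le Ioo_subset_Ioi_self a b).trans <|
      (measure_mono inter_subset_right).trans (by rw [Real.volume_Ioo, sub_zero, one_mul])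

theorem levelNorm_indicatorIco_one_two_le :
    levelNorm (indicatorIco 𝕜 1 2) ≤ ENNReal.ofReal (1 / 2) := by
  refine (levelNorm_le_iff _ _).2 fun x _ =>
    (setLIntegral_indicatorIco_le Ioo_subset_Ioi_self 1 2).trans ?_
  calc volume (Ico 1 2 ∩ Ioo 0 x) ≤ volume (Ico 1 (min 2 x)) :=
        measure_mono fun z hz => ⟨hz.1.1, lt_min hz.1.2 hz.2.2⟩
    _ ≤ ENNReal.ofReal (1 / 2) * ENNReal.ofReal x := by
        rw [Real.volume_Ico, ← ENNReal.ofReal_mul (by norm_num)]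
        refine ENNReal.ofReal_le_ofReal ?_
        rcases le_total x 2 with h | h
        · rw [min_eq_right h]; linarith only [h]
        · rw [min_eq_left h]; linarith only [h]

theorem nrm_L1_indicatorIco_le (a b : ℝ) :
    (lebesgue 𝕜 1 le_rfl).nrm (indicatorIco 𝕜 a b) ≤ ENNReal.ofReal (b - a) := by
  rw [nrm_L1, ← Real.volume_Ico]
  exact (setLIntegral_indicatorIco_le subset_rfl a b).trans (measure_mono inter_subset_left)

variable (𝕜) in
/-- The step function with the values `2` on `[0, 1)`, `1` on `[1, 2)` and `0` elsewhere. -/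
noncomputable def staircase : L0 𝕜 := indicatorIco 𝕜 0 1 + indicatorIco 𝕜 0 2

theorem staircase_ae : ∀ᵐ x ∂halfLine, staircase 𝕜 x =
    (Ico 0 1).indicator (fun _ => (1 : 𝕜)) x + (Ico 0 2).indicator (fun _ => (1 : 𝕜)) x := by
  filter_upwards [AEEqFun.coeFn_add (indicatorIco 𝕜 0 1) (indicatorIco 𝕜 0 2),
    coeFn_indicatorIco (𝕜 := 𝕜) 0 1, coeFn_indicatorIco (𝕜 := 𝕜) 0 2] with x h h₁ h₂
  rw [staircase, h, Pi.add_apply, h₁, h₂]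

theorem isDecreasing_staircase : IsDecreasing (staircase 𝕜) := by
  refine ⟨fun x => (Iio 1).indicator (fun _ => (1 : ℝ)) x + (Iio 2).indicator (fun _ => 1) x,
    (measurable_const.indicator measurableSet_Iio).add
      (measurable_const.indicator measurableSet_Iio), ?_, fun x => ?_, ?_⟩
  · have h : ∀ c : ℝ, Antitone ((Iio c).indicator fun _ => (1 : ℝ)) := fun c x y hxy => by
      by_cases hy : y < c
      · rw [indicator_of_mem (mem_Iio.2 hy), indicator_of_mem (mem_Iio.2 (hxy.trans_lt hy))]
      · rw [indicator_of_notMem (s := Iio c) hy]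
        exact indicator_nonneg (fun _ _ => zero_le_one) x
    exact ((h 1).add (h 2)).antitoneOn _
  · exact add_nonneg (indicator_nonneg (fun _ _ => zero_le_one) x)
      (indicator_nonneg (fun _ _ => zero_le_one) x)
  · filter_upwards [staircase_ae (𝕜 := 𝕜), ae_restrict_mem measurableSet_Ioi] with x hstair hx
    have hx' : 0 ≤ x := le_of_lt hx
    rw [hstair]
    simp only [indicator, mem_Ico, mem_Iio, hx', true_and, RCLike.ofReal_add]
    split_ifs <;> simp

theorem le_of_Linfty_le {h : L0 𝕜} {M : ℝ} (hM : 0 ≤ M)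
    (hh : (lebesgue 𝕜 ∞ le_top).nrm h ≤ ENNReal.ofReal M) : ∀ᵐ x ∂halfLine, ‖h x‖ ≤ M := by
  filter_upwards [(nrm_Linfty_le_iff h _).1 hh] with x hx
  rwa [← ofReal_norm, ENNReal.ofReal_le_ofReal_iff hM] at hx

/-- The functions `u`, `v`, `w` are the images of `χ[0,1)`, `χ[1,2)`, `χ[0,2)`. -/
theorem exists_decomposition_of_isImage_staircase
    (h : IsImage 1 (coupleL1LevelLinfty 𝕜) (coupleL1Linfty 𝕜) (staircase 𝕜) (staircase 𝕜)) :
    ∃ u v w : L0 𝕜, u + v = w ∧ u + w = staircase 𝕜 ∧ ∫⁻ x in Ioi 0, ‖u x‖ₑ ≤ 1 ∧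
      (∀ᵐ x ∂halfLine, ‖v x‖ ≤ 1 / 2) ∧ ∀ᵐ x ∂halfLine, ‖w x‖ ≤ 1 := by
  obtain ⟨hf, T, hT, hTf⟩ := h
  have hbound : ∀ (e : L0 𝕜) (he : e ∈ (coupleL1LevelLinfty 𝕜).sum) {M : ℝ}, 0 ≤ M →
      levelNorm e ≤ ENNReal.ofReal M → ∀ᵐ x ∂halfLine, ‖(T ⟨e, he⟩ : L0 𝕜) x‖ ≤ M := by
    intro e he M hM h
    have hTe := hT.2 ⟨e, he⟩ (h.trans_lt ENNReal.ofReal_lt_top)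
    rw [ENNReal.coe_one, one_mul] at hTe
    exact le_of_Linfty_le hM (hTe.trans h)
  have hmem : ∀ a b, indicatorIco 𝕜 a b ∈ (coupleL1LevelLinfty 𝕜).sum := fun a b =>
    mem_sum_right ((levelNorm_indicatorIco_le_one a b).trans_lt ENNReal.one_lt_top)
  have hadd : ∀ {a b c : L0 𝕜} (ha : a ∈ (coupleL1LevelLinfty 𝕜).sum)
      (hb : b ∈ (coupleL1LevelLinfty 𝕜).sum) (hc : c ∈ (coupleL1LevelLinfty 𝕜).sum), a + b = c →
      (T ⟨a, ha⟩ : L0 𝕜) + T ⟨b, hb⟩ = T ⟨c, hc⟩ := by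
    rintro a b _ ha hb _ rfl
    exact (congrArg Subtype.val (map_add T ⟨a, ha⟩ ⟨b, hb⟩)).symm
  refine ⟨T ⟨_, hmem 0 1⟩, T ⟨_, hmem 1 2⟩, T ⟨_, hmem 0 2⟩,
    hadd _ _ _ (indicatorIco_add zero_le_one one_le_two), (hadd _ _ hf rfl).trans hTf, ?_,
    hbound _ _ (by norm_num) levelNorm_indicatorIco_one_two_le,
    hbound _ _ zero_le_one ((levelNorm_indicatorIco_le_one 0 2).trans_eq ENNReal.ofReal_one.symm)⟩
  have hL1 : (lebesgue 𝕜 1 le_rfl).nrm (indicatorIco 𝕜 0 1) ≤ 1 :=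
    (nrm_L1_indicatorIco_le 0 1).trans_eq (by rw [sub_zero, ENNReal.ofReal_one])
  have hTL1 := hT.1 ⟨_, hmem 0 1⟩ (hL1.trans_lt ENNReal.one_lt_top)
  rw [ENNReal.coe_one, one_mul] at hTL1
  exact (nrm_L1 _).ge.trans (hTL1.trans hL1)

theorem one_le_norm_of_add_eq_two {a b : 𝕜} (h : a + b = 2) (hb : ‖b‖ ≤ 1) : 1 ≤ ‖a‖ := by
  have htri := norm_add_le a b
  rw [h, RCLike.norm_two] at htri
  linarith only [htri, hb]

theorem quarter_le_norm_of_add_add_eq_one {a b : 𝕜} (h : a + (a + b) = 1) (hb : ‖b‖ ≤ 1 / 2) :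
    1 / 4 ≤ ‖a‖ := by
  have htri : ‖a + a + b‖ ≤ ‖a‖ + ‖a‖ + ‖b‖ := norm_add₃_le
  rw [add_assoc, h, norm_one] at htri
  linarith only [htri, hb]

theorem five_quarters_le_lintegral {u v w : L0 𝕜} (huv : u + v = w) (huw : u + w = staircase 𝕜)
    (hv : ∀ᵐ x ∂halfLine, ‖v x‖ ≤ 1 / 2) (hw : ∀ᵐ x ∂halfLine, ‖w x‖ ≤ 1) :
    ENNReal.ofReal (5 / 4) ≤ ∫⁻ x in Ioi 0, ‖u x‖ₑ := by
  have hlow : ∀ᵐ x ∂halfLine, (Ioo 0 1).indicator (fun _ => ENNReal.ofReal 1) x +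
      (Ico 1 2).indicator (fun _ => ENNReal.ofReal (1 / 4)) x ≤ ‖u x‖ₑ := by
    filter_upwards [huv ▸ AEEqFun.coeFn_add u v, huw ▸ AEEqFun.coeFn_add u w, staircase_ae (𝕜 := 𝕜),
      hv, hw] with x hwx hsx hstair hvx hwx'
    rw [hsx, Pi.add_apply] at hstair
    rw [← ofReal_norm (u x)]
    by_cases h₁ : x ∈ Ioo (0 : ℝ) 1
    · have h₂ : x ∉ Ico (1 : ℝ) 2 := fun h => absurd h₁.2 h.1.not_gt
      rw [indicator_of_mem (Ioo_subset_Ico_self h₁), indicator_of_mem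
        (Ico_subset_Ico_right one_le_two (Ioo_subset_Ico_self h₁)), one_add_one_eq_two] at hstair
      rw [indicator_of_mem h₁, indicator_of_notMem h₂, add_zero]
      exact ENNReal.ofReal_le_ofReal (one_le_norm_of_add_eq_two hstair hwx')
    by_cases h₂ : x ∈ Ico (1 : ℝ) 2
    · rw [indicator_of_notMem fun h => h₂.1.not_gt h.2, indicator_of_mem
        (Ico_subset_Ico_left zero_le_one h₂), zero_add, hwx, Pi.add_apply] at hstair
      rw [indicator_of_notMem h₁, indicator_of_mem h₂, zero_add]
      exact ENNReal.ofReal_le_ofReal (quarter_le_norm_of_add_add_eq_one hstair hvx)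
    · rw [indicator_of_notMem h₁, indicator_of_notMem h₂, add_zero]
      exact zero_le
  have hIco : Ico (1 : ℝ) 2 ⊆ Ioi 0 := fun _ hx => zero_lt_one.trans_le hx.1
  refine le_trans (le_of_eq ?_) (lintegral_mono_ae hlow)
  rw [lintegral_add_left (measurable_const.indicator measurableSet_Ioo),
    lintegral_indicator_const measurableSet_Ioo, lintegral_indicator_const measurableSet_Ico,
    Measure.restrict_eq_self _ Ioo_subset_Ioi_self, Measure.restrict_eq_self _ hIco,
    Real.volume_Ioo, Real.volume_Ico,
    ← ENNReal.ofReal_mul (by norm_num), ← ENNReal.ofReal_mul (by norm_num),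
    ← ENNReal.ofReal_add (by norm_num) (by norm_num)]
  norm_num

theorem not_isImage_staircase :
    ¬ IsImage 1 (coupleL1LevelLinfty 𝕜) (coupleL1Linfty 𝕜) (staircase 𝕜) (staircase 𝕜) := by
  intro h
  obtain ⟨u, v, w, huv, huw, hu, hv, hw⟩ := exists_decomposition_of_isImage_staircase h
  have hle := (five_quarters_le_lintegral huv huw hv hw).trans hu
  rw [ENNReal.ofReal_le_one] at hle
  norm_num at hle

theorem not_isExactRelativeCMPair_level_Linfty :
    ¬ IsExactRelativeCMPair (coupleL1LevelLinfty 𝕜) (coupleL1Linfty 𝕜) := fun h => by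
  have hf' : staircase 𝕜 ∈ (coupleL1Linfty 𝕜).sum := by
    refine add_mem (mem_sum_left ?_) (mem_sum_left ?_) <;>
      exact (nrm_L1_indicatorIco_le _ _).trans_lt ENNReal.ofReal_lt_top
  obtain ⟨T, hT, hTf⟩ := h ⟨staircase 𝕜, sum_le_sum_level hf'⟩ ⟨staircase 𝕜, hf'⟩ fun t ht =>
    (K_le_lintegral isDecreasing_staircase ht).trans (lintegral_le_K _ ht)
  exact not_isImage_staircase ⟨_, T, hT, congrArg Subtype.val hTf⟩

end Staircase

end CalderonMityagin

theorem theorem3p6 (𝕜 : Type*) [RCLike 𝕜] :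
    IsLevelConstant 𝕜 2 ∧
    ∀ n : NNReal, IsLevelConstant 𝕜 n →
      CompatibleCouple.IsExactCMCouple (coupleL1LevelLinfty 𝕜) ∧
      CompatibleCouple.IsExactRelativeCMPair (coupleL1Linfty 𝕜) (coupleL1LevelLinfty 𝕜) ∧
      CompatibleCouple.IsRelativeCMPair n (coupleL1LevelLinfty 𝕜) (coupleL1Linfty 𝕜) ∧
      ¬ CompatibleCouple.IsExactRelativeCMPair (coupleL1LevelLinfty 𝕜) (coupleL1Linfty 𝕜) :=
  ⟨isLevelConstant_two, fun _ hn =>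
    ⟨CompatibleCouple.isRelativeCMPair_of_isImage fun _ hx _ _ => isImage_level_level hx,
      CompatibleCouple.isRelativeCMPair_of_isImage fun _ hx _ _ => isImage_Linfty_level hx,
      CompatibleCouple.isRelativeCMPair_of_isImage fun _ hx _ hy => isImage_level_Linfty hn hx hy,
      not_isExactRelativeCMPair_level_Linfty⟩⟩
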